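/- **Setting.** Let $\mathfrak g$ be a finite-dimensional simple Lie algebra over $\mathbb C$ with Killing form $\langle\cdot|\cdot\rangle$, let $\epsilon\in\mathbb C^\times$, and let $L\mathfrak g$ be the Lie algebra of smooth maps $S^1=\mathbb R/2\pi\mathbb Z\to\mathfrak g$, with the form $(u|v)=\int_{S^1}\langle u(x)|v(x)\rangle\,dx$. A *local functional* on $L\mathfrak g$ is a functional $F(q)=\int_{S^1}p(x;q,\partial_xq,\dots,\partial_x^kq)\,dx$ with $p$ polynomial in the jet coordinates and with coefficients smooth in $x\in S^1$; local functionals on a subset of $L\mathfrak g$ are their restrictions. The gradient $\delta F(q)\in L\mathfrak g$ is defined by $\frac{d}{d\theta}F(q+\theta s)|_{\theta=0}=(\delta F(q)|s)$ for all $s\in L\mathfrak g$. A bracket on local functionals is *Poisson* if it is bilinear, skew-symmetric and satisfies the Jacobi identity; a pair $(B_1,B_2)$ of Poisson brackets is *bihamiltonian* if $B_2+\lambda B_1$ is Poisson for every $\lambda\in\mathbb C$. For $a\in\mathfrak g$, let $\{F,G\}_i(q)=(\delta F(q)\,|\,P_i(q)\,\delta G(q))$, where $$P_1(q)(v)=\tfrac1\epsilon[a,v],\qquad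 P_2(q)(v)=\tfrac1\epsilon[\epsilon\partial_x+q,v].$$ Let $\{e,h,f\}\subset\mathfrak g$ satisfy $[h,e]=2e$, $[h,f]=-2f$, $[e,f]=h$, and put $Q=e+L(\ker\operatorname{ad}f)$. A *choice* is a pair $(\Gamma,\mathfrak l)$ where * $\Gamma:\mathfrak g=\bigoplus_{i\in\mathbb Z}\mathfrak g_i$ is a Lie algebra grading with $e\in\mathfrak g_2$, $h\in\mathfrak g_0$, $f\in\mathfrak g_{-2}$ that is good for $f$: $\operatorname{ad}f:\mathfrak g_j\to\mathfrak g_{j-2}$ is injective for $j\ge1$ and surjective for $j\le1$; * $\mathfrak l\subset\mathfrak g_{-1}$ is a subspace that is isotropic for the form $(x,y)\mapsto\langle e|[x,y]\rangle$ on $\mathfrak g_{-1}$. Given a choice, let $\mathfrak l'\subset\mathfrak g_{-1}$ be the orthogonal of $\mathfrak l$ for this form, $\mathfrak n=\mathfrak l'\oplus\bigoplus_{i\le-2}\mathfrak g_i$, $\mathfrak b$ the orthogonal complement of $\mathfrak n$ under the Killing form, and $S=e+L\mathfrak b\supset Q$. The choice is *adapted* to $a\in\mathfrak g$ if $[a,\mathfrak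 n]=0$. An *invariant extension* of a local functional $u$ on $Q$ is a local functional $F$ on $L\mathfrak g$ with $F|_Q=u$ whose differential at every $s\in S$ vanishes on $P_2(s)(L\mathfrak n)$. A pair $(B_1,B_2)$ of bilinear brackets on the local functionals on $Q$ is a *reduction of $(P_1,P_2)$ to $Q$ by the choice* if every local functional on $Q$ has an invariant extension, and for all local functionals $u,v$ on $Q$ and all invariant extensions $F$ of $u$ and $G$ of $v$ the gradients of $F$ and $G$ exist at the points of $Q$ and $B_i(u,v)=\{F,G\}_i|_Q$ for $i=1,2$. **Theorem.** 1. For every triple $\{e,h,f\}$ as above there is a Poisson bracket $P_2^Q$ on $Q$ (the classical $W$-algebra) such that for every $a\in\mathfrak g$ there is a Poisson bracket $P_1^Q$ on $Q$ for which $(P_1^Q,P_2^Q)$ is bihamiltonian and the following holds: for every choice $(\Gamma,\mathfrak l)$ adapted to $a$, $(P_1^Q,P_2^Q)$ is the one and only reduction of $(P_1,P_2)$ to $Q$ by this choice. So the reduced bihamiltonian structure exists and does not depend on the good grading or on the isotropic subspace, and $P_2^Q$ does not depend on $a$ either. 2. Let $\{e,h,f\}$ and $\{e',h',f'\}$ be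 two such triples, with $f$ and $f'$ in the same orbit of the adjoint group (the group generated by all $\exp(\operatorname{ad}x)$, $x\in\mathfrak g$). Then some element of the adjoint group carries $(e,h,f)$ to $(e',h',f')$. Every such element $\varphi$ carries the reduced bihamiltonian structure on $e+L(\ker\operatorname{ad}f)$ obtained from any $a$ and any choice adapted to $a$ to the reduced bihamiltonian structure on $e'+L(\ker\operatorname{ad}f')$ obtained from $\varphi(a)$ and any choice adapted to $\varphi(a)$. In particular, up to the isomorphisms induced by the adjoint group, $P_2^Q$ depends only on the nilpotent orbit of $f$. -/

import Mathlib

open scoped ContDiff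

namespace LoopReduction

noncomputable section

/-! ## Smooth loops -/

/-- Smooth complex functions on the circle `ℝ / 2πℤ`, viewed as `2π`-periodic functions on `ℝ`. -/
def circleFun : Subalgebra ℂ (ℝ → ℂ) where
  carrier := {u | ContDiff ℝ ∞ u ∧ Function.Periodic u (2 * Real.pi)}
  mul_mem' := fun hu hv => ⟨hu.1.mul hv.1, hu.2.mul hv.2⟩
  add_mem' := fun hu hv => ⟨hu.1.add hv.1, hu.2.add hv.2⟩
  algebraMap_mem' := fun _ => ⟨contDiff_const, fun _ => rfl⟩

section Loops

variable (V : Type*) [AddCommGroup V] [Module ℂ V]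

/-- The loop space of a finite-dimensional complex vector space `V`: the `2π`-periodic maps
`ℝ → V` all of whose linear coordinates are smooth. -/
def Loop : Submodule ℂ (ℝ → V) where
  carrier := {q | Function.Periodic q (2 * Real.pi) ∧
    ∀ ℓ : Module.Dual ℂ V, ContDiff ℝ ∞ (fun x => ℓ (q x))}
  add_mem' := fun hu hv => ⟨hu.1.add hv.1, fun ℓ => by
    simpa using (hu.2 ℓ).add (hv.2 ℓ)⟩
  zero_mem' := ⟨fun _ => rfl, fun ℓ => by simpa using contDiff_const⟩
  smul_mem' := fun c u hu => ⟨fun x => by simp [hu.1 x], fun ℓ => by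
    simpa using (contDiff_const (c := c)).mul (hu.2 ℓ)⟩

variable {V}

/-- The constant loop at `a`. -/
def Loop.const (a : V) : Loop V :=
  ⟨fun _ => a, fun _ => rfl, fun _ => contDiff_const⟩

/-- Composition of a loop with a linear automorphism. -/
def Loop.map (φ : V ≃ₗ[ℂ] V) (q : Loop V) : Loop V :=
  ⟨fun x => φ (q.1 x), fun x => by simp [q.2.1 x],
    fun ℓ => q.2.2 (ℓ ∘ₗ (φ : V →ₗ[ℂ] V))⟩

/-- The derivative `∂ₓ q` of a loop, computed in a basis; `Loop.dual_deriv` shows that it does not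
depend on the basis. -/
def Loop.deriv [FiniteDimensional ℂ V] (q : Loop V) : Loop V :=
  ⟨fun x => ∑ i, _root_.deriv (fun t => (Module.finBasis ℂ V).coord i (q.1 t)) x •
      Module.finBasis ℂ V i, by
    refine ⟨fun x => ?_, fun ℓ => ?_⟩
    · refine Finset.sum_congr rfl fun i _ => ?_
      congr 1
      rw [← deriv_comp_add_const]
      congr 1
      funext t
      rw [q.2.1 t]
    · simp only [map_sum, map_smul, smul_eq_mul]
      refine ContDiff.sum fun i _ => ContDiff.mul ?_ contDiff_const
      exact ((contDiff_infty_iff_deriv).1 (q.2.2 ((Module.finBasis ℂ V).coord i))).2⟩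

theorem Loop.dual_deriv [FiniteDimensional ℂ V] (q : Loop V) (ℓ : Module.Dual ℂ V) (x : ℝ) :
    ℓ ((Loop.deriv q).1 x) = _root_.deriv (fun t => ℓ (q.1 t)) x := by
  have h : (fun t => ℓ (q.1 t)) = fun t => ∑ i, (Module.finBasis ℂ V).coord i (q.1 t) *
      ℓ (Module.finBasis ℂ V i) := by
    funext t
    conv_lhs => rw [← (Module.finBasis ℂ V).sum_repr (q.1 t)]
    simp only [map_sum, map_smul, smul_eq_mul, Module.Basis.coord_apply]
  have hd : ∀ i, DifferentiableAt ℝ (fun t => (Module.finBasis ℂ V).coord i (q.1 t)) x :=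
    fun i => (q.2.2 ((Module.finBasis ℂ V).coord i)).differentiable (by simp) x
  rw [h, deriv_fun_sum fun i _ => (hd i).mul_const _]
  simp only [Loop.deriv, map_sum, map_smul, smul_eq_mul]
  exact Finset.sum_congr rfl fun i _ => (deriv_mul_const (hd i) _).symm

end Loops

/-! ## Local functionals -/

section Functionals

variable (V : Type*) [AddCommGroup V] [Module ℂ V]

/-- Densities of local functionals: polynomials in the symbols `(ℓ, k)`, standing for the jet
coordinate `∂ₓᵏ (ℓ ∘ q)`, with coefficients in the smooth functions of the point of the circle. -/
abbrev Density := MvPolynomial (Module.Dual ℂ V × ℕ) circleFun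

variable {V}

/-- Evaluation of a smooth function on the circle at the point `x`. -/
def evalAt (x : ℝ) : circleFun →+* ℂ := (Pi.evalRingHom (fun _ : ℝ => ℂ) x).comp circleFun.val

/-- The value at `x` of the density `p` on the loop `q`. -/
def Density.value (p : Density V) (q : Loop V) (x : ℝ) : ℂ :=
  MvPolynomial.eval₂ (evalAt x) (fun j => iteratedDeriv j.2 (fun t => j.1 (q.1 t)) x) p

theorem Density.continuous_value (p : Density V) (q : Loop V) : Continuous (p.value q) := by
  unfold Density.value
  induction p using MvPolynomial.induction_on with
  | C a => simpa [evalAt] using a.2.1.continuous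
  | add p r hp hr =>
    simp only [MvPolynomial.eval₂_add]
    exact hp.add hr
  | mul_X p j hp =>
    simp only [MvPolynomial.eval₂_mul, MvPolynomial.eval₂_X]
    exact hp.mul ((q.2.2 j.1).continuous_iteratedDeriv j.2 (by exact_mod_cast le_top))

/-- The local functional `q ↦ ∫ p(x, q, ∂ₓ q, ∂ₓ² q, …) dx` with density `p`. -/
def functional : Density V →ₗ[ℂ] (Loop V → ℂ) where
  toFun p := fun q => ∫ x in (0 : ℝ)..(2 * Real.pi), p.value q x
  map_add' p r := by
    funext q
    have h : ∀ x, Density.value (p + r) q x = p.value q x + r.value q x := fun x => by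
      simp [Density.value]
    simp only [h, Pi.add_apply]
    exact intervalIntegral.integral_add ((p.continuous_value q).intervalIntegrable _ _)
      ((r.continuous_value q).intervalIntegrable _ _)
  map_smul' c p := by
    funext q
    have h : ∀ x, Density.value (c • p) q x = c * p.value q x := fun x => by
      have hc : c • p = MvPolynomial.C (algebraMap ℂ circleFun c) * p := by
        rw [← MvPolynomial.smul_eq_C_mul, algebraMap_smul]
      rw [hc]
      simp only [Density.value, MvPolynomial.eval₂_mul, MvPolynomial.eval₂_C]
      rfl
    simp only [h, Pi.smul_apply, smul_eq_mul, RingHom.id_apply]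
    exact intervalIntegral.integral_const_mul _ _

variable (V) in
/-- The space of local functionals on the loop space of `V`. -/
def localFunctionals : Submodule ℂ (Loop V → ℂ) := LinearMap.range functional

/-- The space of local functionals on a subset `Z` of the loop space. -/
def localFunctionalsOn (Z : Set (Loop V)) : Submodule ℂ (Z → ℂ) :=
  (localFunctionals V).map (LinearMap.funLeft ℂ ℂ (Subtype.val : Z → Loop V))

/-- Bilinear brackets on the local functionals on `Z`. -/
abbrev LocalBracket (Z : Set (Loop V)) :=
  localFunctionalsOn Z →ₗ[ℂ] localFunctionalsOn Z →ₗ[ℂ] localFunctionalsOn Z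

/-- A bracket on local functionals is Poisson if it is skew-symmetric and satisfies the Jacobi
identity. -/
def LocalBracket.IsPoisson {Z : Set (Loop V)} (B : LocalBracket Z) : Prop :=
  (∀ u v, B u v = -B v u) ∧ ∀ u v w, B u (B v w) + B v (B w u) + B w (B u v) = 0

/-- Two Poisson brackets form a bihamiltonian structure if all members `B₂ + c B₁` of their pencil
are Poisson brackets. -/
def IsBihamiltonian {Z : Set (Loop V)} (B₁ B₂ : LocalBracket Z) : Prop :=
  B₁.IsPoisson ∧ B₂.IsPoisson ∧ ∀ c : ℂ, LocalBracket.IsPoisson (B₂ + c • B₁)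

/-- The bracket `B` on `Z` is carried to the bracket `C` on `Y` by the map that the linear
automorphism `φ` induces on loops (to be used when that map restricts to a bijection `Z → Y`). -/
def Intertwines (φ : V ≃ₗ[ℂ] V) {Z Y : Set (Loop V)} (B : LocalBracket Z) (C : LocalBracket Y) :
    Prop :=
  ∀ (u v : localFunctionalsOn Z) (u' v' : localFunctionalsOn Y),
    (∀ (z : Z) (y : Y), y.1 = Loop.map φ z.1 → u'.1 y = u.1 z) →
    (∀ (z : Z) (y : Y), y.1 = Loop.map φ z.1 → v'.1 y = v.1 z) →
    ∀ (z : Z) (y : Y), y.1 = Loop.map φ z.1 → (C u' v').1 y = (B u v).1 z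

end Functionals

/-! ## The bihamiltonian structure on the loop algebra -/

section LieAlgebra

variable {𝔤 : Type*} [LieRing 𝔤] [LieAlgebra ℂ 𝔤] [FiniteDimensional ℂ 𝔤]

/-- The pointwise Lie bracket of two loops. -/
def Loop.lie (q v : Loop 𝔤) : Loop 𝔤 :=
  ⟨fun x => ⁅q.1 x, v.1 x⁆, fun x => by simp [q.2.1 x, v.2.1 x], fun ℓ => by
    have h : (fun x => ℓ ⁅q.1 x, v.1 x⁆) = fun x => ∑ i, (Module.finBasis ℂ 𝔤).coord i (q.1 x) *
        ℓ ⁅Module.finBasis ℂ 𝔤 i, v.1 x⁆ := by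
      funext x
      conv_lhs => rw [← (Module.finBasis ℂ 𝔤).sum_repr (q.1 x)]
      simp only [sum_lie, smul_lie, map_sum, map_smul, smul_eq_mul, Module.Basis.coord_apply]
    rw [h]
    exact ContDiff.sum fun i _ => (q.2.2 _).mul
      (v.2.2 (ℓ ∘ₗ (LieAlgebra.ad ℂ 𝔤 (Module.finBasis ℂ 𝔤 i))))⟩

/-- The bilinear form `(u | v) = ∫ ⟨u(x) | v(x)⟩ dx` on loops, with `⟨· | ·⟩` the Killing form. -/
def pairing (u v : Loop 𝔤) : ℂ :=
  ∫ x in (0 : ℝ)..(2 * Real.pi), killingForm ℂ 𝔤 (u.1 x) (v.1 x)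

/-- `v` is the gradient of the functional `F` at the loop `q`. -/
def IsGradient (F : Loop 𝔤 → ℂ) (q v : Loop 𝔤) : Prop :=
  ∀ s : Loop 𝔤, HasDerivAt (fun θ : ℂ => F (q + θ • s)) (pairing v s) 0

/-- The Poisson tensor `P₁(q)(v) = ε⁻¹ [a, v]`. -/
def P₁ (ε : ℂ) (a : 𝔤) (_q v : Loop 𝔤) : Loop 𝔤 := ε⁻¹ • Loop.lie (Loop.const a) v

/-- The Poisson tensor `P₂(q)(v) = ε⁻¹ [ε ∂ₓ + q, v]`. -/
def P₂ (ε : ℂ) (q v : Loop 𝔤) : Loop 𝔤 := ε⁻¹ • (ε • Loop.deriv v + Loop.lie q v)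

/-- For the Poisson tensor `P`, the bracket `{F, G} = (δF | P δG)` of the functionals `F` and `G`
at the loop `q` is defined and equal to `c`. -/
def BracketAt (P : Loop 𝔤 → Loop 𝔤 → Loop 𝔤) (F G : Loop 𝔤 → ℂ) (q : Loop 𝔤) (c : ℂ) : Prop :=
  ∃ v w : Loop 𝔤, IsGradient F q v ∧ IsGradient G q w ∧ pairing v (P q w) = c

/-! ## Good gradings and the reduction -/

/-- The relations of an `sl₂`-triple `{e, h, f}`. Unlike in `IsSl2Triple`, the triple `{0, 0, 0}`
attached to the zero orbit is allowed. -/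
structure IsTriple (e h f : 𝔤) : Prop where
  lie_h_e : ⁅h, e⁆ = (2 : ℂ) • e
  lie_h_f : ⁅h, f⁆ = -((2 : ℂ) • f)
  lie_e_f : ⁅e, f⁆ = h

/-- A good grading for `f`, compatible with the triple `{e, h, f}`. -/
structure GoodGrading (e h f : 𝔤) where
  /-- the homogeneous components -/
  comp : ℤ → Submodule ℂ 𝔤
  isInternal : DirectSum.IsInternal comp
  lie_mem : ∀ i j : ℤ, ∀ x ∈ comp i, ∀ y ∈ comp j, ⁅x, y⁆ ∈ comp (i + j)
  e_mem : e ∈ comp 2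
  h_mem : h ∈ comp 0
  f_mem : f ∈ comp (-2)
  injective : ∀ j : ℤ, 1 ≤ j → ∀ x ∈ comp j, ⁅f, x⁆ = 0 → x = 0
  surjective : ∀ j : ℤ, j ≤ 1 → ∀ y ∈ comp (j - 2), ∃ x ∈ comp j, ⁅f, x⁆ = y

/-- The choices made in the reduction: a good grading, and a subspace `iso` of its component of
degree `-1` that is isotropic for the form `(x, y) ↦ ⟨e | [x, y]⟩`. -/
structure ReductionDatum (e h f : 𝔤) extends GoodGrading e h f where
  /-- the isotropic subspace -/
  iso : Submodule ℂ 𝔤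
  iso_le : iso ≤ comp (-1)
  isotropic : ∀ x ∈ iso, ∀ y ∈ iso, killingForm ℂ 𝔤 e ⁅x, y⁆ = 0

namespace ReductionDatum

variable {e h f : 𝔤} (d : ReductionDatum e h f)

/-- The coisotropic subspace: the orthogonal of the isotropic subspace in degree `-1`. -/
def coiso : Submodule ℂ 𝔤 where
  carrier := {x | x ∈ d.comp (-1) ∧ ∀ y ∈ d.iso, killingForm ℂ 𝔤 e ⁅x, y⁆ = 0}
  add_mem' := fun {x y} hx hy => ⟨add_mem hx.1 hy.1, fun z hz => by
    simp [add_lie, hx.2 z hz, hy.2 z hz]⟩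
  zero_mem' := ⟨zero_mem _, fun z _ => by simp⟩
  smul_mem' := fun c x hx => ⟨Submodule.smul_mem _ c hx.1, fun z hz => by
    simp [smul_lie, hx.2 z hz]⟩

/-- The subalgebra `𝔫`: the sum of the coisotropic subspace and all components of degree at
most `-2`. -/
def nil : Submodule ℂ 𝔤 := d.coiso ⊔ ⨆ i : {i : ℤ // i ≤ -2}, d.comp i.1

/-- The orthogonal complement `𝔟` of `𝔫` for the Killing form. -/
def borel : Submodule ℂ 𝔤 := (killingForm ℂ 𝔤).orthogonal d.nil

/-- The condition on `a` under which the reduction of `P₁` with these choices is defined: `a`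
centralizes `𝔫`. -/
def Adapted (a : 𝔤) : Prop := ∀ n ∈ d.nil, ⁅a, n⁆ = 0

/-- The level surface `S = e + L𝔟`. -/
def S : Set (Loop 𝔤) := {s | ∀ x, s.1 x - e ∈ d.borel}

end ReductionDatum

/-- The affine loop space `Q = e + L(ker ad f)`. -/
def Q (e f : 𝔤) : Set (Loop 𝔤) := {z | ∀ x, ⁅f, z.1 x - e⁆ = 0}

/-- `F` is a local functional on the loop algebra that extends the functional `u` on `Q` and is
constant along the distribution `D = P₂(L𝔫)`, that is, at the points of `S` its differential
vanishes on `D`. -/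
structure IsExtension {e h f : 𝔤} (d : ReductionDatum e h f) (ε : ℂ) (u : Q e f → ℂ)
    (F : Loop 𝔤 → ℂ) : Prop where
  isLocal : F ∈ localFunctionals 𝔤
  restrict : ∀ z : Q e f, F z.1 = u z
  constant : ∀ s ∈ d.S, ∀ n : Loop 𝔤, (∀ x, n.1 x ∈ d.nil) →
    HasDerivAt (fun θ : ℂ => F (s + θ • P₂ ε s n)) 0 0

/-- The bracket `B` on `Q` is the reduction of the Poisson tensor `P` with the choices `d`: every
local functional on `Q` has an extension that is constant along `D`, and the bracket of two
functionals on `Q` is the restriction to `Q` of the bracket of any such extensions. -/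
def IsReducedBracket {e h f : 𝔤} (d : ReductionDatum e h f) (ε : ℂ)
    (P : Loop 𝔤 → Loop 𝔤 → Loop 𝔤) (B : LocalBracket (Q e f)) : Prop :=
  (∀ u : localFunctionalsOn (Q e f), ∃ F, IsExtension d ε u.1 F) ∧
  ∀ (u v : localFunctionalsOn (Q e f)) (F G : Loop 𝔤 → ℂ),
    IsExtension d ε u.1 F → IsExtension d ε v.1 G →
    ∀ z : Q e f, BracketAt P F G z.1 ((B u v).1 z)

/-- `(B₁, B₂)` is the reduction to `Q` of the pair `(P₁, P₂)` with the choices `d`. -/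
def IsReduction {e h f : 𝔤} (d : ReductionDatum e h f) (ε : ℂ) (a : 𝔤)
    (B₁ B₂ : LocalBracket (Q e f)) : Prop :=
  IsReducedBracket d ε (P₁ ε a) B₁ ∧ IsReducedBracket d ε (P₂ ε) B₂

variable (𝔤) in
/-- The adjoint group of `𝔤`: the group generated by the maps `exp (ad x)`, for `x` in `𝔤`. The
exponential series is required to converge in every linear coordinate. -/
def adjointGroup : Subgroup (𝔤 ≃ₗ[ℂ] 𝔤) :=
  Subgroup.closure {φ | ∃ x : 𝔤, ∀ (y : 𝔤) (ℓ : Module.Dual ℂ 𝔤),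
    HasSum (fun n : ℕ => (n.factorial : ℂ)⁻¹ * ℓ (((LieAlgebra.ad ℂ 𝔤 x) ^ n) y)) (ℓ (φ y))}

end LieAlgebra

end

end LoopReduction

/-! Every member of the pencil on the loop algebra has the form `v ↦ c₁ ∂v + [c₂ q + b, v]`
(`tensor`), so one computation (`br_jacobi`) proves Jacobi for all of them: the Hessian terms cancel
by symmetry, and the remaining term vanishes by `cyclic_tensor`.

Independence of choices is seen pointwise. Let `F` be an invariant extension and `z ∈ Q`. Invariance
constrains `(ε∂ + ad z) δF(z)` enough that subtracting a loop `n` in `𝔫` from `δF(z)` makes the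
Hamiltonian vector tangent to `Q` (`IsExtension.exists_tangent`). The corrected gradient `v` depends
only on `F|_Q` and the triple: its pairing with `L(ker ad f)` is prescribed, and tangency fixes the
rest because `Q` is transversal to the distribution (`IsTriple.eq_zero_of_covD`). On `L𝔫` each
admissible tensor is a multiple of `P₂`, so the corrections drop out and `{F, G}(z) = (v | P w)`
(`IsExtension.pairing_tensor`). The right side involves neither the grading, nor `𝔩`, nor the
extensions; it is also natural under automorphisms, which gives the transport statement.

Existence of extensions is Drinfeld–Sokolov gauge fixing. The splitting `𝔤 = ker ad f ⊕ [e, im ad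
f]` defines a map `σ` that has degree `-2` for every good grading. The gauge transformation of `s`
by `exp σ(s - e)` pushes the part of `s - e` outside `ker ad f` down the filtration; finitely many
steps end in `Q`. All exponentials are polynomial because `ad n` is nilpotent, so the result is a
differential polynomial retraction, constant along the distribution (`IsTriple.exists_retraction`),
and composing with it extends local functionals.

The Jacobi identity descends because brackets of invariant functionals are invariant
(`br_mem_invariants`), by Jacobi with the linear functionals `(n | ·)`. This is done on the surface
`e + L level`, with `level` the orthogonal of `𝔩 ⊕ 𝔤_{≤ -2}`: it contains `S`, and the distribution
is tangent to it.

Triples with the same `f` are conjugate because `h' - h` lies in negative degrees and can be removed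
degree by degree (`IsTriple.exists_conj`). Throughout, derivatives are taken along polynomial curves
(`HasDir`), so the loop space needs no topology. -/

open scoped ContDiff

namespace LoopReduction

noncomputable section

/-! ## The differential algebra of smooth functions on the circle -/

namespace circleFun

@[ext] theorem ext {u v : circleFun} (h : ∀ x, u.1 x = v.1 x) : u = v :=
  Subtype.ext (funext h)

theorem contDiff (u : circleFun) : ContDiff ℝ ∞ u.1 := u.2.1

theorem differentiable (u : circleFun) : Differentiable ℝ u.1 := u.2.1.differentiable (by simp)

/-- The derivation `∂ₓ`. -/
def D : circleFun →ₗ[ℂ] circleFun where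
  toFun u := ⟨_root_.deriv u.1, (contDiff_infty_iff_deriv.1 u.2.1).2, fun x => by
    rw [← deriv_comp_add_const]
    congr 1
    funext t
    exact u.2.2 t⟩
  map_add' u v := by
    ext x
    exact deriv_add (differentiable u x) (differentiable v x)
  map_smul' c u := by
    ext x
    exact deriv_const_smul c (differentiable u x)

theorem D_mul (u v : circleFun) : D (u * v) = D u * v + u * D v := by
  ext x
  exact deriv_mul (differentiable u x) (differentiable v x)

theorem iterate_D_apply (u : circleFun) (k : ℕ) : ((D ^ k) u).1 = iteratedDeriv k u.1 := by
  induction k with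
  | zero => simp
  | succ k ih =>
    rw [pow_succ', Module.End.mul_apply, iteratedDeriv_succ, ← ih]
    rfl

/-- Integration over the circle. -/
def integral : circleFun →ₗ[ℂ] ℂ where
  toFun u := ∫ x in (0 : ℝ)..(2 * Real.pi), u.1 x
  map_add' u v := intervalIntegral.integral_add ((contDiff u).continuous.intervalIntegrable _ _)
    ((contDiff v).continuous.intervalIntegrable _ _)
  map_smul' c _ := intervalIntegral.integral_const_mul c _

theorem integral_D (u : circleFun) : integral (D u) = 0 := by
  have h := intervalIntegral.integral_deriv_eq_sub (f := u.1) (a := 0) (b := 2 * Real.pi)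
    (fun x _ => differentiable u x) ((contDiff (D u)).continuous.intervalIntegrable _ _)
  have h2 : u.1 (2 * Real.pi) = u.1 0 := by simpa using u.2.2 0
  rw [h2, sub_self] at h
  exact h

theorem integral_D_mul (u v : circleFun) : integral (D u * v) = -integral (u * D v) := by
  have h := integral_D (u * v)
  rw [D_mul, map_add] at h
  exact eq_neg_of_add_eq_zero_left h

/-- Iterated integration by parts; it moves the derivatives off the test loop and so produces
Euler–Lagrange gradients. -/
theorem integral_mul_iterate_D (u v : circleFun) (k : ℕ) :
    integral (u * (D ^ k) v) = integral (((-D) ^ k) u * v) := by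
  induction k generalizing u with
  | zero => simp
  | succ k ih =>
    rw [pow_succ', Module.End.mul_apply, pow_succ, Module.End.mul_apply, ← ih]
    change _ = integral (-D u * (D ^ k) v)
    rw [neg_mul (D u), map_neg, integral_D_mul, neg_neg]

/-- Complex conjugation. -/
def conj (u : circleFun) : circleFun :=
  ⟨fun x => (starRingEnd ℂ) (u.1 x), (ContinuousLinearEquiv.contDiff Complex.conjCLE).comp u.2.1,
    fun x => by
      have := u.2.2 x
      simp [this]⟩

/-- The fundamental lemma of the calculus of variations. Since `conj u` is itself an admissible test
function, no bump functions are needed. -/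
theorem eq_zero_of_integral_mul_conj {u : circleFun} (h : integral (u * conj u) = 0) : u = 0 := by
  have h1 : (∫ x in (0 : ℝ)..(2 * Real.pi), Complex.normSq (u.1 x)) = 0 := by
    have h2 : integral (u * conj u)
        = ((∫ x in (0 : ℝ)..(2 * Real.pi), Complex.normSq (u.1 x) : ℝ) : ℂ) := by
      rw [← intervalIntegral.integral_ofReal]
      refine intervalIntegral.integral_congr fun x _ => ?_
      exact Complex.mul_conj (u.1 x)
    rw [h2] at h
    exact_mod_cast h
  have hc : Continuous fun x => Complex.normSq (u.1 x) :=
    Complex.continuous_normSq.comp (contDiff u).continuous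
  have h0 : ∀ x ∈ Set.Icc (0 : ℝ) (2 * Real.pi), u.1 x = 0 := by
    intro x hx
    by_contra hne
    have := intervalIntegral.integral_pos (f := fun x => Complex.normSq (u.1 x))
      (by positivity : (0 : ℝ) < 2 * Real.pi) hc.continuousOn
      (fun x _ => Complex.normSq_nonneg _) ⟨x, hx, Complex.normSq_pos.2 hne⟩
    exact this.ne' h1
  ext x
  obtain ⟨y, hy, hxy⟩ := u.2.2.exists_mem_Ico₀ (by positivity : (0 : ℝ) < 2 * Real.pi) x
  rw [hxy]
  exact h0 y ⟨hy.1, hy.2.le⟩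

end circleFun

/-! ## Linear algebra of loops -/

namespace Loop

section

variable {V W U : Type*} [AddCommGroup V] [Module ℂ V] [AddCommGroup W] [Module ℂ W]
  [AddCommGroup U] [Module ℂ U]

@[ext] theorem ext {p q : Loop V} (h : ∀ x, p.1 x = q.1 x) : p = q := Subtype.ext (funext h)

@[simp] theorem add_apply (p q : Loop V) (x : ℝ) : (p + q).1 x = p.1 x + q.1 x := rfl
@[simp] theorem sub_apply (p q : Loop V) (x : ℝ) : (p - q).1 x = p.1 x - q.1 x := rfl
@[simp] theorem neg_apply (p : Loop V) (x : ℝ) : (-p).1 x = -p.1 x := rfl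
@[simp] theorem smul_apply (c : ℂ) (q : Loop V) (x : ℝ) : (c • q).1 x = c • q.1 x := rfl
@[simp] theorem zero_apply (x : ℝ) : (0 : Loop V).1 x = 0 := rfl
@[simp] theorem const_apply (a : V) (x : ℝ) : (const a).1 x = a := rfl

theorem sum_apply {ι : Type*} (s : Finset ι) (p : ι → Loop V) (x : ℝ) :
    (∑ i ∈ s, p i).1 x = ∑ i ∈ s, (p i).1 x := by
  simp

/-- A linear coordinate of a loop. -/
def coord (ℓ : Module.Dual ℂ V) : Loop V →ₗ[ℂ] circleFun where
  toFun q := ⟨fun x => ℓ (q.1 x), q.2.2 ℓ, fun x => congrArg ℓ (q.2.1 x)⟩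
  map_add' p q := by ext x; exact map_add ℓ _ _
  map_smul' c q := by ext x; exact map_smul ℓ _ _

@[simp] theorem coord_apply (ℓ : Module.Dual ℂ V) (q : Loop V) (x : ℝ) :
    (coord ℓ q).1 x = ℓ (q.1 x) := rfl

theorem ext_coord {p q : Loop V} (h : ∀ ℓ, coord ℓ p = coord ℓ q) : p = q := by
  ext x
  rw [← sub_eq_zero, ← Module.forall_dual_apply_eq_zero_iff ℂ]
  intro ℓ
  rw [map_sub, sub_eq_zero]
  exact congrArg (fun u : circleFun => u.1 x) (h ℓ)

/-- The loop `x ↦ u(x) v`. -/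
def tens : circleFun →ₗ[ℂ] V →ₗ[ℂ] Loop V :=
  LinearMap.mk₂ ℂ (fun u v => ⟨fun x => u.1 x • v, fun x => by
      have := u.2.2 x
      simp [this], fun ℓ => by
      simpa using u.2.1.mul contDiff_const⟩)
    (fun u u' v => by ext x; exact add_smul _ _ _)
    (fun c u v => by ext x; exact mul_smul c (u.1 x) v)
    (fun u v v' => by ext x; exact smul_add _ _ _)
    (fun c u v => by ext x; exact smul_comm _ _ _)

@[simp] theorem tens_apply (u : circleFun) (v : V) (x : ℝ) : (tens u v).1 x = u.1 x • v := rfl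

theorem coord_tens (ℓ : Module.Dual ℂ V) (u : circleFun) (v : V) :
    coord ℓ (tens u v) = ℓ v • u := by
  ext x
  simp only [coord_apply, tens_apply, map_smul, smul_eq_mul]
  exact mul_comm _ _

/-- Composition of loops with a linear map. -/
def mapL (φ : V →ₗ[ℂ] W) : Loop V →ₗ[ℂ] Loop W where
  toFun q := ⟨fun x => φ (q.1 x), fun x => congrArg φ (q.2.1 x), fun ℓ => q.2.2 (ℓ ∘ₗ φ)⟩
  map_add' p q := by ext x; exact map_add φ _ _
  map_smul' c q := by ext x; exact map_smul φ _ _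

@[simp] theorem mapL_apply (φ : V →ₗ[ℂ] W) (q : Loop V) (x : ℝ) :
    (mapL φ q).1 x = φ (q.1 x) := rfl

variable [FiniteDimensional ℂ V]

theorem eq_sum_tens (q : Loop V) :
    q = ∑ i, tens (coord ((Module.finBasis ℂ V).coord i) q) (Module.finBasis ℂ V i) := by
  ext x
  rw [sum_apply]
  simp only [tens_apply, coord_apply, Module.Basis.coord_apply]
  exact ((Module.finBasis ℂ V).sum_repr _).symm

/-- The pointwise application of a bilinear map to two loops. -/
def map₂ (β : V →ₗ[ℂ] W →ₗ[ℂ] U) : Loop V →ₗ[ℂ] Loop W →ₗ[ℂ] Loop U :=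
  LinearMap.mk₂ ℂ (fun p q => ⟨fun x => β (p.1 x) (q.1 x), fun x => by simp [p.2.1 x, q.2.1 x],
      fun ℓ => by
        have h : (fun x => ℓ (β (p.1 x) (q.1 x))) = fun x => ∑ i,
            (Module.finBasis ℂ V).coord i (p.1 x) * ℓ (β (Module.finBasis ℂ V i) (q.1 x)) := by
          funext x
          conv_lhs => rw [← (Module.finBasis ℂ V).sum_repr (p.1 x)]
          simp only [map_sum, map_smul, LinearMap.sum_apply, LinearMap.smul_apply, smul_eq_mul,
            Module.Basis.coord_apply]
        rw [h]
        exact ContDiff.sum fun i _ => (p.2.2 _).mul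
          (q.2.2 (ℓ ∘ₗ β (Module.finBasis ℂ V i)))⟩)
    (fun p p' q => by ext x; simp) (fun c p q => by ext x; simp)
    (fun p q q' => by ext x; simp) (fun c p q => by ext x; simp)

@[simp] theorem map₂_apply (β : V →ₗ[ℂ] W →ₗ[ℂ] U) (p : Loop V) (q : Loop W) (x : ℝ) :
    (map₂ β p q).1 x = β (p.1 x) (q.1 x) := rfl

/-- The pointwise application of a bilinear form to two loops. -/
def form (β : V →ₗ[ℂ] W →ₗ[ℂ] ℂ) : Loop V →ₗ[ℂ] Loop W →ₗ[ℂ] circleFun :=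
  (map₂ β).compr₂ (coord LinearMap.id)

@[simp] theorem form_apply (β : V →ₗ[ℂ] W →ₗ[ℂ] ℂ) (p : Loop V) (q : Loop W) (x : ℝ) :
    (form β p q).1 x = β (p.1 x) (q.1 x) := rfl

theorem coord_deriv (ℓ : Module.Dual ℂ V) (q : Loop V) :
    coord ℓ (deriv q) = circleFun.D (coord ℓ q) := by
  ext x
  exact dual_deriv q ℓ x

/-- The derivative `∂ₓ` as a linear map. -/
def derivL : Loop V →ₗ[ℂ] Loop V where
  toFun := deriv
  map_add' p q := ext_coord fun ℓ => by simp only [coord_deriv, map_add]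
  map_smul' c q := ext_coord fun ℓ => by simp only [coord_deriv, map_smul, RingHom.id_apply]

theorem derivL_apply (q : Loop V) : derivL q = deriv q := rfl

theorem deriv_mapL [FiniteDimensional ℂ W] (φ : V →ₗ[ℂ] W) (q : Loop V) :
    deriv (mapL φ q) = mapL φ (deriv q) := by
  refine ext_coord fun ℓ => ?_
  rw [coord_deriv]
  exact (coord_deriv (ℓ ∘ₗ φ) q).symm

theorem deriv_tens (u : circleFun) (v : V) : deriv (tens u v) = tens (circleFun.D u) v := by
  refine ext_coord fun ℓ => ?_
  rw [coord_deriv, coord_tens, coord_tens, map_smul]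

theorem D_form [FiniteDimensional ℂ W] (β : V →ₗ[ℂ] W →ₗ[ℂ] ℂ) (p : Loop V) (q : Loop W) :
    circleFun.D (form β p q) = form β (deriv p) q + form β p (deriv q) := by
  have h : ∀ (u : circleFun) (v : V) (q : Loop W), form β (tens u v) q = u * coord (β v) q := by
    intro u v q
    ext x
    simp [coord]
  rw [← derivL_apply p, eq_sum_tens p]
  simp only [map_sum, LinearMap.sum_apply, ← Finset.sum_add_distrib]
  refine Finset.sum_congr rfl fun i _ => ?_
  rw [derivL_apply, deriv_tens, h, h, h, circleFun.D_mul, coord_deriv]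

theorem deriv_map₂ [FiniteDimensional ℂ W] [FiniteDimensional ℂ U]
    (β : V →ₗ[ℂ] W →ₗ[ℂ] U) (p : Loop V) (q : Loop W) :
    deriv (map₂ β p q) = map₂ β (deriv p) q + map₂ β p (deriv q) := by
  refine ext_coord fun ℓ => ?_
  rw [coord_deriv, map_add]
  exact D_form (β.compr₂ ℓ) p q

/-- The derivative of a loop with values in a subspace has values in that subspace. -/
theorem deriv_mem (K : Submodule ℂ V) {q : Loop V} (hq : ∀ x, q.1 x ∈ K) (x : ℝ) :
    (deriv q).1 x ∈ K := by
  obtain ⟨φ, hφ⟩ := K.exists_isCompl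
  have h1 : mapL (K.projection φ hφ) q = q := by
    ext x
    exact (Submodule.projection_eq_self_iff hφ _).2 (hq x)
  rw [← h1, deriv_mapL]
  simp

end

end Loop

/-! ## Polynomial curves -/

section Curves

variable {E F G : Type*} [AddCommGroup E] [Module ℂ E] [AddCommGroup F] [Module ℂ F]
  [AddCommGroup G] [Module ℂ G]

variable (E) in
/-- Polynomial maps `ℂ → E`. -/
def polyCurves : Submodule ℂ (ℂ → E) :=
  Submodule.span ℂ {γ | ∃ (k : ℕ) (c : E), γ = fun θ => θ ^ k • c}

theorem polyCurves.monomial (k : ℕ) (c : E) : (fun θ : ℂ => θ ^ k • c) ∈ polyCurves E :=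
  Submodule.subset_span ⟨k, c, rfl⟩

theorem polyCurves.const (c : E) : (fun _ : ℂ => c) ∈ polyCurves E := by
  simpa using polyCurves.monomial 0 c

theorem polyCurves.bilin (β : E →ₗ[ℂ] F →ₗ[ℂ] G) {γ : ℂ → E} {κ : ℂ → F}
    (hγ : γ ∈ polyCurves E) (hκ : κ ∈ polyCurves F) :
    (fun θ => β (γ θ) (κ θ)) ∈ polyCurves G := by
  induction hγ using Submodule.span_induction with
  | zero =>
    convert zero_mem (polyCurves G) using 2
    simp
  | add p q _ _ hp hq =>
    convert add_mem hp hq using 2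
    simp
  | smul c p _ hp =>
    convert Submodule.smul_mem _ c hp using 2
    simp
  | mem p hp =>
    obtain ⟨k, c, rfl⟩ := hp
    induction hκ using Submodule.span_induction with
    | zero =>
      convert zero_mem (polyCurves G) using 2
      simp
    | add p q _ _ hp hq =>
      convert add_mem hp hq using 2
      simp
    | smul c p _ hp =>
      convert Submodule.smul_mem _ c hp using 2
      simp only [Pi.smul_apply, map_smul, LinearMap.smul_apply]
    | mem q hq =>
      obtain ⟨l, d, rfl⟩ := hq
      convert polyCurves.monomial (k + l) (β c d) using 2
      simp only [map_smul, LinearMap.smul_apply, smul_smul, pow_add, mul_comm]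

theorem polyCurves.smul {γ : ℂ → E} (hγ : γ ∈ polyCurves E) (k : ℕ) :
    (fun θ => θ ^ k • γ θ) ∈ polyCurves E := by
  simpa using polyCurves.bilin (LinearMap.lsmul ℂ E) (polyCurves.monomial k (1 : ℂ)) hγ

theorem polyCurves.continuous {γ : ℂ → ℂ} (hγ : γ ∈ polyCurves ℂ) : Continuous γ := by
  induction hγ using Submodule.span_induction with
  | zero => exact continuous_const
  | add p q _ _ hp hq => exact hp.add hq
  | smul c p _ hp => exact hp.const_smul c
  | mem p hp =>
    obtain ⟨k, c, rfl⟩ := hp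
    fun_prop

/-- The polynomial curve `γ` has derivative `γ'` at the origin. -/
def HasDir (γ : ℂ → E) (γ' : E) : Prop :=
  ∃ r ∈ polyCurves E, ∀ θ, γ θ = γ 0 + θ • γ' + θ ^ 2 • r θ

namespace HasDir

theorem const (c : E) : HasDir (fun _ : ℂ => c) 0 :=
  ⟨0, zero_mem _, fun θ => by simp⟩

theorem line (q s : E) : HasDir (fun θ : ℂ => q + θ • s) s :=
  ⟨0, zero_mem _, fun θ => by simp⟩

theorem bilin (β : E →ₗ[ℂ] F →ₗ[ℂ] G) {γ : ℂ → E} {γ' : E} {κ : ℂ → F} {κ' : F}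
    (hγ : HasDir γ γ') (hκ : HasDir κ κ') :
    HasDir (fun θ => β (γ θ) (κ θ)) (β γ' (κ 0) + β (γ 0) κ') := by
  obtain ⟨r, hr, hγ⟩ := hγ
  obtain ⟨ρ, hρ, hκ⟩ := hκ
  refine ⟨_, add_mem (add_mem (add_mem (polyCurves.const (β γ' κ'))
    (polyCurves.bilin β (polyCurves.const (γ 0)) hρ))
    (polyCurves.bilin β hr (polyCurves.const (κ 0))))
    (add_mem (polyCurves.smul (add_mem (polyCurves.bilin β (polyCurves.const γ') hρ)
      (polyCurves.bilin β hr (polyCurves.const κ'))) 1)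
    (polyCurves.smul (polyCurves.bilin β hr hρ) 2)), fun θ => ?_⟩
  simp only [Pi.add_apply]
  conv_lhs => rw [hγ θ, hκ θ]
  simp only [map_add, LinearMap.add_apply, map_smul, LinearMap.smul_apply]
  module

theorem map (φ : E →ₗ[ℂ] F) {γ : ℂ → E} {γ' : E} (hγ : HasDir γ γ') :
    HasDir (fun θ => φ (γ θ)) (φ γ') := by
  simpa using bilin ((LinearMap.lsmul ℂ F).flip ∘ₗ φ) hγ (const (1 : ℂ))

theorem add {γ κ : ℂ → E} {γ' κ' : E} (hγ : HasDir γ γ') (hκ : HasDir κ κ') :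
    HasDir (fun θ => γ θ + κ θ) (γ' + κ') := by
  obtain ⟨r, hr, hγ⟩ := hγ
  obtain ⟨ρ, hρ, hκ⟩ := hκ
  refine ⟨_, add_mem hr hρ, fun θ => ?_⟩
  simp only [Pi.add_apply]
  conv_lhs => rw [hγ θ, hκ θ]
  module

theorem sub {γ κ : ℂ → E} {γ' κ' : E} (hγ : HasDir γ γ') (hκ : HasDir κ κ') :
    HasDir (fun θ => γ θ - κ θ) (γ' - κ') := by
  simpa [sub_eq_add_neg] using hγ.add (hκ.map (-LinearMap.id))

theorem sum {ι : Type*} (s : Finset ι) {γ : ι → ℂ → E} {γ' : ι → E}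
    (h : ∀ i ∈ s, HasDir (γ i) (γ' i)) : HasDir (fun θ => ∑ i ∈ s, γ i θ) (∑ i ∈ s, γ' i) := by
  classical
  induction s using Finset.induction_on with
  | empty => simpa using const (0 : E)
  | insert i s hi ih =>
    simp only [Finset.sum_insert hi]
    exact (h i (by simp)).add (ih fun j hj => h j (by simp [hj]))

theorem hasDerivAt {γ : ℂ → ℂ} {γ' : ℂ} (h : HasDir γ γ') : HasDerivAt γ γ' 0 := by
  obtain ⟨r, hr, h⟩ := h
  have h1 : HasDerivAt (fun θ : ℂ => θ * r θ) (r 0) 0 := by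
    rw [hasDerivAt_iff_tendsto_slope]
    have h2 : Filter.Tendsto r (nhdsWithin 0 {0}ᶜ) (nhds (r 0)) :=
      ((polyCurves.continuous hr).tendsto 0).mono_left nhdsWithin_le_nhds
    refine h2.congr' ?_
    filter_upwards [self_mem_nhdsWithin] with θ hθ
    have hθ' : θ ≠ 0 := hθ
    rw [slope_def_field]
    field_simp
    ring
  have h3 : HasDerivAt (fun θ : ℂ => γ 0 + θ * (γ' + θ * r θ))
      (1 * (γ' + 0 * r 0) + 0 * r 0) 0 :=
    ((hasDerivAt_id' (0 : ℂ)).mul (h1.const_add γ')).const_add (γ 0)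
  have h4 : γ = fun θ : ℂ => γ 0 + θ * (γ' + θ * r θ) := by
    funext θ
    rw [h θ]
    simp only [smul_eq_mul]
    ring
  rw [h4]
  simpa using h3

/-- Scalar derivatives are unique, and linear functionals separate the points of any complex vector
space. -/
theorem unique {γ : ℂ → E} {γ' γ'' : E} (h : HasDir γ γ') (h' : HasDir γ γ'') : γ' = γ'' := by
  rw [← sub_eq_zero, ← Module.forall_dual_apply_eq_zero_iff ℂ]
  intro ℓ
  rw [map_sub, sub_eq_zero]
  exact (h.map ℓ).hasDerivAt.unique (h'.map ℓ).hasDerivAt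

end HasDir

end Curves

/-! ## Differential polynomials -/

section DifferentialPolynomials

variable {V W U : Type*} [AddCommGroup V] [Module ℂ V] [AddCommGroup W] [Module ℂ W]
  [AddCommGroup U] [Module ℂ U]

/-- A jet coordinate of a loop. -/
def jet (j : Module.Dual ℂ V × ℕ) : Loop V →ₗ[ℂ] circleFun :=
  (circleFun.D ^ j.2) ∘ₗ Loop.coord j.1

variable (V) in
/-- The map that sends a density to the function on loops that it defines. -/
def ev : Density V →ₐ[circleFun] (Loop V → circleFun) := MvPolynomial.aeval fun j q => jet j q

theorem ev_apply (p : Density V) (q : Loop V) (x : ℝ) : (ev V p q).1 x = p.value q x := by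
  unfold Density.value
  induction p using MvPolynomial.induction_on with
  | C a =>
    simp only [ev, MvPolynomial.aeval_C, MvPolynomial.eval₂_C]
    simp [evalAt]
  | add p r hp hr => simp [hp, hr]
  | mul_X p j hp =>
    simp only [map_mul, Pi.mul_apply, MvPolynomial.eval₂_mul, MvPolynomial.eval₂_X, ← hp]
    simp only [ev, MvPolynomial.aeval_X, MulMemClass.coe_mul, Pi.mul_apply, jet,
      LinearMap.comp_apply, circleFun.iterate_D_apply]
    rfl

theorem functional_apply (p : Density V) (q : Loop V) :
    functional p q = circleFun.integral (ev V p q) := by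
  change (∫ x in (0 : ℝ)..(2 * Real.pi), p.value q x) = ∫ x in (0 : ℝ)..(2 * Real.pi), _
  simp only [ev_apply]

variable (V) in
/-- The algebra of differential polynomials on the loop space. -/
def dp : Subalgebra circleFun (Loop V → circleFun) := (ev V).range

theorem dp.const (u : circleFun) : (fun _ => u) ∈ dp V := by
  convert (dp V).algebraMap_mem u using 1
  funext q
  simp

theorem dp.jet (j : Module.Dual ℂ V × ℕ) : (fun q => jet j q) ∈ dp V :=
  ⟨MvPolynomial.X j, by simp [ev]⟩

theorem dp.coord (ℓ : Module.Dual ℂ V) : (fun q => Loop.coord ℓ q) ∈ dp V := by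
  simpa [LoopReduction.jet] using dp.jet (ℓ, 0)

-- Induction on a density, transferred to the function it defines. Distinct densities may define the
-- same function, because jet coordinates of linearly dependent functionals are dependent.
@[elab_as_elim]
theorem dp.induction {P : (p : Loop V → circleFun) → p ∈ dp V → Prop}
    (const : ∀ u : circleFun, P (fun _ => u) (dp.const u))
    (add : ∀ p hp r hr, P p hp → P r hr → P (fun q => p q + r q) ((dp V).add_mem hp hr))
    (mul : ∀ p hp r hr, P p hp → P r hr → P (fun q => p q * r q) ((dp V).mul_mem hp hr))
    (jet : ∀ j, P (fun q => LoopReduction.jet j q) (dp.jet j)) {p : Loop V → circleFun}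
    (hp : p ∈ dp V) : P p hp := by
  have key : ∀ {p r : Loop V → circleFun} (hp : p ∈ dp V) (hr : r ∈ dp V), p = r →
      P r hr → P p hp := by
    rintro p _ _ _ rfl h
    exact h
  suffices h : ∀ p : Density V, P (ev V p) ⟨p, rfl⟩ by
    obtain ⟨p, rfl⟩ := hp
    exact h p
  intro p
  induction p using MvPolynomial.induction_on with
  | C a =>
    refine key _ _ (funext fun q => ?_) (const a)
    simp [ev]
  | add p r hp hr =>
    exact key _ _ (map_add _ _ _) (add _ _ _ _ hp hr)
  | mul_X p j hp =>
    refine key _ _ ?_ (mul _ _ _ _ hp (jet j))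
    simp [ev]
    rfl

theorem dp.smul (c : ℂ) {p : Loop V → circleFun} (hp : p ∈ dp V) : (fun q => c • p q) ∈ dp V := by
  convert (dp V).mul_mem (dp.const (algebraMap ℂ circleFun c)) hp using 1
  funext q
  simp [Algebra.smul_def]

theorem dp.sum {ι : Type*} (s : Finset ι) {p : ι → Loop V → circleFun}
    (hp : ∀ i ∈ s, p i ∈ dp V) : (fun q => ∑ i ∈ s, p i q) ∈ dp V := by
  convert (dp V).sum_mem hp using 1
  funext q
  simp

theorem dp.D {p : Loop V → circleFun} (hp : p ∈ dp V) : (fun q => circleFun.D (p q)) ∈ dp V := by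
  induction hp using dp.induction with
  | const u => exact dp.const _
  | add p _ r _ hp hr =>
    simp only [map_add]
    exact (dp V).add_mem hp hr
  | mul p hp r hr ihp ihr =>
    simp only [circleFun.D_mul]
    exact (dp V).add_mem ((dp V).mul_mem ihp hr) ((dp V).mul_mem hp ihr)
  | jet j =>
    convert dp.jet (j.1, j.2 + 1) using 2
    simp [LoopReduction.jet, pow_succ']

theorem dp.iterate_neg_D {p : Loop V → circleFun} (hp : p ∈ dp V) (k : ℕ) :
    (fun q => ((-circleFun.D) ^ k) (p q)) ∈ dp V := by
  induction k with
  | zero => simpa using hp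
  | succ k ih =>
    convert dp.smul (-1) (dp.D ih) using 2
    rw [pow_succ', Module.End.mul_apply, LinearMap.neg_apply, neg_one_smul]

/-- A map between loop spaces is a differential polynomial map if all its coordinates are
differential polynomials. -/
def IsDP (A : Loop V → Loop W) : Prop := ∀ ℓ, (fun q => Loop.coord ℓ (A q)) ∈ dp V

/-- Closure of differential polynomials under `∂ₓ` makes them stable under substitution; this is why
a functional composed with the retraction onto `Q` is still local. -/
theorem dp.comp {p : Loop W → circleFun} (hp : p ∈ dp W) {A : Loop V → Loop W} (hA : IsDP A) :
    (fun q => p (A q)) ∈ dp V := by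
  induction hp using dp.induction with
  | const u => exact dp.const u
  | add p _ r _ hp hr => exact (dp V).add_mem hp hr
  | mul p _ r _ hp hr => exact (dp V).mul_mem hp hr
  | jet j =>
    obtain ⟨ℓ, k⟩ := j
    induction k with
    | zero => simpa [LoopReduction.jet] using hA ℓ
    | succ k ih =>
      convert dp.D ih using 2
      simp [LoopReduction.jet, pow_succ']

namespace IsDP

theorem id : IsDP (fun q : Loop V => q) := dp.coord

theorem const (w : Loop W) : IsDP (fun _ : Loop V => w) := fun _ => dp.const _

theorem comp {A : Loop V → Loop W} {B : Loop W → Loop U} (hB : IsDP B) (hA : IsDP A) :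
    IsDP (fun q => B (A q)) := fun ℓ => dp.comp (hB ℓ) hA

theorem add {A B : Loop V → Loop W} (hA : IsDP A) (hB : IsDP B) : IsDP (fun q => A q + B q) :=
  fun ℓ => by
    simp only [map_add]
    exact (dp V).add_mem (hA ℓ) (hB ℓ)

theorem smul (c : ℂ) {A : Loop V → Loop W} (hA : IsDP A) : IsDP (fun q => c • A q) :=
  fun ℓ => by simpa using dp.smul c (hA ℓ)

theorem sub {A B : Loop V → Loop W} (hA : IsDP A) (hB : IsDP B) : IsDP (fun q => A q - B q) := by
  intro ℓ
  simp only [map_sub]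
  exact (dp V).sub_mem (hA ℓ) (hB ℓ)

theorem sum {ι : Type*} (s : Finset ι) {A : ι → Loop V → Loop W} (h : ∀ i ∈ s, IsDP (A i)) :
    IsDP (fun q => ∑ i ∈ s, A i q) := fun ℓ => by
  simpa using dp.sum s fun i hi => h i hi ℓ

theorem tens {p : Loop V → circleFun} (hp : p ∈ dp V) (w : W) :
    IsDP (fun q => Loop.tens (p q) w) := fun ℓ => by
  simpa [Loop.coord_tens] using dp.smul (ℓ w) hp

theorem mapL (φ : W →ₗ[ℂ] U) {A : Loop V → Loop W} (hA : IsDP A) :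
    IsDP (fun q => Loop.mapL φ (A q)) := fun ℓ => hA (ℓ ∘ₗ φ)

variable [FiniteDimensional ℂ W]

theorem deriv {A : Loop V → Loop W} (hA : IsDP A) : IsDP (fun q => Loop.deriv (A q)) := fun ℓ => by
  simpa [Loop.coord_deriv] using dp.D (hA ℓ)

theorem _root_.LoopReduction.dp.form {V' : Type*} [AddCommGroup V'] [Module ℂ V']
    (β : W →ₗ[ℂ] U →ₗ[ℂ] ℂ) {A : Loop V' → Loop W} {B : Loop V' → Loop U} (hA : IsDP A)
    (hB : IsDP B) : (fun q => Loop.form β (A q) (B q)) ∈ dp V' := by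
  have h : ∀ q, Loop.form β (A q) (B q) = ∑ i, Loop.coord ((Module.finBasis ℂ W).coord i) (A q) *
      Loop.coord (β (Module.finBasis ℂ W i)) (B q) := by
    intro q
    conv_lhs => rw [Loop.eq_sum_tens (A q)]
    simp only [map_sum, LinearMap.sum_apply]
    refine Finset.sum_congr rfl fun i _ => ?_
    ext x
    simp
  simp only [h]
  exact dp.sum _ fun i _ => (dp V').mul_mem (hA _) (hB _)

theorem map₂ {V' : Type*} [AddCommGroup V'] [Module ℂ V']
    (β : W →ₗ[ℂ] U →ₗ[ℂ] V) {A : Loop V' → Loop W} {B : Loop V' → Loop U} (hA : IsDP A)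
    (hB : IsDP B) : IsDP (fun q => Loop.map₂ β (A q) (B q)) := fun ℓ =>
  dp.form (β.compr₂ ℓ) hA hB

end IsDP

/-! ### First and second variations -/

/-- The differential polynomial `p` has first variation `p₁` and second variation `p₂`. -/
structure HasVariations (p : Loop V → circleFun) (p₁ : Loop V → Loop V → circleFun)
    (p₂ : Loop V → Loop V → Loop V → circleFun) : Prop where
  first : ∀ γ γ', HasDir γ γ' → HasDir (fun θ => p (γ θ)) (p₁ (γ 0) γ')
  second : ∀ γ γ' s, HasDir γ γ' → HasDir (fun θ => p₁ (γ θ) s) (p₂ (γ 0) s γ')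
  symm : ∀ q s t, p₂ q s t = p₂ q t s

theorem dp.hasVariations {p : Loop V → circleFun} (hp : p ∈ dp V) :
    ∃ p₁ p₂, HasVariations p p₁ p₂ := by
  induction hp using dp.induction with
  | const u =>
    exact ⟨fun _ _ => 0, fun _ _ _ => 0, fun _ _ _ => HasDir.const u,
      fun _ _ _ _ => HasDir.const _, fun _ _ _ => rfl⟩
  | add p _ r _ hp hr =>
    obtain ⟨p₁, p₂, hp⟩ := hp
    obtain ⟨r₁, r₂, hr⟩ := hr
    exact ⟨fun q s => p₁ q s + r₁ q s, fun q s t => p₂ q s t + r₂ q s t,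
      fun γ γ' h => (hp.first γ γ' h).add (hr.first γ γ' h),
      fun γ γ' s h => (hp.second γ γ' s h).add (hr.second γ γ' s h),
      fun q s t => by rw [hp.symm, hr.symm]⟩
  | mul p _ r _ hp hr =>
    obtain ⟨p₁, p₂, hp⟩ := hp
    obtain ⟨r₁, r₂, hr⟩ := hr
    refine ⟨fun q s => p₁ q s * r q + p q * r₁ q s, fun q s t =>
      (p₂ q s t * r q + p₁ q s * r₁ q t) + (p₁ q t * r₁ q s + p q * r₂ q s t),
      fun γ γ' h => (hp.first γ γ' h).bilin (LinearMap.mul ℂ circleFun) (hr.first γ γ' h),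
      fun γ γ' s h => HasDir.add
        ((hp.second γ γ' s h).bilin (LinearMap.mul ℂ circleFun) (hr.first γ γ' h))
        ((hp.first γ γ' h).bilin (LinearMap.mul ℂ circleFun) (hr.second γ γ' s h)),
      fun q s t => ?_⟩
    rw [hp.symm q s t, hr.symm q s t]
    ring
  | jet j =>
    exact ⟨fun _ s => LoopReduction.jet j s, fun _ _ _ => 0, fun γ γ' h => h.map _,
      fun _ _ _ _ => HasDir.const _, fun _ _ _ => rfl⟩

theorem IsDP.hasDir [FiniteDimensional ℂ W] {A : Loop V → Loop W} (hA : IsDP A) :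
    ∃ A₁ : Loop V → Loop V → Loop W, ∀ γ γ', HasDir γ γ' →
      HasDir (fun θ => A (γ θ)) (A₁ (γ 0) γ') := by
  choose p₁ p₂ h using fun i => dp.hasVariations (hA ((Module.finBasis ℂ W).coord i))
  refine ⟨fun q s => ∑ i, Loop.tens (p₁ i q s) (Module.finBasis ℂ W i), fun γ γ' hγ => ?_⟩
  have h1 := HasDir.sum Finset.univ fun i _ =>
    ((h i).first γ γ' hγ).map (Loop.tens.flip (Module.finBasis ℂ W i))
  simp only [LinearMap.flip_apply, ← Loop.eq_sum_tens] at h1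
  exact h1

end DifferentialPolynomials

/-! ## Gradients of local functionals -/

section Gradients

variable {𝔤 : Type*} [LieRing 𝔤] [LieAlgebra ℂ 𝔤] [FiniteDimensional ℂ 𝔤]

theorem pairing_eq (u v : Loop 𝔤) :
    pairing u v = circleFun.integral (Loop.form (killingForm ℂ 𝔤) u v) := rfl

/-- The pairing as a bilinear map. -/
def pairingL : Loop 𝔤 →ₗ[ℂ] Loop 𝔤 →ₗ[ℂ] ℂ :=
  (Loop.form (killingForm ℂ 𝔤)).compr₂ circleFun.integral

theorem pairingL_apply (u v : Loop 𝔤) : pairingL u v = pairing u v := rfl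

theorem pairing_add_left (u v w : Loop 𝔤) : pairing (u + v) w = pairing u w + pairing v w :=
  pairingL.map_add₂ u v w

theorem pairing_add_right (u v w : Loop 𝔤) : pairing u (v + w) = pairing u v + pairing u w :=
  (pairingL u).map_add v w

theorem pairing_sub_left (u v w : Loop 𝔤) : pairing (u - v) w = pairing u w - pairing v w :=
  pairingL.map_sub₂ u v w

theorem pairing_neg_left (u v : Loop 𝔤) : pairing (-u) v = -pairing u v := pairingL.map_neg₂ u v

theorem pairing_smul_left (c : ℂ) (u v : Loop 𝔤) : pairing (c • u) v = c * pairing u v :=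
  pairingL.map_smul₂ c u v

theorem pairing_smul_right (c : ℂ) (u v : Loop 𝔤) : pairing u (c • v) = c * pairing u v :=
  (pairingL u).map_smul c v

theorem pairing_zero_left (u : Loop 𝔤) : pairing 0 u = 0 := pairingL.map_zero₂ u

theorem pairing_zero_right (u : Loop 𝔤) : pairing u 0 = 0 := (pairingL u).map_zero

omit [FiniteDimensional ℂ 𝔤] in
theorem pairing_comm (u v : Loop 𝔤) : pairing u v = pairing v u := by
  unfold pairing
  simp only [LieModule.traceForm_comm ℂ 𝔤 𝔤 (u.1 _)]

theorem pairing_deriv (u v : Loop 𝔤) : pairing (Loop.deriv u) v = -pairing u (Loop.deriv v) := by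
  have h := circleFun.integral_D (Loop.form (killingForm ℂ 𝔤) u v)
  rw [Loop.D_form, map_add] at h
  exact eq_neg_of_add_eq_zero_left h

/-- A loop that pairs to zero with the loops in a subspace is pointwise orthogonal to it. -/
theorem killingForm_eq_zero_of_pairing (K : Submodule ℂ 𝔤) {v : Loop 𝔤}
    (h : ∀ s : Loop 𝔤, (∀ x, s.1 x ∈ K) → pairing v s = 0) (x : ℝ) {k : 𝔤} (hk : k ∈ K) :
    killingForm ℂ 𝔤 (v.1 x) k = 0 := by
  set u : circleFun := Loop.coord ((killingForm ℂ 𝔤).flip k) v with hu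
  have h1 : u = 0 := by
    refine circleFun.eq_zero_of_integral_mul_conj ?_
    rw [← h (Loop.tens (circleFun.conj u) k) fun x => K.smul_mem _ hk, pairing_eq]
    congr 1
    ext x
    simp [hu, mul_comm]
  exact congrArg (fun u : circleFun => u.1 x) h1

variable [LieAlgebra.IsKilling ℂ 𝔤]

omit [FiniteDimensional ℂ 𝔤] in
theorem eq_zero_of_killingForm {x : 𝔤} (h : ∀ y, killingForm ℂ 𝔤 x y = 0) : x = 0 :=
  (LieAlgebra.IsKilling.killingForm_nondegenerate ℂ 𝔤).1 x h

theorem eq_zero_of_pairing {v : Loop 𝔤} (h : ∀ s, pairing v s = 0) : v = 0 := by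
  ext x
  exact eq_zero_of_killingForm fun y =>
    killingForm_eq_zero_of_pairing ⊤ (fun s _ => h s) x Submodule.mem_top

theorem IsGradient.unique {F : Loop 𝔤 → ℂ} {q v w : Loop 𝔤} (hv : IsGradient F q v)
    (hw : IsGradient F q w) : v = w := by
  rw [← sub_eq_zero]
  refine eq_zero_of_pairing fun s => ?_
  rw [pairing_sub_left, sub_eq_zero]
  exact (hv s).unique (hw s)

theorem exists_killingForm_eq (ℓ : Module.Dual ℂ 𝔤) : ∃ v : 𝔤, ∀ y, killingForm ℂ 𝔤 v y = ℓ y := by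
  refine ⟨((killingForm ℂ 𝔤).toDual
    (LieAlgebra.IsKilling.killingForm_nondegenerate ℂ 𝔤)).symm ℓ, fun y => ?_⟩
  exact LinearMap.BilinForm.apply_toDual_symm_apply (B := killingForm ℂ 𝔤) ℓ y

/-- The formal adjoint of the linearization of `p`, applied to `b`. The weight `b` makes the
induction work: in a product, the factor that is not varied is absorbed into it. The gradient is the
case `b = 1`. -/
theorem dp.exists_adjoint {p : Loop 𝔤 → circleFun} (hp : p ∈ dp 𝔤) :
    ∃ p₁ p₂, HasVariations p p₁ p₂ ∧ ∀ b ∈ dp 𝔤, ∃ δ : Loop 𝔤 → Loop 𝔤, IsDP δ ∧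
      ∀ q s, circleFun.integral (b q * p₁ q s) = pairing (δ q) s := by
  suffices h : ∃ p₁ : Loop 𝔤 → Loop 𝔤 → circleFun,
      (∀ γ γ', HasDir γ γ' → HasDir (fun θ => p (γ θ)) (p₁ (γ 0) γ')) ∧
      ∀ b ∈ dp 𝔤, ∃ δ : Loop 𝔤 → Loop 𝔤, IsDP δ ∧
        ∀ q s, circleFun.integral (b q * p₁ q s) = pairing (δ q) s by
    obtain ⟨p₁, h1, h2⟩ := h
    obtain ⟨r₁, r₂, hr⟩ := dp.hasVariations hp
    refine ⟨r₁, r₂, hr, fun b hb => ?_⟩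
    obtain ⟨δ, hδ, h3⟩ := h2 b hb
    refine ⟨δ, hδ, fun q s => ?_⟩
    -- First variations are unique, so the adjoint found by induction also serves the variation that
    -- comes with a symmetric second variation.
    have h4 := (h1 _ _ (HasDir.line q s)).unique (hr.first _ _ (HasDir.line q s))
    simp only [zero_smul, add_zero] at h4
    rw [← h3, h4]
  induction hp using dp.induction with
  | const u =>
    exact ⟨fun _ _ => 0, fun _ _ _ => HasDir.const u, fun b _ => ⟨fun _ => 0, IsDP.const 0,
      fun q s => by rw [mul_zero, map_zero, pairing_zero_left]⟩⟩
  | add p _ r _ hp hr =>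
    obtain ⟨p₁, hp, hp'⟩ := hp
    obtain ⟨r₁, hr, hr'⟩ := hr
    refine ⟨fun q s => p₁ q s + r₁ q s, fun γ γ' h => (hp γ γ' h).add (hr γ γ' h), fun b hb => ?_⟩
    obtain ⟨δ, hδ, h1⟩ := hp' b hb
    obtain ⟨δ', hδ', h2⟩ := hr' b hb
    refine ⟨_, hδ.add hδ', fun q s => ?_⟩
    rw [mul_add, map_add, h1, h2, pairing_add_left]
  | mul p hpm r hrm hp hr =>
    obtain ⟨p₁, hp, hp'⟩ := hp
    obtain ⟨r₁, hr, hr'⟩ := hr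
    refine ⟨fun q s => p₁ q s * r q + p q * r₁ q s, fun γ γ' h =>
      (hp γ γ' h).bilin (LinearMap.mul ℂ circleFun) (hr γ γ' h), fun b hb => ?_⟩
    obtain ⟨δ, hδ, h1⟩ := hp' _ ((dp 𝔤).mul_mem hb hrm)
    obtain ⟨δ', hδ', h2⟩ := hr' _ ((dp 𝔤).mul_mem hb hpm)
    refine ⟨_, hδ.add hδ', fun q s => ?_⟩
    rw [pairing_add_left, ← h1, ← h2, ← map_add]
    congr 1
    simp only [Pi.mul_apply]
    ring
  | jet j =>
    obtain ⟨v, hv⟩ := exists_killingForm_eq j.1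
    refine ⟨fun _ s => LoopReduction.jet j s, fun γ γ' h => h.map _, fun b hb => ?_⟩
    refine ⟨_, IsDP.tens (dp.iterate_neg_D hb j.2) v, fun q s => ?_⟩
    change circleFun.integral (b q * (circleFun.D ^ j.2) (Loop.coord j.1 s)) = _
    rw [circleFun.integral_mul_iterate_D, pairing_eq]
    congr 1
    ext x
    simp [hv]

/-- A local functional has a gradient, whose derivative is symmetric. -/
theorem exists_gradient {F : Loop 𝔤 → ℂ} (hF : F ∈ localFunctionals 𝔤) :
    ∃ (δ : Loop 𝔤 → Loop 𝔤) (H : Loop 𝔤 → Loop 𝔤 → Loop 𝔤), IsDP δ ∧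
      (∀ γ γ', HasDir γ γ' → HasDir (fun θ => F (γ θ)) (pairing (δ (γ 0)) γ')) ∧
      (∀ γ γ', HasDir γ γ' → HasDir (fun θ => δ (γ θ)) (H (γ 0) γ')) ∧
      ∀ q s t, pairing (H q s) t = pairing (H q t) s := by
  obtain ⟨p, rfl⟩ := hF
  obtain ⟨p₁, p₂, hp, h⟩ := dp.exists_adjoint (p := ev 𝔤 p) ⟨p, rfl⟩
  obtain ⟨δ, hδ, h1⟩ := h 1 (one_mem _)
  simp only [Pi.one_apply, one_mul] at h1
  obtain ⟨H, hH⟩ := hδ.hasDir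
  -- Differentiating `(δ(q) | t) = ∫ p₁(q, t)` in the direction `s` expresses the Hessian by the
  -- second variation, which is symmetric.
  have hs : ∀ q s t, pairing (H q s) t = circleFun.integral (p₂ q t s) := by
    intro q s t
    have h2 := (hH _ _ (HasDir.line q s)).map (pairingL.flip t)
    have h3 := (hp.second _ _ t (HasDir.line q s)).map circleFun.integral
    simp only [LinearMap.flip_apply, pairingL_apply, ← h1, zero_smul, add_zero] at h2 h3
    exact h2.unique h3
  refine ⟨δ, H, hδ, fun γ γ' hγ => ?_, hH, fun q s t => by rw [hs, hs, hp.symm]⟩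
  rw [← h1]
  simp only [functional_apply]
  exact (hp.first _ _ hγ).map circleFun.integral

omit [FiniteDimensional ℂ 𝔤] [LieAlgebra.IsKilling ℂ 𝔤] in
theorem functional_mem {p : Loop 𝔤 → circleFun} (hp : p ∈ dp 𝔤) :
    (fun q => circleFun.integral (p q)) ∈ localFunctionals 𝔤 := by
  obtain ⟨p, rfl⟩ := hp
  exact ⟨p, funext fun q => functional_apply p q⟩

omit [FiniteDimensional ℂ 𝔤] [LieAlgebra.IsKilling ℂ 𝔤] in
theorem localFunctionals_comp {F : Loop 𝔤 → ℂ} (hF : F ∈ localFunctionals 𝔤) {A : Loop 𝔤 → Loop 𝔤}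
    (hA : IsDP A) : (fun q => F (A q)) ∈ localFunctionals 𝔤 := by
  obtain ⟨p, rfl⟩ := hF
  simp only [functional_apply]
  exact functional_mem (dp.comp ⟨p, rfl⟩ hA)

end Gradients

/-! ## The pencil of Poisson brackets on the loop algebra -/

section LoopAlgebra

variable {𝔤 : Type*} [LieRing 𝔤] [LieAlgebra ℂ 𝔤] [FiniteDimensional ℂ 𝔤]

instance : LieRing (Loop 𝔤) where
  bracket := Loop.lie
  add_lie p q r := by ext x; exact add_lie (p.1 x) (q.1 x) (r.1 x)
  lie_add p q r := by ext x; exact lie_add (p.1 x) (q.1 x) (r.1 x)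
  lie_self p := by ext x; exact lie_self (p.1 x)
  leibniz_lie p q r := by ext x; exact leibniz_lie (p.1 x) (q.1 x) (r.1 x)

@[simp] theorem Loop.lie_apply (p q : Loop 𝔤) (x : ℝ) : ⁅p, q⁆.1 x = ⁅p.1 x, q.1 x⁆ := rfl

theorem Loop.lie_def (p q : Loop 𝔤) : Loop.lie p q = ⁅p, q⁆ := rfl

instance : LieAlgebra ℂ (Loop 𝔤) where
  lie_smul c p q := by ext x; exact lie_smul c (p.1 x) (q.1 x)

variable (𝔤) in
/-- The Lie bracket as a bilinear map. -/
def bracketL : 𝔤 →ₗ[ℂ] 𝔤 →ₗ[ℂ] 𝔤 :=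
  LinearMap.mk₂ ℂ (fun x y => ⁅x, y⁆) add_lie smul_lie lie_add fun c x y => lie_smul c x y

/-- The Lie bracket of loops as a bilinear map. -/
def Loop.lieL : Loop 𝔤 →ₗ[ℂ] Loop 𝔤 →ₗ[ℂ] Loop 𝔤 := Loop.map₂ (bracketL 𝔤)

theorem Loop.deriv_lie (p q : Loop 𝔤) :
    Loop.deriv ⁅p, q⁆ = ⁅Loop.deriv p, q⁆ + ⁅p, Loop.deriv q⁆ :=
  Loop.deriv_map₂ (bracketL 𝔤) p q

theorem Loop.deriv_add (p q : Loop 𝔤) : Loop.deriv (p + q) = Loop.deriv p + Loop.deriv q :=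
  map_add Loop.derivL p q

theorem Loop.deriv_sub (p q : Loop 𝔤) : Loop.deriv (p - q) = Loop.deriv p - Loop.deriv q :=
  map_sub Loop.derivL p q

theorem Loop.deriv_smul (c : ℂ) (q : Loop 𝔤) : Loop.deriv (c • q) = c • Loop.deriv q :=
  map_smul Loop.derivL c q

theorem IsDP.lie {A B : Loop 𝔤 → Loop 𝔤} (hA : IsDP A) (hB : IsDP B) :
    IsDP (fun q => ⁅A q, B q⁆) := IsDP.map₂ (bracketL 𝔤) hA hB

theorem HasDir.lie {γ κ : ℂ → Loop 𝔤} {γ' κ' : Loop 𝔤} (hγ : HasDir γ γ') (hκ : HasDir κ κ') :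
    HasDir (fun θ => ⁅γ θ, κ θ⁆) (⁅γ', κ 0⁆ + ⁅γ 0, κ'⁆) := hγ.bilin Loop.lieL hκ

theorem pairing_lie (u v w : Loop 𝔤) : pairing ⁅u, v⁆ w = pairing u ⁅v, w⁆ := by
  unfold pairing
  simp only [Loop.lie_apply, LieModule.traceForm_apply_lie_apply]

theorem pairing_lie' (u v w : Loop 𝔤) : pairing u ⁅v, w⁆ = -pairing ⁅v, u⁆ w := by
  rw [← pairing_lie, ← lie_skew, pairing_neg_left]

/-- The Poisson tensor `v ↦ c₁ ∂ₓ v + [c₂ q + b, v]`. -/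
def tensor (c₁ c₂ : ℂ) (b q v : Loop 𝔤) : Loop 𝔤 := c₁ • Loop.deriv v + ⁅c₂ • q + b, v⁆

theorem P₂_eq_tensor (ε : ℂ) : P₂ (𝔤 := 𝔤) ε = tensor (ε⁻¹ * ε) ε⁻¹ 0 := by
  funext q v
  simp only [P₂, tensor, smul_add, smul_smul, add_zero, smul_lie, Loop.lie_def]

theorem P₁_eq_tensor (ε : ℂ) (a : 𝔤) : P₁ ε a = tensor 0 0 (ε⁻¹ • Loop.const a) := by
  funext q v
  simp only [P₁, tensor, zero_smul, zero_add, smul_lie, Loop.lie_def]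

theorem pencil_eq_tensor (ε : ℂ) (a : 𝔤) (α β : ℂ) (q v : Loop 𝔤) :
    α • P₂ ε q v + β • P₁ ε a q v =
      tensor (α * (ε⁻¹ * ε)) (α * ε⁻¹) (β • ε⁻¹ • Loop.const a) q v := by
  simp only [P₂_eq_tensor, P₁_eq_tensor, tensor, add_zero, zero_smul, zero_add, smul_add,
    smul_smul, smul_lie, add_lie, add_assoc]

theorem tensor_add (c₁ c₂ : ℂ) (b q v w : Loop 𝔤) :
    tensor c₁ c₂ b q (v + w) = tensor c₁ c₂ b q v + tensor c₁ c₂ b q w := by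
  simp only [tensor, Loop.deriv_add, lie_add, smul_add]
  abel

theorem tensor_smul (c₁ c₂ : ℂ) (b q : Loop 𝔤) (c : ℂ) (v : Loop 𝔤) :
    tensor c₁ c₂ b q (c • v) = c • tensor c₁ c₂ b q v := by
  simp only [tensor, Loop.deriv_smul, lie_smul, smul_add, smul_comm c]

theorem pairing_tensor (c₁ c₂ : ℂ) (b q v w : Loop 𝔤) :
    pairing v (tensor c₁ c₂ b q w) = -pairing (tensor c₁ c₂ b q v) w := by
  simp only [tensor, pairing_add_right, pairing_add_left, pairing_smul_left, pairing_smul_right,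
    pairing_deriv, pairing_lie' v]
  ring

theorem HasDir.tensor (c₁ c₂ : ℂ) (b : Loop 𝔤) {γ κ : ℂ → Loop 𝔤} {γ' κ' : Loop 𝔤}
    (hγ : HasDir γ γ') (hκ : HasDir κ κ') :
    HasDir (fun θ => tensor c₁ c₂ b (γ θ) (κ θ))
      (tensor c₁ c₂ b (γ 0) κ' + c₂ • ⁅γ', κ 0⁆) := by
  have h := (hκ.map (c₁ • Loop.derivL)).add
    (((hγ.map (c₂ • LinearMap.id)).add (HasDir.const b)).lie hκ)
  simp only [LinearMap.smul_apply, LinearMap.id_apply, add_zero, smul_lie] at h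
  have e : LoopReduction.tensor c₁ c₂ b (γ 0) κ' + c₂ • ⁅γ', κ 0⁆ =
      c₁ • Loop.derivL κ' + (c₂ • ⁅γ', κ 0⁆ + ⁅c₂ • γ 0 + b, κ'⁆) := by
    change c₁ • Loop.deriv κ' + _ + _ = c₁ • Loop.deriv κ' + _
    abel
  rw [e]
  exact h

/-- The contribution to the Jacobi identity of the dependence of the tensor on `q`. For `∂ₓ` it is
integration by parts and invariance of the form; for `ad z` it is invariance and the Jacobi identity
of the loop algebra, applied with `z = q` and `z = b`. -/
theorem cyclic_tensor (c₁ c₂ : ℂ) (b q u v w : Loop 𝔤) :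
    pairing v ⁅tensor c₁ c₂ b q u, w⁆ + pairing w ⁅tensor c₁ c₂ b q v, u⁆ +
      pairing u ⁅tensor c₁ c₂ b q w, v⁆ = 0 := by
  have h1 : pairing v ⁅Loop.deriv u, w⁆ + pairing w ⁅Loop.deriv v, u⁆ +
      pairing u ⁅Loop.deriv w, v⁆ = 0 := by
    have h := pairing_deriv u ⁅w, v⁆
    rw [Loop.deriv_lie, pairing_add_right] at h
    have e1 : pairing v ⁅Loop.deriv u, w⁆ = pairing (Loop.deriv u) ⁅w, v⁆ := by
      rw [pairing_comm, pairing_lie]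
    have e2 : pairing w ⁅Loop.deriv v, u⁆ = pairing u ⁅w, Loop.deriv v⁆ := by
      rw [← pairing_lie, pairing_comm]
    rw [e1, e2, h]
    ring
  have h2 : ∀ z : Loop 𝔤, pairing v ⁅⁅z, u⁆, w⁆ + pairing w ⁅⁅z, v⁆, u⁆ +
      pairing u ⁅⁅z, w⁆, v⁆ = 0 := by
    intro z
    have e : ∀ u v w : Loop 𝔤, pairing v ⁅⁅z, u⁆, w⁆ = pairing z ⁅u, ⁅w, v⁆⁆ := by
      intro u v w
      rw [pairing_comm, pairing_lie, pairing_lie]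
    rw [e, e, e, ← pairing_add_right, ← pairing_add_right]
    have e2 : ⁅u, ⁅w, v⁆⁆ + ⁅v, ⁅u, w⁆⁆ + ⁅w, ⁅v, u⁆⁆ = 0 := by
      have := lie_jacobi u w v
      rw [← this]
      abel
    rw [e2, pairing_zero_right]
  simp only [tensor, add_lie, smul_lie, pairing_add_right, pairing_smul_right]
  linear_combination c₁ * h1 + c₂ * h2 q + h2 b

variable [LieAlgebra.IsKilling ℂ 𝔤]

/-- The gradient of a local functional. -/
def grad (F : localFunctionals 𝔤) : Loop 𝔤 → Loop 𝔤 := (exists_gradient F.2).choose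

/-- The derivative of the gradient of a local functional. -/
def hess (F : localFunctionals 𝔤) : Loop 𝔤 → Loop 𝔤 → Loop 𝔤 :=
  (exists_gradient F.2).choose_spec.choose

variable (F G H : localFunctionals 𝔤)

theorem isDP_grad : IsDP (grad F) := (exists_gradient F.2).choose_spec.choose_spec.1

theorem hasDir_grad {γ : ℂ → Loop 𝔤} {γ' : Loop 𝔤} (h : HasDir γ γ') :
    HasDir (fun θ => F.1 (γ θ)) (pairing (grad F (γ 0)) γ') :=
  (exists_gradient F.2).choose_spec.choose_spec.2.1 γ γ' h

theorem hasDir_hess {γ : ℂ → Loop 𝔤} {γ' : Loop 𝔤} (h : HasDir γ γ') :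
    HasDir (fun θ => grad F (γ θ)) (hess F (γ 0) γ') :=
  (exists_gradient F.2).choose_spec.choose_spec.2.2.1 γ γ' h

theorem hess_symm (q s t : Loop 𝔤) : pairing (hess F q s) t = pairing (hess F q t) s :=
  (exists_gradient F.2).choose_spec.choose_spec.2.2.2 q s t

theorem hasDir_grad_line (q s : Loop 𝔤) :
    HasDir (fun θ : ℂ => F.1 (q + θ • s)) (pairing (grad F q) s) := by
  simpa using hasDir_grad F (HasDir.line q s)

theorem isGradient_grad (q : Loop 𝔤) : IsGradient F.1 q (grad F q) := fun s =>
  (hasDir_grad_line F q s).hasDerivAt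

theorem grad_eq {q v : Loop 𝔤} (h : IsGradient F.1 q v) : grad F q = v :=
  (isGradient_grad F q).unique h

theorem grad_eq_of_hasDir {q v : Loop 𝔤}
    (h : ∀ s : Loop 𝔤, HasDir (fun θ : ℂ => F.1 (q + θ • s)) (pairing v s)) : grad F q = v :=
  grad_eq F fun s => (h s).hasDerivAt

theorem grad_add (q : Loop 𝔤) : grad (F + G) q = grad F q + grad G q :=
  grad_eq_of_hasDir _ fun s => by
    rw [pairing_add_left]
    exact (hasDir_grad_line F q s).add (hasDir_grad_line G q s)

theorem grad_smul (c : ℂ) (q : Loop 𝔤) : grad (c • F) q = c • grad F q :=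
  grad_eq_of_hasDir _ fun s => by
    rw [pairing_smul_left]
    exact (hasDir_grad_line F q s).map (c • LinearMap.id)

/-- The bracket of local functionals on the loop algebra defined by a Poisson tensor. -/
def br (c₁ c₂ : ℂ) (b : Loop 𝔤) :
    localFunctionals 𝔤 →ₗ[ℂ] localFunctionals 𝔤 →ₗ[ℂ] localFunctionals 𝔤 :=
  LinearMap.mk₂ ℂ (fun F G => ⟨fun q => pairing (grad F q) (tensor c₁ c₂ b q (grad G q)),
      functional_mem (dp.form (killingForm ℂ 𝔤) (isDP_grad F) (((isDP_grad G).deriv.smul c₁).add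
        (((IsDP.id.smul c₂).add (IsDP.const b)).lie (isDP_grad G))))⟩)
    (fun F F' G => Subtype.ext <| funext fun q => by
      simp only [grad_add, pairing_add_left]
      rfl)
    (fun c F G => Subtype.ext <| funext fun q => by
      simp only [grad_smul, pairing_smul_left]
      rfl)
    (fun F G G' => Subtype.ext <| funext fun q => by
      simp only [grad_add, tensor_add, pairing_add_right]
      rfl)
    (fun c F G => Subtype.ext <| funext fun q => by
      simp only [grad_smul, tensor_smul, pairing_smul_right]
      rfl)

theorem br_apply (c₁ c₂ : ℂ) (b q : Loop 𝔤) :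
    (br c₁ c₂ b F G).1 q = pairing (grad F q) (tensor c₁ c₂ b q (grad G q)) := rfl

theorem br_skew (c₁ c₂ : ℂ) (b : Loop 𝔤) : br c₁ c₂ b F G = -br c₁ c₂ b G F := by
  refine Subtype.ext (funext fun q => ?_)
  change (br c₁ c₂ b F G).1 q = -(br c₁ c₂ b G F).1 q
  rw [br_apply, br_apply, pairing_tensor, pairing_comm]

/-- By skewness of the tensor, bracketing with `F` is minus the derivative along `X = P δF`.
Differentiating `(δG | P δH)` gives one Hessian term for each of `G`, `H` and one term from the
dependence of `P` on the point. -/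
theorem br_br_apply (c₁ c₂ : ℂ) (b q : Loop 𝔤) :
    (br c₁ c₂ b F (br c₁ c₂ b G H)).1 q =
      pairing (hess H q (tensor c₁ c₂ b q (grad F q))) (tensor c₁ c₂ b q (grad G q)) -
      pairing (hess G q (tensor c₁ c₂ b q (grad F q))) (tensor c₁ c₂ b q (grad H q)) -
      c₂ * pairing (grad G q) ⁅tensor c₁ c₂ b q (grad F q), grad H q⁆ := by
  set X := tensor c₁ c₂ b q (grad F q) with hX
  have hl := HasDir.line q X
  have h1 := (hasDir_hess G hl).bilin pairingL (HasDir.tensor c₁ c₂ b hl (hasDir_hess H hl))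
  simp only [zero_smul, add_zero] at h1
  have h2 := (hasDir_grad_line (br c₁ c₂ b G H) q X).unique h1
  simp only [pairingL_apply] at h2
  rw [br_apply, pairing_tensor, ← hX, pairing_comm, h2, pairing_add_right, pairing_smul_right]
  linear_combination pairing_comm (tensor c₁ c₂ b q (grad G q)) (hess H q X) -
    pairing_tensor c₁ c₂ b q (grad G q) (hess H q X)

theorem br_jacobi (c₁ c₂ : ℂ) (b : Loop 𝔤) :
    br c₁ c₂ b F (br c₁ c₂ b G H) + br c₁ c₂ b G (br c₁ c₂ b H F) +
      br c₁ c₂ b H (br c₁ c₂ b F G) = 0 := by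
  refine Subtype.ext (funext fun q => ?_)
  change (br c₁ c₂ b F (br c₁ c₂ b G H)).1 q + (br c₁ c₂ b G (br c₁ c₂ b H F)).1 q +
      (br c₁ c₂ b H (br c₁ c₂ b F G)).1 q = 0
  rw [br_br_apply, br_br_apply, br_br_apply]
  have h := cyclic_tensor c₁ c₂ b q (grad F q) (grad G q) (grad H q)
  have h1 := hess_symm F q (tensor c₁ c₂ b q (grad G q)) (tensor c₁ c₂ b q (grad H q))
  have h2 := hess_symm G q (tensor c₁ c₂ b q (grad F q)) (tensor c₁ c₂ b q (grad H q))
  have h3 := hess_symm H q (tensor c₁ c₂ b q (grad F q)) (tensor c₁ c₂ b q (grad G q))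
  linear_combination h3 - h2 + h1 - c₂ * h

/-- The linear functional `(n | ·)`. -/
def linFun (n : Loop 𝔤) : localFunctionals 𝔤 :=
  ⟨fun q => pairing n q, functional_mem (dp.form (killingForm ℂ 𝔤) (IsDP.const n) IsDP.id)⟩

theorem grad_linFun (n q : Loop 𝔤) : grad (linFun n) q = n :=
  grad_eq_of_hasDir _ fun s => by
    have := (HasDir.line q s).map (pairingL n)
    exact this

end LoopAlgebra

/-! ## Homogeneous components -/

section Graded

variable {V : Type*} [AddCommGroup V] [Module ℂ V] {comp : ℤ → Submodule ℂ V}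

/-- The projection to a component of a graded vector space. -/
def proj (hc : DirectSum.IsInternal comp) (i : ℤ) : V →ₗ[ℂ] V :=
  (comp i).subtype ∘ₗ DirectSum.component ℂ ℤ (fun i => comp i) i ∘ₗ
    (LinearEquiv.ofBijective (DirectSum.coeLinearMap comp) hc).symm.toLinearMap

variable (hc : DirectSum.IsInternal comp)

theorem proj_mem (i : ℤ) (x : V) : proj hc i x ∈ comp i := Subtype.coe_prop _

theorem proj_of_mem {i : ℤ} {x : V} (hx : x ∈ comp i) (j : ℤ) :
    proj hc j x = if j = i then x else 0 := by
  have h : (LinearEquiv.ofBijective (DirectSum.coeLinearMap comp) hc).symm x =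
      DirectSum.lof ℂ ℤ (fun i => comp i) i ⟨x, hx⟩ := by
    rw [LinearEquiv.symm_apply_eq]
    exact (DirectSum.coeLinearMap_lof comp i ⟨x, hx⟩).symm
  simp only [proj, LinearMap.comp_apply, LinearEquiv.coe_coe, h]
  split_ifs with hj
  · subst hj
    rw [DirectSum.component.lof_self]
    rfl
  · rw [DirectSum.component.of, dif_neg (Ne.symm hj)]
    rfl

theorem proj_same {i : ℤ} {x : V} (hx : x ∈ comp i) : proj hc i x = x := by
  rw [proj_of_mem hc hx, if_pos rfl]

theorem proj_ne {i j : ℤ} {x : V} (hx : x ∈ comp i) (h : j ≠ i) : proj hc j x = 0 := by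
  rw [proj_of_mem hc hx, if_neg h]

theorem mem_of_proj_mem (K : Submodule ℂ V) {x : V} (h : ∀ i, proj hc i x ∈ K) : x ∈ K := by
  classical
  have h1 : DirectSum.coeLinearMap comp
      ((LinearEquiv.ofBijective (DirectSum.coeLinearMap comp) hc).symm x) = x :=
    (LinearEquiv.ofBijective (DirectSum.coeLinearMap comp) hc).apply_symm_apply x
  rw [← h1, DirectSum.coeLinearMap_eq_dfinsuppSum]
  exact Submodule.dfinsuppSum_mem _ _ _ fun i _ => h i

theorem graded_induction (hc : DirectSum.IsInternal comp) {P : V → Prop}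
    (zero : P 0) (add : ∀ x y, P x → P y → P (x + y))
    (mem : ∀ i, ∀ x ∈ comp i, P x) (x : V) : P x := by
  have h : x ∈ iSup comp := by
    rw [hc.submodule_iSup_eq_top]
    exact Submodule.mem_top
  exact Submodule.iSup_induction comp (motive := P) h mem zero add

/-- A homogeneous linear map commutes with the projections. -/
theorem proj_map {d : ℤ} {φ : V →ₗ[ℂ] V} (hφ : ∀ i, ∀ x ∈ comp i, φ x ∈ comp (i + d)) (i : ℤ)
    (x : V) : proj hc (i + d) (φ x) = φ (proj hc i x) := by
  refine graded_induction hc (P := fun x => proj hc (i + d) (φ x) = φ (proj hc i x)) ?_ ?_ ?_ x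
  · simp
  · intro x y hx hy
    simp only [map_add, hx, hy]
  · intro j x hx
    rcases eq_or_ne i j with rfl | hij
    · rw [proj_same hc hx, proj_same hc (hφ i x hx)]
    · rw [proj_ne hc hx hij, proj_ne hc (hφ j x hx) (by omega), map_zero]

end Graded

/-! ## Representation theory of the triple -/

section Triple

variable {𝔤 : Type*} [LieRing 𝔤] [LieAlgebra ℂ 𝔤]

open LieAlgebra

theorem IsTriple.symm {e h f : 𝔤} (t : IsTriple e h f) : IsTriple f (-h) e where
  lie_h_e := by rw [neg_lie, t.lie_h_f, neg_neg]
  lie_h_f := by rw [neg_lie, t.lie_h_e]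
  lie_e_f := by rw [← lie_skew, t.lie_e_f]

variable [FiniteDimensional ℂ 𝔤] {e h f : 𝔤}

/-- Finitely many eigenvalues exist in finite dimension. This is what terminates the `sl₂` strings
below. -/
theorem exists_zero_of_eigenvectors (x : 𝔤) {y : ℕ → 𝔤} {μ : ℕ → ℂ} (hμ : Function.Injective μ)
    (h : ∀ n, ⁅x, y n⁆ = μ n • y n) : ∃ n, y n = 0 := by
  by_contra! hy
  refine Set.infinite_range_of_injective hμ
    ((Module.End.finite_hasEigenvalue (ad ℂ 𝔤 x)).subset ?_)
  rintro _ ⟨n, rfl⟩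
  exact Module.End.hasEigenvalue_of_hasEigenvector
    ⟨Module.End.mem_eigenspace_iff.2 (h n), hy n⟩

namespace IsTriple

variable (t : IsTriple e h f)
include t

theorem exists_nat {x : 𝔤} (hx : x ≠ 0) (he : ⁅e, x⁆ = 0) {μ : ℂ} (hh : ⁅h, x⁆ = μ • x) :
    ∃ n : ℕ, μ = n := by
  -- `IsSl2Triple` requires `h ≠ 0`; if `h = 0`, the only weight is `0`.
  by_cases h0 : h = 0
  · refine ⟨0, ?_⟩
    rw [h0, zero_lie] at hh
    simpa using (smul_eq_zero.1 hh.symm).resolve_right hx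
  · have t' : IsSl2Triple h e f := ⟨h0, t.lie_e_f, by rw [t.lie_h_e, two_smul, two_smul],
      by rw [t.lie_h_f, two_smul, two_smul]⟩
    exact IsSl2Triple.HasPrimitiveVectorWith.exists_nat (t := t') (m := x) ⟨hx, hh, he⟩

theorem exists_nat' {x : 𝔤} (hx : x ≠ 0) (hf : ⁅f, x⁆ = 0) {μ : ℂ} (hh : ⁅h, x⁆ = μ • x) :
    ∃ n : ℕ, μ = -n := by
  obtain ⟨n, hn⟩ := t.symm.exists_nat hx hf (μ := -μ) (by rw [neg_lie, hh, neg_smul])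
  exact ⟨n, by rw [← hn, neg_neg]⟩

omit [FiniteDimensional ℂ 𝔤] in
theorem lie_h_mem_ker {x : 𝔤} (hx : ⁅e, x⁆ = 0) : ⁅e, ⁅h, x⁆⁆ = 0 := by
  rw [leibniz_lie, hx, lie_zero, add_zero, ← lie_skew e h, t.lie_h_e, neg_lie, smul_lie, hx,
    smul_zero, neg_zero]

/-- A nonzero intersection contains an `ad h`-eigenvector `x = [f, y]` killed by `e`, of weight `n ≥
0`. Weights on `ker ad f` are at most `0`, so `ad h - (n + 2)` is invertible there and `y` can be
corrected to a vector of weight `n + 2`. Applying `ad e` to it repeatedly never gives zero, since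
`ad f` takes each vector to a nonzero multiple of the previous one; this yields infinitely many
weights. -/
theorem ker_inf_range : LinearMap.ker (ad ℂ 𝔤 e) ⊓ LinearMap.range (ad ℂ 𝔤 f) = ⊥ := by
  set K := LinearMap.ker (ad ℂ 𝔤 e) ⊓ LinearMap.range (ad ℂ 𝔤 f) with hK
  by_contra hne
  have : Nontrivial K := Submodule.nontrivial_iff_ne_bot.2 hne
  have hstab : ∀ x ∈ K, ad ℂ 𝔤 h x ∈ K := by
    rintro x ⟨hx, y, rfl⟩
    refine ⟨t.lie_h_mem_ker hx, ⁅h, y⁆ - (2 : ℂ) • y, ?_⟩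
    simp only [ad_apply, lie_sub, lie_smul]
    rw [leibniz_lie h f y, t.lie_h_f, neg_lie, smul_lie]
    abel
  obtain ⟨μ, hμ⟩ := Module.End.exists_eigenvalue ((ad ℂ 𝔤 h).restrict hstab)
  obtain ⟨⟨x, hxe, y, hy⟩, hx⟩ := hμ.exists_hasEigenvector
  have hx0 : x ≠ 0 := fun h0 => hx.2 (Subtype.ext h0)
  have hxh : ⁅h, x⁆ = μ • x := congrArg Subtype.val hx.apply_eq_smul
  have hxe : ⁅e, x⁆ = 0 := hxe
  replace hy : ⁅f, y⁆ = x := hy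
  obtain ⟨n, rfl⟩ := t.exists_nat hx0 hxe hxh
  have hstab' : ∀ k ∈ LinearMap.ker (ad ℂ 𝔤 f),
      (ad ℂ 𝔤 h - ((n : ℂ) + 2) • (LinearMap.id : 𝔤 →ₗ[ℂ] 𝔤)) k ∈ LinearMap.ker (ad ℂ 𝔤 f) := by
    intro k hk
    have hk : ⁅f, k⁆ = 0 := hk
    have h1 := t.symm.lie_h_mem_ker hk
    rw [neg_lie, lie_neg, neg_eq_zero] at h1
    simp [hk, h1]
  have hinj : Function.Injective
      ((ad ℂ 𝔤 h - ((n : ℂ) + 2) • (LinearMap.id : 𝔤 →ₗ[ℂ] 𝔤)).restrict hstab') := by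
    rw [injective_iff_map_eq_zero]
    rintro ⟨k, hk⟩ h1
    by_contra hk0
    have h1' : ⁅h, k⁆ = ((n : ℂ) + 2) • k := by
      have := congrArg Subtype.val h1
      simpa [sub_eq_zero] using this
    obtain ⟨m, hm⟩ := t.exists_nat' (fun h0 => hk0 (Subtype.ext h0)) hk h1'
    have h2 : ((n + 2 + m : ℕ) : ℂ) = 0 := by
      push_cast
      rw [hm]
      ring
    have := Nat.cast_eq_zero.1 h2
    omega
  have hker : ⁅f, ⁅h, y⁆ - ((n : ℂ) + 2) • y⁆ = 0 := by
    have h1 : ⁅h, ⁅f, y⁆⁆ = (n : ℂ) • ⁅f, y⁆ := by rw [hy, hxh]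
    rw [leibniz_lie, t.lie_h_f, neg_lie, smul_lie] at h1
    rw [lie_sub, lie_smul, sub_eq_zero, add_smul, ← h1]
    abel
  obtain ⟨⟨k, hk⟩, hk'⟩ := LinearMap.injective_iff_surjective.1 hinj ⟨_, hker⟩
  have hk' : ⁅h, k⁆ - ((n : ℂ) + 2) • k = ⁅h, y⁆ - ((n : ℂ) + 2) • y :=
    congrArg Subtype.val hk'
  have hk : ⁅f, k⁆ = 0 := hk
  set z : ℕ → 𝔤 := fun m => ((ad ℂ 𝔤 e) ^ m) (y - k) with hz
  have hzs : ∀ m, z (m + 1) = ⁅e, z m⁆ := fun m => by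
    simp only [hz, pow_succ', Module.End.mul_apply, ad_apply]
  have hfz : ⁅f, z 0⁆ = x := by simp [hz, hk, hy]
  have hz0 : z 0 ≠ 0 := fun h0 => hx0 (by rw [← hfz, h0, lie_zero])
  have hh : ∀ m, ⁅h, z m⁆ = ((n : ℂ) + 2 + 2 * m) • z m := by
    intro m
    induction m with
    | zero =>
      simp only [hz, pow_zero, Module.End.one_apply, Nat.cast_zero, mul_zero, add_zero, lie_sub,
        smul_sub]
      rw [← sub_eq_zero] at hk' ⊢
      rw [← neg_eq_zero, ← hk']
      abel
    | succ m ih =>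
      rw [hzs, leibniz_lie, ih, t.lie_h_e, smul_lie, lie_smul, ← add_smul]
      congr 1
      push_cast
      ring
  have hf : ∀ m : ℕ, ⁅f, z (m + 1)⁆ = (-(((m : ℂ) + 1) * (n + 2 + m))) • z m := by
    intro m
    induction m with
    | zero =>
      rw [hzs, leibniz_lie, ← lie_skew f e, t.lie_e_f, neg_lie, hh, hfz, hxe]
      simp [← neg_smul, add_comm]
    | succ m ih =>
      rw [hzs, leibniz_lie, ← lie_skew f e, t.lie_e_f, neg_lie, hh, ih, lie_smul, ← hzs,
        ← neg_smul, ← add_smul]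
      congr 1
      push_cast
      ring
  have hne : ∀ m, z m ≠ 0 := by
    intro m
    induction m with
    | zero => exact hz0
    | succ m ih =>
      intro h0
      have h1 := hf m
      rw [h0, lie_zero] at h1
      refine ih ((smul_eq_zero.1 h1.symm).resolve_left ?_)
      have h2 : (((m + 1) * (n + 2 + m) : ℕ) : ℂ) ≠ 0 := Nat.cast_ne_zero.2 (by positivity)
      push_cast at h2
      exact neg_ne_zero.2 h2
  obtain ⟨m, hm⟩ := exists_zero_of_eigenvectors h (μ := fun m => (n : ℂ) + 2 + 2 * m)
    (fun a b hab => by simpa using hab) hh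
  exact hne m hm

/-- The trivial intersections for the triple and for its mirror image `(f, -h, e)` bound two
dimensions by `dim 𝔤`. By rank–nullity their sum is `2 dim 𝔤`, so both bounds are equalities. -/
theorem isCompl_ker_range : IsCompl (LinearMap.ker (ad ℂ 𝔤 e)) (LinearMap.range (ad ℂ 𝔤 f)) := by
  have h1 := t.ker_inf_range
  have h2 := t.symm.ker_inf_range
  have d1 := Submodule.finrank_sup_add_finrank_inf_eq (LinearMap.ker (ad ℂ 𝔤 e))
    (LinearMap.range (ad ℂ 𝔤 f))
  have d2 := Submodule.finrank_sup_add_finrank_inf_eq (LinearMap.ker (ad ℂ 𝔤 f))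
    (LinearMap.range (ad ℂ 𝔤 e))
  rw [h1, finrank_bot] at d1
  rw [h2, finrank_bot] at d2
  have r1 := (ad ℂ 𝔤 e).finrank_range_add_finrank_ker
  have r2 := (ad ℂ 𝔤 f).finrank_range_add_finrank_ker
  have l2 := Submodule.finrank_le (LinearMap.ker (ad ℂ 𝔤 f) ⊔ LinearMap.range (ad ℂ 𝔤 e))
  refine ⟨disjoint_iff.2 h1, codisjoint_iff.2 (Submodule.eq_top_of_finrank_eq ?_)⟩
  have l1 := Submodule.finrank_le (LinearMap.ker (ad ℂ 𝔤 e) ⊔ LinearMap.range (ad ℂ 𝔤 f))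
  omega

theorem eq_zero_of_ker_range {x y : 𝔤} (he : ⁅e, ⁅f, y⁆⁆ = 0) (hx : x = ⁅f, y⁆) : x = 0 := by
  have h1 : x ∈ LinearMap.ker (ad ℂ 𝔤 e) ⊓ LinearMap.range (ad ℂ 𝔤 f) := by
    rw [hx]
    exact ⟨he, y, rfl⟩
  rwa [t.ker_inf_range] at h1

omit [FiniteDimensional ℂ 𝔤] in
theorem lie_h_pow_f (k : ℕ) (x : 𝔤) :
    ⁅h, ((ad ℂ 𝔤 f) ^ k) x⁆ = ((ad ℂ 𝔤 f) ^ k) (⁅h, x⁆ - (2 * k : ℂ) • x) := by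
  induction k generalizing x with
  | zero => simp
  | succ k ih =>
    rw [pow_succ, Module.End.mul_apply, ih, Module.End.mul_apply]
    congr 1
    simp only [ad_apply, lie_sub, lie_smul]
    rw [leibniz_lie, t.lie_h_f, neg_lie, smul_lie]
    push_cast
    module

/-- `ad h` is not yet known to be diagonalizable, hence the induction on the order of a generalized
eigenvector `x`: once `(ad f)^r` kills `(ad h - μ) x`, the vectors `(ad f)^(r + m) x` satisfy
genuine eigenvector equations for distinct numbers, so one of them is zero. -/
theorem exists_pow_f_eq_zero : ∃ r : ℕ, (ad ℂ 𝔤 f) ^ r = 0 := by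
  have h1 : ∀ x, ∃ r : ℕ, ((ad ℂ 𝔤 f) ^ r) x = 0 := by
    intro x
    have hx : x ∈ ⨆ μ, (ad ℂ 𝔤 h).maxGenEigenspace μ := by
      rw [Module.End.iSup_maxGenEigenspace_eq_top]
      exact Submodule.mem_top
    induction hx using Submodule.iSup_induction' with
    | zero => exact ⟨0, by simp⟩
    | add x y _ _ hx hy =>
      obtain ⟨r, hr⟩ := hx
      obtain ⟨s, hs⟩ := hy
      refine ⟨r + s, ?_⟩
      rw [map_add, pow_add, Module.End.mul_apply, Module.End.mul_apply, hs, map_zero, add_zero,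
        ← Module.End.mul_apply, ← pow_add, add_comm, pow_add, Module.End.mul_apply, hr, map_zero]
    | mem μ x hx =>
      rw [Module.End.mem_maxGenEigenspace] at hx
      obtain ⟨k, hk⟩ := hx
      induction k generalizing x with
      | zero => exact ⟨0, by simpa using hk⟩
      | succ k ih =>
        rw [pow_succ, Module.End.mul_apply] at hk
        obtain ⟨r, hr⟩ := ih _ hk
        have h2 : ∀ m, ⁅h, ((ad ℂ 𝔤 f) ^ (r + m)) x⁆ =
            (μ - 2 * (r + m)) • ((ad ℂ 𝔤 f) ^ (r + m)) x := by
          intro m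
          have h3 : ((ad ℂ 𝔤 f) ^ (r + m)) ((ad ℂ 𝔤 h - μ • 1) x) = 0 := by
            rw [add_comm, pow_add, Module.End.mul_apply, hr, map_zero]
          have h4 : ⁅h, x⁆ = (ad ℂ 𝔤 h - μ • 1) x + μ • x := by simp
          rw [t.lie_h_pow_f, h4, map_sub, map_add, h3, map_smul, map_smul]
          push_cast
          module
        obtain ⟨m, hm⟩ := exists_zero_of_eigenvectors h (y := fun m => ((ad ℂ 𝔤 f) ^ (r + m)) x)
          (μ := fun m : ℕ => μ - 2 * (r + m)) (fun a b hab => by simpa using hab) h2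
        exact ⟨_, hm⟩
  choose r hr using fun i => h1 (Module.finBasis ℂ 𝔤 i)
  refine ⟨∑ i, r i, (Module.finBasis ℂ 𝔤).ext fun i => ?_⟩
  rw [← Finset.sum_erase_add _ _ (Finset.mem_univ i), pow_add, Module.End.mul_apply, hr, map_zero]
  rfl

omit [FiniteDimensional ℂ 𝔤] in
theorem lie_e_pow_f {x : 𝔤} (hx : ⁅e, x⁆ = 0) (k : ℕ) :
    ⁅e, ((ad ℂ 𝔤 f) ^ (k + 1)) x⁆ =
      ((k : ℂ) + 1) • ((ad ℂ 𝔤 f) ^ k) (⁅h, x⁆ - (k : ℂ) • x) := by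
  induction k with
  | zero => simp [leibniz_lie e f x, t.lie_e_f, hx]
  | succ k ih =>
    rw [pow_succ', Module.End.mul_apply, ad_apply, leibniz_lie, t.lie_e_f, ih, t.lie_h_pow_f,
      lie_smul]
    rw [← ad_apply ℂ 𝔤 f, ← Module.End.mul_apply, ← pow_succ', ← map_smul, ← map_add]
    rw [← map_smul]
    congr 1
    push_cast
    module

-- On `ker ad e` the operator `e^r f^r` is a polynomial in `h` with distinct integer roots. As `ad
-- f` is nilpotent, this polynomial annihilates `ker ad e` for large `r`, so `ad h` is
-- diagonalizable there.
omit [FiniteDimensional ℂ 𝔤] in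
open Polynomial in
theorem pow_e_pow_f {x : 𝔤} (hx : ⁅e, x⁆ = 0) (r : ℕ) :
    ((ad ℂ 𝔤 e) ^ r) (((ad ℂ 𝔤 f) ^ r) x) =
      (r.factorial : ℂ) • aeval (ad ℂ 𝔤 h) (∏ i ∈ Finset.range r, (X - C (i : ℂ))) x := by
  induction r generalizing x with
  | zero => simp
  | succ r ih =>
    rw [pow_succ, Module.End.mul_apply, ad_apply, t.lie_e_pow_f hx, map_smul, ih,
      Finset.prod_range_succ, map_mul, Module.End.mul_apply, smul_smul, Nat.factorial_succ]
    · congr 1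
      · push_cast
        ring
      · congr 1
        simp [Nat.cast_smul_eq_nsmul]
    · rw [lie_sub, lie_smul, hx, t.lie_h_mem_ker hx, smul_zero, sub_zero]

open Polynomial in
theorem ker_le_iSup_eigenspace :
    LinearMap.ker (ad ℂ 𝔤 e) ≤ ⨆ m : ℤ, Module.End.eigenspace (ad ℂ 𝔤 h) (m : ℂ) := by
  obtain ⟨r, hr⟩ := t.exists_pow_f_eq_zero
  intro x hx
  have h1 : x ∈ LinearMap.ker (aeval (ad ℂ 𝔤 h) (∏ i ∈ Finset.range r, (X - C (i : ℂ)))) := by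
    have h2 := t.pow_e_pow_f hx r
    rw [hr, LinearMap.zero_apply, map_zero] at h2
    exact (smul_eq_zero.1 h2.symm).resolve_left (Nat.cast_ne_zero.2 r.factorial_ne_zero)
  refine SetLike.le_def.1 ?_ h1
  clear h1 hr
  induction r with
  | zero => simp [Module.End.one_eq_id]
  | succ r ih =>
    rw [Finset.prod_range_succ, ← Polynomial.sup_ker_aeval_eq_ker_aeval_mul_of_coprime]
    · refine sup_le ih (le_iSup_of_le (r : ℤ) fun y hy => ?_)
      rw [Module.End.mem_eigenspace_iff]
      simpa [sub_eq_zero, Module.algebraMap_end_apply, Nat.cast_smul_eq_nsmul] using hy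
    · refine IsCoprime.prod_left fun i hi => isCoprime_X_sub_C_of_isUnit_sub (Ne.isUnit ?_)
      rw [sub_ne_zero]
      exact_mod_cast (Finset.mem_range.1 hi).ne

/-- The sum `W` of the integral weight spaces contains `ker ad e` and is stable under `ad f`.
Applying `𝔤 = ker ad e + im ad f` repeatedly writes any vector, modulo `W`, as `(ad f)^k y`, which
is zero for large `k`. -/
theorem iSup_eigenspace : ⨆ m : ℤ, Module.End.eigenspace (ad ℂ 𝔤 h) (m : ℂ) = ⊤ := by
  set W := ⨆ m : ℤ, Module.End.eigenspace (ad ℂ 𝔤 h) (m : ℂ) with hW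
  have hf : ∀ x ∈ W, ⁅f, x⁆ ∈ W := by
    intro x hx
    induction hx using Submodule.iSup_induction' with
    | zero => simp
    | add x y _ _ hx hy => simpa using add_mem hx hy
    | mem m x hx =>
      refine Submodule.mem_iSup_of_mem (m - 2) ?_
      rw [Module.End.mem_eigenspace_iff, ad_apply] at hx ⊢
      rw [leibniz_lie, hx, t.lie_h_f, neg_lie, smul_lie, lie_smul]
      push_cast
      module
  obtain ⟨r, hr⟩ := t.exists_pow_f_eq_zero
  have key : ∀ (k : ℕ) (x : 𝔤), ∃ y, x - ((ad ℂ 𝔤 f) ^ k) y ∈ W := by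
    intro k
    induction k with
    | zero => exact fun x => ⟨x, by simp⟩
    | succ k ih =>
      intro x
      obtain ⟨y, hy⟩ := ih x
      have h1 : y ∈ LinearMap.ker (ad ℂ 𝔤 e) ⊔ LinearMap.range (ad ℂ 𝔤 f) := by
        rw [t.isCompl_ker_range.sup_eq_top]
        exact Submodule.mem_top
      obtain ⟨u, hu, _, ⟨z, rfl⟩, rfl⟩ := Submodule.mem_sup.1 h1
      have h2 : ∀ k : ℕ, ((ad ℂ 𝔤 f) ^ k) u ∈ W := by
        intro k
        induction k with
        | zero => exact t.ker_le_iSup_eigenspace hu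
        | succ k ih =>
          rw [pow_succ', Module.End.mul_apply]
          exact hf _ ih
      refine ⟨z, ?_⟩
      have := add_mem hy (h2 k)
      rwa [map_add, ← Module.End.mul_apply, ← pow_succ, sub_add_eq_sub_sub_swap,
        sub_add_cancel] at this
  refine eq_top_iff.2 fun x _ => ?_
  obtain ⟨y, hy⟩ := key r x
  simpa [hr] using hy

theorem isInternal_eigenspace :
    DirectSum.IsInternal fun m : ℤ => Module.End.eigenspace (ad ℂ 𝔤 h) (m : ℂ) :=
  DirectSum.isInternal_submodule_of_iSupIndep_of_iSup_eq_top
    ((Module.End.eigenspaces_iSupIndep (ad ℂ 𝔤 h)).comp Int.cast_injective) t.iSup_eigenspace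

/-- The Dynkin grading. -/
def dynkin : GoodGrading e h f where
  comp m := Module.End.eigenspace (ad ℂ 𝔤 h) (m : ℂ)
  isInternal := t.isInternal_eigenspace
  lie_mem i j x hx y hy := by
    rw [Module.End.mem_eigenspace_iff, ad_apply] at hx hy ⊢
    rw [leibniz_lie, hx, hy, smul_lie, lie_smul, ← add_smul]
    push_cast
    rfl
  e_mem := by
    rw [Module.End.mem_eigenspace_iff, ad_apply, t.lie_h_e]
    norm_num
  h_mem := by simp
  f_mem := by
    rw [Module.End.mem_eigenspace_iff, ad_apply, t.lie_h_f]
    simp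
  injective j hj x hx hfx := by
    by_contra hx0
    rw [Module.End.mem_eigenspace_iff, ad_apply] at hx
    obtain ⟨n, hn⟩ := t.exists_nat' hx0 hfx hx
    have : j = -n := by exact_mod_cast hn
    omega
  surjective j hj y hy := by
    have h1 : y ∈ LinearMap.ker (ad ℂ 𝔤 e) ⊔ LinearMap.range (ad ℂ 𝔤 f) := by
      rw [t.isCompl_ker_range.sup_eq_top]
      exact Submodule.mem_top
    obtain ⟨u, hu, _, ⟨z, rfl⟩, rfl⟩ := Submodule.mem_sup.1 h1
    have hfd : ∀ i : ℤ, ∀ x ∈ Module.End.eigenspace (ad ℂ 𝔤 h) (i : ℂ),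
        ad ℂ 𝔤 f x ∈ Module.End.eigenspace (ad ℂ 𝔤 h) ((i + -2 : ℤ) : ℂ) := by
      intro i x hx
      rw [Module.End.mem_eigenspace_iff, ad_apply] at hx ⊢
      rw [ad_apply, leibniz_lie, hx, t.lie_h_f, neg_lie, smul_lie, lie_smul]
      push_cast
      module
    have hed : ∀ i : ℤ, ∀ x ∈ Module.End.eigenspace (ad ℂ 𝔤 h) (i : ℂ),
        ad ℂ 𝔤 e x ∈ Module.End.eigenspace (ad ℂ 𝔤 h) ((i + 2 : ℤ) : ℂ) := by
      intro i x hx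
      rw [Module.End.mem_eigenspace_iff, ad_apply] at hx ⊢
      rw [ad_apply, leibniz_lie, hx, t.lie_h_e, smul_lie, lie_smul]
      push_cast
      module
    have hc := t.isInternal_eigenspace
    have hu0 : proj hc (j - 2) u = 0 := by
      by_contra hne
      have h2 : ⁅e, proj hc (j - 2) u⁆ = 0 := by
        have h3 := proj_map hc hed (j - 2) u
        rw [LinearMap.mem_ker.1 hu, map_zero] at h3
        exact h3.symm
      obtain ⟨n, hn⟩ := t.exists_nat hne h2
        (Module.End.mem_eigenspace_iff.1 (proj_mem hc (j - 2) u))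
      have : j - 2 = n := by exact_mod_cast hn
      omega
    refine ⟨proj hc j z, proj_mem hc j z, ?_⟩
    have h4 := proj_same hc hy
    rw [map_add, hu0, zero_add] at h4
    rw [← h4]
    exact (proj_map hc hfd j z).symm

end IsTriple

end Triple

/-! ### The splitting `𝔤 = ker ad f ⊕ [e, im ad f]` -/

section Sigma

variable {𝔤 : Type*} [LieRing 𝔤] [LieAlgebra ℂ 𝔤] [FiniteDimensional ℂ 𝔤] {e h f : 𝔤}

open LieAlgebra

namespace IsTriple

variable (t : IsTriple e h f)
include t

/-- Combines `𝔤 = ker ad f ⊕ im ad e` with `𝔤 = ker ad e ⊕ im ad f`: by the latter, `ad e` maps `im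
ad f` isomorphically onto `im ad e`. -/
theorem sum_bijective : Function.Bijective ((LinearMap.ker (ad ℂ 𝔤 f)).subtype.coprod
    (ad ℂ 𝔤 e ∘ₗ (LinearMap.range (ad ℂ 𝔤 f)).subtype)) := by
  constructor
  · rw [injective_iff_map_eq_zero]
    rintro ⟨⟨k, hk⟩, ⟨_, z, rfl⟩⟩ h0
    have h0 : k + ⁅e, ⁅f, z⁆⁆ = 0 := h0
    have hk : ⁅f, k⁆ = 0 := hk
    have h1 : ⁅e, ⁅f, z⁆⁆ = 0 := by
      refine t.symm.eq_zero_of_ker_range ?_ rfl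
      have h2 := congrArg (fun x => ⁅f, x⁆) h0
      simpa [hk] using h2
    have h2 : ⁅f, z⁆ = 0 := t.eq_zero_of_ker_range h1 rfl
    rw [h1, add_zero] at h0
    exact Prod.ext (Subtype.ext h0) (Subtype.ext h2)
  · intro x
    have h1 : x ∈ LinearMap.ker (ad ℂ 𝔤 f) ⊔ LinearMap.range (ad ℂ 𝔤 e) := by
      rw [t.symm.isCompl_ker_range.sup_eq_top]
      exact Submodule.mem_top
    obtain ⟨k, hk, _, ⟨y, rfl⟩, rfl⟩ := Submodule.mem_sup.1 h1
    have h2 : y ∈ LinearMap.ker (ad ℂ 𝔤 e) ⊔ LinearMap.range (ad ℂ 𝔤 f) := by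
      rw [t.isCompl_ker_range.sup_eq_top]
      exact Submodule.mem_top
    obtain ⟨u, hu, w, hw, rfl⟩ := Submodule.mem_sup.1 h2
    refine ⟨(⟨k, hk⟩, ⟨w, hw⟩), ?_⟩
    have hu : ⁅e, u⁆ = 0 := hu
    simp [hu]

/-- The component `σ x ∈ im ad f` in the decomposition `x = k + [e, σ x]` with `k ∈ ker ad f`. -/
def sigma : 𝔤 →ₗ[ℂ] 𝔤 :=
  (LinearMap.range (ad ℂ 𝔤 f)).subtype ∘ₗ LinearMap.snd ℂ _ _ ∘ₗ
    (LinearEquiv.ofBijective _ t.sum_bijective).symm.toLinearMap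

theorem sigma_mem (x : 𝔤) : t.sigma x ∈ LinearMap.range (ad ℂ 𝔤 f) := Subtype.coe_prop _

theorem lie_f_sub (x : 𝔤) : ⁅f, x - ⁅e, t.sigma x⁆⁆ = 0 := by
  set p := (LinearEquiv.ofBijective _ t.sum_bijective).symm x with hp
  have h1 : p.1.1 + ⁅e, t.sigma x⁆ = x :=
    (LinearEquiv.ofBijective _ t.sum_bijective).apply_symm_apply x
  have h2 : x - ⁅e, t.sigma x⁆ = p.1.1 := by
    rw [sub_eq_iff_eq_add]
    exact h1.symm
  rw [h2]
  exact p.1.2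

theorem sigma_eq {x y : 𝔤} (hy : y ∈ LinearMap.range (ad ℂ 𝔤 f)) (h : ⁅f, x - ⁅e, y⁆⁆ = 0) :
    t.sigma x = y := by
  have h1 : (LinearEquiv.ofBijective _ t.sum_bijective).symm x = (⟨_, h⟩, ⟨y, hy⟩) := by
    rw [LinearEquiv.symm_apply_eq]
    change x = (x - ⁅e, y⁆) + ⁅e, y⁆
    rw [sub_add_cancel]
  simp only [sigma, LinearMap.comp_apply, LinearEquiv.coe_coe, h1]
  rfl

theorem sigma_of_ker {x : 𝔤} (hx : ⁅f, x⁆ = 0) : t.sigma x = 0 :=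
  t.sigma_eq (zero_mem _) (by simpa using hx)

theorem lie_f_eq_zero_of_sigma {x : 𝔤} (hx : t.sigma x = 0) : ⁅f, x⁆ = 0 := by
  simpa [hx] using t.lie_f_sub x

end IsTriple

end Sigma

/-! ### Filtrations defined by good gradings -/

section Grading

variable {𝔤 : Type*} [LieRing 𝔤] [LieAlgebra ℂ 𝔤] {e h f : 𝔤}

open LieAlgebra

namespace GoodGrading

variable (Γ : GoodGrading e h f)

/-- The filtration defined by a grading: the sum of the components of degree at most `j`. -/
def V (j : ℤ) : Submodule ℂ 𝔤 := ⨅ i : {i : ℤ // j < i}, LinearMap.ker (proj Γ.isInternal i.1)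

variable {Γ}

theorem mem_V {j : ℤ} {x : 𝔤} : x ∈ Γ.V j ↔ ∀ i, j < i → proj Γ.isInternal i x = 0 := by
  simp [V, Submodule.mem_iInf]

theorem V_mono {i j : ℤ} (hij : i ≤ j) : Γ.V i ≤ Γ.V j := fun _ hx =>
  mem_V.2 fun k hk => mem_V.1 hx k (by omega)

theorem comp_le_V {i j : ℤ} (hij : i ≤ j) : Γ.comp i ≤ Γ.V j := fun _ hx =>
  mem_V.2 fun k hk => proj_ne _ hx (by omega)

theorem V_le_of_comp {j : ℤ} {K : Submodule ℂ 𝔤} (h : ∀ i ≤ j, Γ.comp i ≤ K) : Γ.V j ≤ K := by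
  intro x hx
  refine mem_of_proj_mem Γ.isInternal K fun i => ?_
  rcases le_or_gt i j with hi | hi
  · exact h i hi (proj_mem _ _ _)
  · rw [mem_V.1 hx i hi]
    exact zero_mem _

theorem lie_mem_V {i j k : ℤ} (hk : i + j ≤ k) {x y : 𝔤} (hx : x ∈ Γ.V i) (hy : y ∈ Γ.V j) :
    ⁅x, y⁆ ∈ Γ.V k := by
  have h1 : Γ.V i ≤ (Γ.V k).comap (ad ℂ 𝔤 y) := by
    refine V_le_of_comp fun l hl u hu => ?_
    have h2 : Γ.V j ≤ (Γ.V k).comap (ad ℂ 𝔤 u) := by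
      refine V_le_of_comp fun m hm v hv => ?_
      exact comp_le_V (by omega) (Γ.lie_mem l m u hu v hv)
    rw [Submodule.mem_comap, ad_apply, ← lie_skew]
    exact neg_mem (h2 hy)
  rw [← lie_skew]
  exact neg_mem (h1 hx)

theorem e_mem_V : e ∈ Γ.V 2 := comp_le_V le_rfl Γ.e_mem

theorem f_hom (i : ℤ) (x : 𝔤) (hx : x ∈ Γ.comp i) : ad ℂ 𝔤 f x ∈ Γ.comp (i + -2) := by
  rw [add_comm]
  exact Γ.lie_mem _ _ _ Γ.f_mem _ hx

theorem e_hom (i : ℤ) (x : 𝔤) (hx : x ∈ Γ.comp i) : ad ℂ 𝔤 e x ∈ Γ.comp (i + 2) := by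
  rw [add_comm]
  exact Γ.lie_mem _ _ _ Γ.e_mem _ hx

theorem proj_ker {x : 𝔤} (hx : ⁅f, x⁆ = 0) (i : ℤ) : ⁅f, proj Γ.isInternal i x⁆ = 0 := by
  have h1 := proj_map Γ.isInternal Γ.f_hom i x
  rw [ad_apply, hx, map_zero] at h1
  exact h1.symm

theorem ker_le_V : LinearMap.ker (ad ℂ 𝔤 f) ≤ Γ.V 0 := fun x hx =>
  mem_V.2 fun i hi => Γ.injective i (by omega) _ (proj_mem _ _ _) (proj_ker hx i)

theorem V_le_range : Γ.V (-1) ≤ LinearMap.range (ad ℂ 𝔤 f) := by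
  refine V_le_of_comp fun i hi y hy => ?_
  obtain ⟨x, -, hx⟩ := Γ.surjective (i + 2) (by omega) y (by simpa using hy)
  exact ⟨x, hx⟩

variable [FiniteDimensional ℂ 𝔤]

/-- `sigma` depends only on the triple, but it is built from `ad e` and `ad f`, homogeneous for
every good grading; hence it has degree `-2` for all of them. -/
theorem sigma_mem_V (t : IsTriple e h f) {j k : ℤ} (hk : j ≤ k + 2) {x : 𝔤} (hx : x ∈ Γ.V j) :
    t.sigma x ∈ Γ.V k := by
  have h1 : Γ.V j ≤ (Γ.V k).comap t.sigma := by
    refine V_le_of_comp fun i hi x hx => ?_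
    obtain ⟨z, hz⟩ := t.sigma_mem x
    -- For homogeneous `x`, the component of `σ x` in degree `i - 2` satisfies the same defining
    -- conditions, so uniqueness applies.
    have h2 : t.sigma x = proj Γ.isInternal (i - 2) (t.sigma x) := by
      refine t.sigma_eq ⟨proj Γ.isInternal i z, ?_⟩ ?_
      · rw [← hz]
        exact (proj_map Γ.isInternal Γ.f_hom i z).symm
      · have h3 := proj_ker (Γ := Γ) (t.lie_f_sub x) i
        have h4 := proj_map Γ.isInternal Γ.e_hom (i - 2) (t.sigma x)
        rw [sub_add_cancel] at h4
        rw [map_sub, proj_same _ hx, ← ad_apply ℂ 𝔤 e, h4] at h3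
        exact h3
    rw [Submodule.mem_comap, h2]
    exact comp_le_V (by omega) (proj_mem _ _ _)
  exact h1 hx

variable (Γ) in
theorem exists_bound : ∃ M : ℕ, Γ.V (-M) = ⊥ ∧ Γ.V M = ⊤ := by
  have hfin : {i | Γ.comp i ≠ ⊥}.Finite := WellFoundedGT.finite_ne_bot_of_iSupIndep
    Γ.isInternal.submodule_iSupIndep
  obtain ⟨M, hM⟩ := (hfin.image Int.natAbs).bddAbove
  have h0 : ∀ i : ℤ, M < i.natAbs → Γ.comp i = ⊥ := by
    intro i hi
    by_contra hne
    have := hM ⟨i, hne, rfl⟩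
    omega
  refine ⟨M + 1, ?_, ?_⟩
  · rw [eq_bot_iff]
    refine V_le_of_comp fun i hi => ?_
    rw [h0 i (by omega)]
  · rw [eq_top_iff]
    refine fun x _ => mem_V.2 fun i hi => ?_
    have h1 := proj_mem Γ.isInternal i x
    rwa [h0 i (by omega)] at h1

theorem killingForm_comp {i j : ℤ} (hij : i + j ≠ 0) {x y : 𝔤} (hx : x ∈ Γ.comp i)
    (hy : y ∈ Γ.comp j) : killingForm ℂ 𝔤 x y = 0 := by
  rw [LieModule.traceForm_apply_apply]
  refine LinearMap.trace_eq_zero_of_mapsTo_ne Γ.isInternal (fun k => i + (j + k))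
    (fun k => by omega) fun k z hz => ?_
  exact Γ.lie_mem _ _ _ hx _ (Γ.lie_mem _ _ _ hy _ hz)

theorem killingForm_V {i j : ℤ} (hij : i + j < 0) {x y : 𝔤} (hx : x ∈ Γ.V i)
    (hy : y ∈ Γ.V j) : killingForm ℂ 𝔤 x y = 0 := by
  have h1 : Γ.V j ≤ LinearMap.ker (killingForm ℂ 𝔤 x) := by
    refine V_le_of_comp fun l hl v hv => ?_
    have h2 : Γ.V i ≤ LinearMap.ker ((killingForm ℂ 𝔤).flip v) := by
      refine V_le_of_comp fun k hk u hu => ?_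
      exact killingForm_comp (by omega) hu hv
    exact h2 hx
  exact h1 hy

theorem killingForm_proj {i : ℤ} {y : 𝔤} (hy : y ∈ Γ.comp (-i)) (x : 𝔤) :
    killingForm ℂ 𝔤 (proj Γ.isInternal i x) y = killingForm ℂ 𝔤 x y := by
  refine graded_induction Γ.isInternal
    (P := fun x => killingForm ℂ 𝔤 (proj Γ.isInternal i x) y = killingForm ℂ 𝔤 x y) ?_ ?_ ?_ x
  · simp
  · intro x z hx hz
    simp only [map_add, LinearMap.add_apply, hx, hz]
  · intro j x hx
    rcases eq_or_ne i j with rfl | hij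
    · rw [proj_same _ hx]
    · rw [proj_ne _ hx hij, map_zero, LinearMap.zero_apply, killingForm_comp (by omega) hx hy]

end GoodGrading

/-! ### The level surface of a reduction datum -/

namespace ReductionDatum

open GoodGrading

variable (d : ReductionDatum e h f)

/-- The subspace of the coisotropic subspace spanned by the isotropic subspace and the components
of degree at most `-2`. -/
def moment : Submodule ℂ 𝔤 := d.iso ⊔ d.V (-2)

/-- The orthogonal complement of `moment`. -/
def level : Submodule ℂ 𝔤 := (killingForm ℂ 𝔤).orthogonal d.moment

variable {d}

theorem mem_level {b : 𝔤} : b ∈ d.level ↔ ∀ m ∈ d.moment, killingForm ℂ 𝔤 m b = 0 := Iff.rfl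

theorem coiso_le_V : d.coiso ≤ d.V (-1) := fun _ hx => comp_le_V le_rfl hx.1

theorem iSup_comp : ⨆ i : {i : ℤ // i ≤ -2}, d.comp i.1 = d.V (-2) := by
  refine le_antisymm (iSup_le fun i => comp_le_V i.2) (V_le_of_comp fun i hi => ?_)
  exact le_iSup (fun i : {i : ℤ // i ≤ -2} => d.comp i.1) ⟨i, hi⟩

theorem nil_eq : d.nil = d.coiso ⊔ d.V (-2) := by
  rw [nil, iSup_comp]

theorem moment_le_nil : d.moment ≤ d.nil := by
  rw [nil_eq]
  exact sup_le_sup_right (fun x hx => ⟨d.iso_le hx, fun y hy => d.isotropic x hx y hy⟩) _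

theorem nil_le_V : d.nil ≤ d.V (-1) := by
  rw [nil_eq]
  exact sup_le coiso_le_V (V_mono (by omega))

theorem V_le_nil : d.V (-2) ≤ d.nil := by
  rw [nil_eq]
  exact le_sup_right

theorem V_le_moment : d.V (-2) ≤ d.moment := le_sup_right

theorem nil_le_range : d.nil ≤ LinearMap.range (ad ℂ 𝔤 f) := nil_le_V.trans V_le_range

theorem lie_nil_mem {n m : 𝔤} (hn : n ∈ d.nil) (hm : m ∈ d.nil) : ⁅n, m⁆ ∈ d.nil :=
  V_le_nil (lie_mem_V (by norm_num) (nil_le_V hn) (nil_le_V hm))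

variable [FiniteDimensional ℂ 𝔤]

/-- `𝔩'` is orthogonal to `𝔩` by definition, and every other bracket lies in degree at most `-3`,
where `⟨e | ·⟩` vanishes. This is the reason for defining `level` by `moment` and not by all of `𝔫`:
it makes `[e, 𝔫] ⊂ level`. -/
theorem killingForm_e_lie {n m : 𝔤} (hn : n ∈ d.nil) (hm : m ∈ d.moment) :
    killingForm ℂ 𝔤 e ⁅n, m⁆ = 0 := by
  have h3 : ∀ {x : 𝔤}, x ∈ d.V (-3) → killingForm ℂ 𝔤 e x = 0 := fun hx =>
    killingForm_V (by norm_num) e_mem_V hx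
  have hm' := nil_le_V (moment_le_nil hm)
  rw [nil_eq] at hn
  obtain ⟨c, hc, w, hw, rfl⟩ := Submodule.mem_sup.1 hn
  obtain ⟨i, hi, w', hw', rfl⟩ := Submodule.mem_sup.1 hm
  rw [add_lie, lie_add c, map_add, map_add, hc.2 i hi,
    h3 (lie_mem_V (by norm_num) (coiso_le_V hc) hw'),
    h3 (lie_mem_V (by norm_num) hw hm'), add_zero, add_zero]

theorem lie_e_mem_level {n : 𝔤} (hn : n ∈ d.nil) : ⁅e, n⁆ ∈ d.level := by
  intro m hm
  have h1 := killingForm_e_lie hn hm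
  change killingForm ℂ 𝔤 m ⁅e, n⁆ = 0
  rw [LieModule.traceForm_comm, LieModule.traceForm_apply_lie_apply, h1]

omit [FiniteDimensional ℂ 𝔤] in
theorem lie_mem_level {n b : 𝔤} (hn : n ∈ d.nil) (hb : b ∈ d.level) : ⁅n, b⁆ ∈ d.level := by
  intro m hm
  change killingForm ℂ 𝔤 m ⁅n, b⁆ = 0
  rw [← LieModule.traceForm_apply_lie_apply]
  exact mem_level.1 hb _ (V_le_moment
    (lie_mem_V (by norm_num) (nil_le_V (moment_le_nil hm)) (nil_le_V hn)))

theorem V_le_level : d.V 0 ≤ d.level := fun _ hx _ hm =>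
  killingForm_V (i := -1) (j := 0) (by norm_num) (nil_le_V (moment_le_nil hm)) hx

theorem ker_le_level : LinearMap.ker (ad ℂ 𝔤 f) ≤ d.level := ker_le_V.trans V_le_level

theorem nil_le_level : d.nil ≤ d.level := nil_le_V.trans ((V_mono (by omega)).trans V_le_level)

omit [FiniteDimensional ℂ 𝔤] in
theorem borel_le_level : d.borel ≤ d.level := fun _ hb m hm => hb m (moment_le_nil hm)

variable [LieAlgebra.IsKilling ℂ 𝔤]

theorem level_le_V : d.level ≤ d.V 1 := by
  intro b hb
  refine mem_V.2 fun i hi => eq_zero_of_killingForm fun y => ?_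
  refine graded_induction d.isInternal
    (P := fun y => killingForm ℂ 𝔤 (proj d.isInternal i b) y = 0) ?_ ?_ ?_ y
  · simp
  · intro x z hx hz
    simp only [map_add, hx, hz, add_zero]
  · intro j y hy
    rcases eq_or_ne (i + j) 0 with hij | hij
    · obtain rfl : j = -i := by omega
      rw [killingForm_proj hy, LieModule.traceForm_comm]
      exact hb y (V_le_moment (comp_le_V (by omega) hy))
    · exact killingForm_comp hij (proj_mem _ _ _) hy

/-- Only the component `y` of `σ b` in degree `-1` is in question. Since `ker ad f` lives in degrees
at most `0`, `[e, y]` is the component of `b` in degree `1`; it is orthogonal to `𝔩`, which says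
that `y ∈ 𝔩'`. So gauge fixing uses only parameters in `L𝔫`. -/
theorem sigma_mem_nil (t : IsTriple e h f) {b : 𝔤} (hb : b ∈ d.level) : t.sigma b ∈ d.nil := by
  have h1 : t.sigma b ∈ d.V (-1) := sigma_mem_V t (by norm_num) (level_le_V hb)
  set y := proj d.isInternal (-1) (t.sigma b) with hy
  have hyc : y ∈ d.comp (-1) := proj_mem _ _ _
  have h2 : t.sigma b - y ∈ d.V (-2) := by
    refine mem_V.2 fun i hi => ?_
    rcases eq_or_ne i (-1) with rfl | hne
    · rw [map_sub, hy, proj_same _ hyc, sub_self]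
    · rw [map_sub, mem_V.1 h1 i (by omega), proj_ne _ hyc hne, sub_zero]
  have h3 : y ∈ d.coiso := by
    refine ⟨hyc, fun l hl => ?_⟩
    have h4 : ⁅e, y⁆ = proj d.isInternal 1 b := by
      have h5 := mem_V.1 (ker_le_V (Γ := d.toGoodGrading) (t.lie_f_sub b)) 1 (by omega)
      rw [map_sub, sub_eq_zero] at h5
      rw [h5]
      have h6 := proj_map d.isInternal d.e_hom (-1) (t.sigma b)
      norm_num at h6
      exact h6.symm
    rw [← LieModule.traceForm_apply_lie_apply, h4]
    rw [killingForm_proj (d.iso_le hl), LieModule.traceForm_comm]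
    exact hb l (Submodule.mem_sup_left hl)
  rw [nil_eq]
  have := Submodule.add_mem_sup h3 h2
  rwa [add_sub_cancel] at this

theorem mem_moment_of_orthogonal {v : 𝔤} (hv : ∀ b ∈ d.level, killingForm ℂ 𝔤 v b = 0) :
    v ∈ d.moment := by
  rw [← LinearMap.BilinForm.orthogonal_orthogonal
    (LieAlgebra.IsKilling.killingForm_nondegenerate ℂ 𝔤)
    (LieModule.traceForm_isSymm ℂ 𝔤 𝔤).isRefl d.moment]
  intro b hb
  change killingForm ℂ 𝔤 b v = 0
  rw [LieModule.traceForm_comm]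
  exact hv b hb

end ReductionDatum

variable [FiniteDimensional ℂ 𝔤] [LieAlgebra.IsKilling ℂ 𝔤]

/-- `ad f` is skew for the Killing form, so `ker ad f` and `im ad f` are each other's orthogonals.
-/
theorem mem_range_of_orthogonal_ker {v : 𝔤} (hv : ∀ k, ⁅f, k⁆ = 0 → killingForm ℂ 𝔤 v k = 0) :
    v ∈ LinearMap.range (ad ℂ 𝔤 f) := by
  rw [← LinearMap.BilinForm.orthogonal_orthogonal
    (LieAlgebra.IsKilling.killingForm_nondegenerate ℂ 𝔤)
    (LieModule.traceForm_isSymm ℂ 𝔤 𝔤).isRefl (LinearMap.range (ad ℂ 𝔤 f))]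
  intro k hk
  change killingForm ℂ 𝔤 k v = 0
  rw [LieModule.traceForm_comm]
  refine hv k (eq_zero_of_killingForm fun y => ?_)
  have h1 : killingForm ℂ 𝔤 ⁅f, y⁆ k = 0 := hk _ ⟨y, rfl⟩
  rw [← lie_skew, map_neg, LinearMap.neg_apply, LieModule.traceForm_apply_lie_apply,
    LieModule.traceForm_comm, h1, neg_zero]

end Grading

/-! ## Exponentials of nilpotent inner derivations -/

section Exponential

/-- A double sum over a triangle equals the sum over a square if the summands vanish outside of a
square that is contained in the triangle. -/
theorem sum_antidiagonal_eq_sum_range {E : Type*} [AddCommMonoid E] (g : ℕ → ℕ → E) {M N : ℕ}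
    (hN : 2 * M ≤ N) (h₁ : ∀ a b, M ≤ a → g a b = 0) (h₂ : ∀ a b, M ≤ b → g a b = 0) :
    ∑ k ∈ Finset.range N, ∑ p ∈ Finset.HasAntidiagonal.antidiagonal k, g p.1 p.2 =
      ∑ a ∈ Finset.range N, ∑ b ∈ Finset.range N, g a b := by
  have hz : ∀ p : ℕ × ℕ, p ∉ Finset.range M ×ˢ Finset.range M → g p.1 p.2 = 0 := by
    intro p hp
    simp only [Finset.mem_product, Finset.mem_range, not_and_or, not_lt] at hp
    exact hp.elim (h₁ _ _) (h₂ _ _)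
  have hs : Finset.range M ⊆ Finset.range N := Finset.range_subset_range.2 (by omega)
  rw [← Finset.sum_product', ← Finset.sum_subset (Finset.product_subset_product hs hs)
    fun p _ hp => hz p hp]
  rw [← Finset.sum_fiberwise_of_maps_to (t := Finset.range N) (g := fun p : ℕ × ℕ => p.1 + p.2)]
  · refine Finset.sum_congr rfl fun k _ => ?_
    symm
    refine Finset.sum_subset (fun p hp => ?_) fun p hp hp' => hz p fun hp'' => hp' ?_
    · simpa using (Finset.mem_filter.1 hp).2
    · exact Finset.mem_filter.2 ⟨hp'', by simpa using hp⟩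
  · intro p hp
    simp only [Finset.mem_product, Finset.mem_range] at hp ⊢
    omega

variable {𝔏 : Type*} [LieRing 𝔏] [LieAlgebra ℂ 𝔏]

open LieAlgebra

/-- The divided power `(ad n)ᵏ / k!` applied to a vector. -/
def dpow (n : 𝔏) (k : ℕ) : Module.End ℂ 𝔏 := (k.factorial : ℂ)⁻¹ • (ad ℂ 𝔏 n) ^ k

theorem dpow_zero (n x : 𝔏) : dpow n 0 x = x := by simp [dpow]

theorem lie_dpow (n x : 𝔏) (k : ℕ) : ⁅n, dpow n k x⁆ = ((k : ℂ) + 1) • dpow n (k + 1) x := by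
  have h : ((k : ℂ) + 1) ≠ 0 := Nat.cast_add_one_ne_zero k
  simp only [dpow, LinearMap.smul_apply, lie_smul, pow_succ', Module.End.mul_apply, ad_apply,
    smul_smul, Nat.factorial_succ, Nat.cast_mul, Nat.cast_add, Nat.cast_one]
  congr 1
  field_simp

/-- The truncated exponential of `ad n`. -/
def expAd (N : ℕ) (n : 𝔏) : Module.End ℂ 𝔏 := ∑ k ∈ Finset.range N, dpow n k

/-- The truncation of `(exp (ad n) - 1) / ad n`. -/
def psiAd (N : ℕ) (n : 𝔏) : Module.End ℂ 𝔏 :=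
  ∑ k ∈ Finset.range N, ((k : ℂ) + 1)⁻¹ • dpow n k

theorem expAd_apply (N : ℕ) (n x : 𝔏) : expAd N n x = ∑ k ∈ Finset.range N, dpow n k x := by
  simp [expAd]

theorem psiAd_apply (N : ℕ) (n x : 𝔏) :
    psiAd N n x = ∑ k ∈ Finset.range N, ((k : ℂ) + 1)⁻¹ • dpow n k x := by
  simp [psiAd]

/-- `exp = 1 + ψ ∘ ad n`. With truncation orders `N + 1` and `N` this is exact, without nilpotency.
-/
theorem expAd_eq (N : ℕ) (n x : 𝔏) : expAd (N + 1) n x = x + psiAd N n ⁅n, x⁆ := by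
  rw [expAd_apply, psiAd_apply, Finset.sum_range_succ', dpow_zero, add_comm]
  congr 1
  refine Finset.sum_congr rfl fun k _ => ?_
  have h : ((k : ℂ) + 1) ≠ 0 := Nat.cast_add_one_ne_zero k
  simp only [dpow, LinearMap.smul_apply, pow_succ, Module.End.mul_apply, ad_apply, smul_smul,
    Nat.factorial_succ, Nat.cast_mul, Nat.cast_add, Nat.cast_one]
  congr 1
  field_simp

variable {n : 𝔏} {M N : ℕ} (hn : (ad ℂ 𝔏 n) ^ M = 0) (hN : 2 * M ≤ N)

include hn in
theorem dpow_eq_zero {k : ℕ} (hk : M ≤ k) (x : 𝔏) : dpow n k x = 0 := by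
  rw [dpow, pow_eq_zero_of_le hk hn, smul_zero, LinearMap.zero_apply]

include hn in
theorem expAd_succ (hN : M ≤ N) (x : 𝔏) : expAd (N + 1) n x = expAd N n x := by
  rw [expAd_apply, Finset.sum_range_succ, dpow_eq_zero hn hN, add_zero, expAd_apply]

theorem dpow_lie (n x y : 𝔏) (k : ℕ) :
    dpow n k ⁅x, y⁆ =
      ∑ p ∈ Finset.HasAntidiagonal.antidiagonal k, ⁅dpow n p.1 x, dpow n p.2 y⁆ := by
  induction k with
  | zero => simp [dpow_zero]
  | succ k ih =>
    have h : ((k : ℂ) + 1) ≠ 0 := Nat.cast_add_one_ne_zero k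
    rw [← smul_right_inj h, ← lie_dpow, ih, lie_sum]
    simp only [leibniz_lie n, lie_dpow, smul_lie, lie_smul, Finset.sum_add_distrib]
    have h1 := Finset.Nat.sum_antidiagonal_succ (n := k)
      (f := fun p => (p.1 : ℂ) • ⁅dpow n p.1 x, dpow n p.2 y⁆)
    have h2 := Finset.Nat.sum_antidiagonal_succ' (n := k)
      (f := fun p => (p.2 : ℂ) • ⁅dpow n p.1 x, dpow n p.2 y⁆)
    simp only [Nat.cast_zero, zero_smul, zero_add, Nat.cast_add, Nat.cast_one] at h1 h2
    rw [← h1, ← h2, ← Finset.sum_add_distrib, Finset.smul_sum]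
    refine Finset.sum_congr rfl fun p hp => ?_
    rw [← add_smul, ← Nat.cast_add, Finset.HasAntidiagonal.mem_antidiagonal.1 hp]
    push_cast
    rfl

include hn hN in
theorem expAd_lie (x y : 𝔏) : expAd N n ⁅x, y⁆ = ⁅expAd N n x, expAd N n y⁆ := by
  simp only [expAd_apply, dpow_lie]
  rw [sum_antidiagonal_eq_sum_range (fun a b => ⁅dpow n a x, dpow n b y⁆) hN, sum_lie_sum]
  · intro a b ha
    rw [dpow_eq_zero hn ha, zero_lie]
  · intro a b hb
    rw [dpow_eq_zero hn hb, lie_zero]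

/-- The solution of the recursion satisfied by the variations of `(ad n)ᵏ x`. -/
theorem variation_eq {S : ℕ → 𝔏} {n w x : 𝔏} (h0 : S 0 = 0)
    (hS : ∀ k, S (k + 1) = ⁅n, S k⁆ + ⁅w, ((ad ℂ 𝔏 n) ^ k) x⁆) (k : ℕ) :
    ((k + 1).factorial : ℂ)⁻¹ • S (k + 1) =
      ∑ p ∈ Finset.HasAntidiagonal.antidiagonal k,
        ((p.1 : ℂ) + 1)⁻¹ • ⁅dpow n p.1 w, dpow n p.2 x⁆ := by
  induction k with
  | zero => simp [hS, h0, dpow_zero]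
  | succ k ih =>
    have h : ((k : ℂ) + 2) ≠ 0 := by
      have := Nat.cast_add_one_ne_zero (R := ℂ) (k + 1)
      push_cast at this
      rwa [add_assoc, one_add_one_eq_two] at this
    have hstep : ((k : ℂ) + 2) • (((k + 2).factorial : ℂ)⁻¹ • S (k + 2)) =
        ⁅n, ((k + 1).factorial : ℂ)⁻¹ • S (k + 1)⁆ + ⁅w, dpow n (k + 1) x⁆ := by
      rw [hS (k + 1), smul_smul, lie_smul, dpow, LinearMap.smul_apply, lie_smul, ← smul_add]
      congr 1
      rw [Nat.factorial_succ (k + 1)]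
      push_cast
      rw [add_assoc, one_add_one_eq_two]
      field_simp
    rw [← smul_right_inj h, hstep, ih, lie_sum]
    have h1 := Finset.Nat.sum_antidiagonal_succ (n := k)
      (f := fun p => ⁅dpow n p.1 w, dpow n p.2 x⁆)
    have h2 := Finset.Nat.sum_antidiagonal_succ' (n := k)
      (f := fun p => ((p.2 : ℂ) * ((p.1 : ℂ) + 1)⁻¹) • ⁅dpow n p.1 w, dpow n p.2 x⁆)
    simp only [Nat.cast_zero, zero_mul, zero_smul, Nat.cast_add, Nat.cast_one,
      dpow_zero] at h1 h2
    have h3 : ∀ p : ℕ × ℕ, ⁅n, ((p.1 : ℂ) + 1)⁻¹ • ⁅dpow n p.1 w, dpow n p.2 x⁆⁆ =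
        ⁅dpow n (p.1 + 1) w, dpow n p.2 x⁆ +
        (((p.2 : ℂ) + 1) * ((p.1 : ℂ) + 1)⁻¹) • ⁅dpow n p.1 w, dpow n (p.2 + 1) x⁆ := by
      intro p
      have hp : ((p.1 : ℂ) + 1) ≠ 0 := Nat.cast_add_one_ne_zero _
      rw [lie_smul, leibniz_lie, lie_dpow, lie_dpow, smul_lie, lie_smul, smul_add, smul_smul,
        smul_smul, inv_mul_cancel₀ hp, one_smul, mul_comm]
    simp only [h3, Finset.sum_add_distrib]
    rw [zero_add] at h2
    rw [add_right_comm, add_comm _ ⁅w, _⁆, ← h1, ← h2, ← Finset.sum_add_distrib, Finset.smul_sum]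
    refine Finset.sum_congr rfl fun p hp => ?_
    have hp' : ((p.1 : ℂ) + 1) ≠ 0 := Nat.cast_add_one_ne_zero _
    have hpk : (p.1 : ℂ) + p.2 = k + 1 := by
      exact_mod_cast Finset.HasAntidiagonal.mem_antidiagonal.1 hp
    rw [smul_smul]
    refine Eq.trans (b := (1 + (p.2 : ℂ) * ((p.1 : ℂ) + 1)⁻¹) • ⁅dpow n p.1 w, dpow n p.2 x⁆)
      (by rw [add_smul, one_smul]) ?_
    congr 1
    field_simp
    linear_combination hpk

-- The derivative of the exponential: varying `n` by `w` changes `exp(ad n) x` by `[ψ(n) w, exp(ad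
-- n) x]`. Stated for an abstract recursion, it serves both `∂ₓ` and derivatives along curves. The
-- bound `2 * M ≤ N` leaves room for products of two truncated series.
include hn hN in
theorem sum_variation {S : ℕ → 𝔏} {w x : 𝔏} (h0 : S 0 = 0)
    (hS : ∀ k, S (k + 1) = ⁅n, S k⁆ + ⁅w, ((ad ℂ 𝔏 n) ^ k) x⁆) :
    ∑ k ∈ Finset.range (N + 1), (k.factorial : ℂ)⁻¹ • S k = ⁅psiAd N n w, expAd (N + 1) n x⁆ := by
  rw [Finset.sum_range_succ', h0, smul_zero, add_zero]
  simp only [variation_eq h0 hS]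
  rw [sum_antidiagonal_eq_sum_range
    (fun a b => ((a : ℂ) + 1)⁻¹ • ⁅dpow n a w, dpow n b x⁆) hN]
  · rw [expAd_succ hn (by omega), psiAd_apply, expAd_apply, sum_lie_sum]
    simp only [smul_lie]
  · intro a b ha
    rw [dpow_eq_zero hn ha, zero_lie, smul_zero]
  · intro a b hb
    rw [dpow_eq_zero hn hb, lie_zero, smul_zero]

include hn in
theorem expAd_surjective : Function.Surjective (expAd (N + 1) n) := by
  have h1 : expAd (N + 1) n = 1 + psiAd N n * ad ℂ 𝔏 n := by
    ext x
    exact expAd_eq N n x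
  have h2 : Commute (psiAd N n) (ad ℂ 𝔏 n) := by
    refine Commute.sum_left _ _ _ fun k _ => ?_
    exact ((Commute.pow_self _ k).smul_left _).smul_left _
  have h3 : IsUnit (expAd (N + 1) n) := by
    rw [h1]
    exact (h2.isNilpotent_mul_left ⟨M, hn⟩).isUnit_one_add
  exact ((Module.End.isUnit_iff _).1 h3).2

end Exponential

/-! ## Gauge transformations -/

section Gauge

variable {𝔤 : Type*} [LieRing 𝔤] [LieAlgebra ℂ 𝔤] [FiniteDimensional ℂ 𝔤]

open LieAlgebra

/-- The operator `ε ∂ₓ + ad s`. -/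
def covD (ε : ℂ) (s v : Loop 𝔤) : Loop 𝔤 := ε • Loop.deriv v + ⁅s, v⁆

theorem P₂_eq_covD (ε : ℂ) (s v : Loop 𝔤) : P₂ ε s v = ε⁻¹ • covD ε s v := rfl

theorem covD_sub (ε : ℂ) (s v w : Loop 𝔤) : covD ε s (v - w) = covD ε s v - covD ε s w := by
  simp only [covD, Loop.deriv_sub, lie_sub, smul_sub]
  abel

theorem covD_smul (ε c : ℂ) (s v : Loop 𝔤) : covD ε s (c • v) = c • covD ε s v := by
  simp only [covD, Loop.deriv_smul, lie_smul, smul_add, smul_comm ε c]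

theorem covD_lie (ε : ℂ) (s v w : Loop 𝔤) :
    covD ε s ⁅v, w⁆ = ⁅covD ε s v, w⁆ + ⁅v, covD ε s w⁆ := by
  simp only [covD, Loop.deriv_lie, smul_add, add_lie, lie_add, smul_lie, lie_smul,
    leibniz_lie s v w]
  abel

theorem HasDir.covD (ε : ℂ) {γ κ : ℂ → Loop 𝔤} {γ' κ' : Loop 𝔤} (hγ : HasDir γ γ')
    (hκ : HasDir κ κ') :
    HasDir (fun θ => covD ε (γ θ) (κ θ)) (covD ε (γ 0) κ' + ⁅γ', κ 0⁆) := by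
  have h := (hκ.map (ε • Loop.derivL)).add (hγ.lie hκ)
  have e : LoopReduction.covD ε (γ 0) κ' + ⁅γ', κ 0⁆ =
      (ε • Loop.derivL) κ' + (⁅γ', κ 0⁆ + ⁅γ 0, κ'⁆) := by
    change ε • Loop.deriv κ' + _ + _ = ε • Loop.deriv κ' + _
    abel
  rw [e]
  exact h

/-- The (truncated) gauge transformation of `ε ∂ₓ + s` by `exp n`. -/
def gauge (ε : ℂ) (N : ℕ) (n s : Loop 𝔤) : Loop 𝔤 :=
  s + psiAd N n (⁅n, s⁆ - ε • Loop.deriv n)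

theorem gauge_eq (ε : ℂ) (N : ℕ) (n s : Loop 𝔤) :
    gauge ε N n s = expAd (N + 1) n s - ε • psiAd N n (Loop.deriv n) := by
  rw [gauge, expAd_eq, map_sub, map_smul]
  abel

variable {M N : ℕ} (hN : 2 * M ≤ N)

section

variable {n : Loop 𝔤} (hn : (ad ℂ (Loop 𝔤) n) ^ M = 0)
include hN hn

theorem deriv_expAd (y : Loop 𝔤) :
    Loop.deriv (expAd (N + 1) n y) =
      expAd (N + 1) n (Loop.deriv y) + ⁅psiAd N n (Loop.deriv n), expAd (N + 1) n y⁆ := by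
  -- `S k` is the commutator of `∂ₓ` with `(ad n)^k`; it satisfies the recursion with `w = ∂ₓ n`.
  rw [← sum_variation hn hN (S := fun k => Loop.deriv (((ad ℂ (Loop 𝔤) n) ^ k) y) -
    ((ad ℂ (Loop 𝔤) n) ^ k) (Loop.deriv y))]
  · simp only [expAd_apply, dpow, LinearMap.smul_apply, smul_sub, Finset.sum_sub_distrib]
    rw [← Loop.derivL_apply, map_sum]
    simp only [map_smul, Loop.derivL_apply]
    abel
  · simp
  · intro k
    simp only [pow_succ', Module.End.mul_apply, ad_apply, Loop.deriv_lie, lie_sub]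
    abel

/-- A gauge transformation conjugates the operators `ε ∂ₓ + ad s`. -/
theorem covD_gauge (ε : ℂ) (s y : Loop 𝔤) :
    covD ε (gauge ε N n s) (expAd (N + 1) n y) = expAd (N + 1) n (covD ε s y) := by
  have h1 := expAd_lie (N := N + 1) hn (by omega) s y
  rw [gauge_eq, covD, covD, deriv_expAd hN hn, map_add, map_smul, h1, sub_lie, smul_lie, smul_add]
  abel

end

theorem HasDir.ad_pow {γ κ : ℂ → Loop 𝔤} {γ' κ' : Loop 𝔤} (hγ : HasDir γ γ') (hκ : HasDir κ κ')
    {S : ℕ → Loop 𝔤} (h0 : S 0 = 0)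
    (hS : ∀ k, S (k + 1) = ⁅γ 0, S k⁆ + ⁅γ', ((ad ℂ (Loop 𝔤) (γ 0)) ^ k) (κ 0)⁆) (k : ℕ) :
    HasDir (fun θ => ((ad ℂ (Loop 𝔤) (γ θ)) ^ k) (κ θ))
      (S k + ((ad ℂ (Loop 𝔤) (γ 0)) ^ k) κ') := by
  induction k with
  | zero => simpa [h0] using hκ
  | succ k ih =>
    have h1 := hγ.lie ih
    simp only [pow_succ', Module.End.mul_apply, ad_apply]
    convert h1 using 1
    rw [hS, lie_add]
    abel

/-- The recursion for the variations of the powers of `ad n`. -/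
def variation (n w x : Loop 𝔤) : ℕ → Loop 𝔤
  | 0 => 0
  | k + 1 => ⁅n, variation n w x k⁆ + ⁅w, ((ad ℂ (Loop 𝔤) n) ^ k) x⁆

theorem HasDir.dpow {γ κ : ℂ → Loop 𝔤} {γ' κ' : Loop 𝔤} (hγ : HasDir γ γ') (hκ : HasDir κ κ')
    (k : ℕ) : HasDir (fun θ => dpow (γ θ) k (κ θ))
      ((k.factorial : ℂ)⁻¹ • variation (γ 0) γ' (κ 0) k + LoopReduction.dpow (γ 0) k κ') := by
  have h1 := (hγ.ad_pow hκ (S := variation (γ 0) γ' (κ 0)) rfl (fun _ => rfl) k).map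
    ((k.factorial : ℂ)⁻¹ • LinearMap.id)
  simp only [LinearMap.smul_apply, LinearMap.id_apply, smul_add] at h1
  exact h1

theorem HasDir.expAd (hN : 2 * M ≤ N) {γ κ : ℂ → Loop 𝔤} {γ' κ' : Loop 𝔤} (hγ : HasDir γ γ')
    (hκ : HasDir κ κ') (hn : (ad ℂ (Loop 𝔤) (γ 0)) ^ M = 0) :
    HasDir (fun θ => expAd (N + 1) (γ θ) (κ θ))
      (⁅psiAd N (γ 0) γ', LoopReduction.expAd (N + 1) (γ 0) (κ 0)⁆ +
        LoopReduction.expAd (N + 1) (γ 0) κ') := by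
  have h1 := HasDir.sum (Finset.range (N + 1)) fun k _ => hγ.dpow hκ k
  rw [Finset.sum_add_distrib, sum_variation hn hN rfl (fun _ => rfl), ← expAd_apply] at h1
  simp only [← expAd_apply] at h1
  exact h1

/-- Only differentiability is needed here: the value of the derivative is found below from the
conjugation identity. -/
theorem HasDir.exists_gauge (ε : ℂ) (N : ℕ) {γ κ : ℂ → Loop 𝔤} {γ' κ' : Loop 𝔤} (hγ : HasDir γ γ')
    (hκ : HasDir κ κ') : ∃ τ, HasDir (fun θ => gauge ε N (γ θ) (κ θ)) τ := by
  have h1 := (hγ.lie hκ).sub (hγ.map (ε • Loop.derivL))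
  have h2 := HasDir.sum (Finset.range N) fun k _ =>
    (hγ.dpow h1 k).map (((k : ℂ) + 1)⁻¹ • LinearMap.id)
  have h3 := hκ.add h2
  simp only [LinearMap.smul_apply, LinearMap.id_apply] at h3
  simp only [← psiAd_apply] at h3
  exact ⟨_, h3⟩

variable [LieAlgebra.IsKilling ℂ 𝔤]

theorem Loop.eq_zero_of_lie {v : Loop 𝔤} (h : ∀ y : Loop 𝔤, ⁅v, y⁆ = 0) : v = 0 := by
  ext x
  refine eq_zero_of_killingForm fun y => ?_
  have h1 : ad ℂ 𝔤 (v.1 x) = 0 := by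
    ext z
    exact congrArg (fun q : Loop 𝔤 => q.1 x) (h (Loop.const z))
  rw [killingForm_apply_apply, h1, LinearMap.zero_comp, map_zero]

/-- Gauge transformations with variable parameter preserve the distribution spanned by the
vectors `(ε ∂ₓ + ad s) m`. -/
theorem HasDir.gauge (hN : 2 * M ≤ N) (ε : ℂ) {γ κ : ℂ → Loop 𝔤} {γ' m : Loop 𝔤}
    (hγ : HasDir γ γ') (hκ : HasDir κ (LoopReduction.covD ε (κ 0) m))
    (hn : ∀ θ, (ad ℂ (Loop 𝔤) (γ θ)) ^ M = 0) :
    HasDir (fun θ => gauge ε N (γ θ) (κ θ))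
      (LoopReduction.covD ε (LoopReduction.gauge ε N (γ 0) (κ 0))
        (LoopReduction.expAd (N + 1) (γ 0) m - psiAd N (γ 0) γ')) := by
  obtain ⟨τ, hτ⟩ := HasDir.exists_gauge ε N hγ hκ
  suffices h : τ = LoopReduction.covD ε (LoopReduction.gauge ε N (γ 0) (κ 0))
      (LoopReduction.expAd (N + 1) (γ 0) m - psiAd N (γ 0) γ') by rwa [← h]
  rw [← sub_eq_zero]
  -- The center is trivial, so adjoint actions may be compared. They come from differentiating
  -- `covD_gauge` at `exp(ad n) y`, and these vectors are all loops.
  refine Loop.eq_zero_of_lie fun z => ?_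
  obtain ⟨y, rfl⟩ := expAd_surjective (N := N) (hn 0) z
  have h1 := hτ.covD ε (hγ.expAd hN (HasDir.const y) (hn 0))
  have h2 := hγ.expAd hN (hκ.covD ε (HasDir.const y)) (hn 0)
  simp only [← covD_gauge hN (hn _)] at h2
  have h3 := h1.unique h2
  have hz : LoopReduction.covD ε (κ 0) 0 = 0 := by simpa using covD_smul ε 0 (κ 0) 0
  have hl := expAd_lie (N := N + 1) (hn 0) (by omega) (LoopReduction.covD ε (κ 0) m) y
  rw [map_zero, add_zero, hz, zero_add, hl, covD_lie, ← covD_gauge hN (hn 0)] at h3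
  rw [covD_sub, sub_lie, sub_lie, sub_eq_zero, ← sub_eq_zero]
  rw [← sub_eq_zero] at h3
  rw [← h3]
  abel

end Gauge

/-! ## The slice -/

section Slice

variable {𝔤 : Type*} [LieRing 𝔤] [LieAlgebra ℂ 𝔤] [FiniteDimensional ℂ 𝔤]

open LieAlgebra

/-- The loops with values in a subspace. -/
def loopIn (K : Submodule ℂ 𝔤) : Submodule ℂ (Loop 𝔤) where
  carrier := {q | ∀ x, q.1 x ∈ K}
  add_mem' := fun hu hv x => add_mem (hu x) (hv x)
  zero_mem' := fun _ => zero_mem K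
  smul_mem' := fun c _ hu x => K.smul_mem c (hu x)

theorem deriv_mem_loopIn {K : Submodule ℂ 𝔤} {q : Loop 𝔤} (hq : q ∈ loopIn K) :
    Loop.deriv q ∈ loopIn K := fun x => Loop.deriv_mem K hq x

theorem lie_mem_loopIn {K K₁ K₂ : Submodule ℂ 𝔤} (hK : ∀ x ∈ K, ∀ y ∈ K₁, ⁅x, y⁆ ∈ K₂)
    {p q : Loop 𝔤} (hp : p ∈ loopIn K) (hq : q ∈ loopIn K₁) : ⁅p, q⁆ ∈ loopIn K₂ :=
  fun x => hK _ (hp x) _ (hq x)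

omit [FiniteDimensional ℂ 𝔤] in
theorem loopIn_mono {K K' : Submodule ℂ 𝔤} (h : K ≤ K') : loopIn K ≤ loopIn K' :=
  fun _ hq x => h (hq x)

omit [FiniteDimensional ℂ 𝔤] in
theorem eq_zero_of_mem_loopIn {K : Submodule ℂ 𝔤} (hK : K = ⊥) {q : Loop 𝔤}
    (hq : q ∈ loopIn K) : q = 0 := by
  ext x
  have := hq x
  rwa [hK] at this

theorem covD_eq (ε : ℂ) (e : 𝔤) (s v : Loop 𝔤) :
    covD ε s v = (ε • Loop.deriv v + ⁅s - Loop.const e, v⁆) + ⁅Loop.const e, v⁆ := by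
  rw [covD, sub_lie]
  abel

section

variable {𝔏 : Type*} [LieRing 𝔏] [LieAlgebra ℂ 𝔏] {n : 𝔏} {K : Submodule ℂ 𝔏}

theorem dpow_mem (hK : ∀ y ∈ K, ⁅n, y⁆ ∈ K) {y : 𝔏} (hy : y ∈ K) (k : ℕ) : dpow n k y ∈ K :=
  K.smul_mem _ (Module.End.pow_apply_mem_of_forall_mem k hK y hy)

theorem psiAd_mem (hK : ∀ y ∈ K, ⁅n, y⁆ ∈ K) {y : 𝔏} (hy : y ∈ K) (N : ℕ) : psiAd N n y ∈ K := by
  rw [psiAd_apply]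
  exact sum_mem fun k _ => K.smul_mem _ (dpow_mem hK hy k)

theorem expAd_mem (hK : ∀ y ∈ K, ⁅n, y⁆ ∈ K) {y : 𝔏} (hy : y ∈ K) (N : ℕ) : expAd N n y ∈ K := by
  rw [expAd_apply]
  exact sum_mem fun k _ => dpow_mem hK hy k

/-- The series starts with the identity and all later terms factor through `[n, y]`; the order `N +
1` ensures that the leading term is present. -/
theorem psiAd_sub_mem (hK : ∀ y ∈ K, ⁅n, y⁆ ∈ K) {y : 𝔏} (hy : ⁅n, y⁆ ∈ K) (N : ℕ) :
    psiAd (N + 1) n y - y ∈ K := by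
  rw [psiAd_apply, Finset.sum_range_succ', dpow_zero, Nat.cast_zero, zero_add, inv_one, one_smul,
    add_sub_cancel_right]
  refine sum_mem fun k _ => K.smul_mem _ ?_
  rw [dpow, pow_succ]
  exact K.smul_mem _ (Module.End.pow_apply_mem_of_forall_mem k hK _ hy)

end

section Step

variable {e h f : 𝔤} (t : IsTriple e h f)

theorem IsDP.psiAd {A B : Loop 𝔤 → Loop 𝔤} (hA : IsDP A) (hB : IsDP B) (N : ℕ) :
    IsDP (fun q => psiAd N (A q) (B q)) := by
  simp only [psiAd_apply]
  refine IsDP.sum _ fun k _ => IsDP.smul _ (IsDP.smul _ ?_)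
  clear * - hA hB
  induction k with
  | zero => simpa using hB
  | succ k ih =>
    simp only [pow_succ', Module.End.mul_apply, ad_apply]
    exact hA.lie ih

namespace IsTriple

/-- One step of the gauge fixing algorithm. -/
def step (ε : ℂ) (N : ℕ) (s : Loop 𝔤) : Loop 𝔤 :=
  gauge ε N (Loop.mapL t.sigma (s - Loop.const e)) s

theorem isDP_step (ε : ℂ) (N : ℕ) : IsDP (t.step ε N) := by
  have h1 : IsDP fun s : Loop 𝔤 => Loop.mapL t.sigma (s - Loop.const e) :=
    (IsDP.id.sub (IsDP.const _)).mapL _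
  exact IsDP.id.add (h1.psiAd ((h1.lie IsDP.id).sub (h1.deriv.smul ε)) N)

theorem step_of_mem_Q (ε : ℂ) (N : ℕ) {s : Loop 𝔤} (hs : s ∈ Q e f) : t.step ε N s = s := by
  have h1 : Loop.mapL t.sigma (s - Loop.const e) = 0 := by
    ext x
    exact t.sigma_of_ker (hs x)
  have h2 : Loop.deriv (0 : Loop 𝔤) = 0 := map_zero Loop.derivL
  rw [step, h1, gauge, zero_lie, h2, smul_zero, sub_zero, map_zero, add_zero]

/-! ### Transversality of the slice -/

section Descent

omit [FiniteDimensional ℂ 𝔤] in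
theorem mem_loopIn_top {K : Submodule ℂ 𝔤} (hK : K = ⊤) (q : Loop 𝔤) : q ∈ loopIn K := fun x => by
  rw [hK]
  exact Submodule.mem_top

include t in
/-- Transversality of the slice `Q` to the distribution. -/
theorem eq_zero_of_covD (Γ : GoodGrading e h f) (ε : ℂ) {z v : Loop 𝔤} (hz : z ∈ Q e f)
    (hv : v ∈ loopIn (LinearMap.range (ad ℂ 𝔤 f)))
    (h : covD ε z v ∈ loopIn (LinearMap.ker (ad ℂ 𝔤 f))) : v = 0 := by
  obtain ⟨M, hbot, htop⟩ := Γ.exists_bound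
  have key : ∀ k : ℕ, v ∈ loopIn (Γ.V (M - k)) := by
    intro k
    induction k with
    | zero => exact mem_loopIn_top (by simpa using htop) v
    | succ k ih =>
      intro x
      have h1 : (ε • Loop.deriv v + ⁅z - Loop.const e, v⁆).1 x ∈ Γ.V (M - k) := by
        refine (add_mem (Submodule.smul_mem _ ε (deriv_mem_loopIn ih)) (lie_mem_loopIn
          (fun a ha b hb => ?_) (K := LinearMap.ker (ad ℂ 𝔤 f)) (fun y => hz y) ih) :
          ε • Loop.deriv v + ⁅z - Loop.const e, v⁆ ∈ loopIn (Γ.V (M - k))) x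
        exact GoodGrading.lie_mem_V (by omega) (GoodGrading.ker_le_V ha) hb
      -- Thus `v = -σ(ε ∂v + [z - e, v])`, which lies strictly lower in the filtration than the
      -- bound known for `v`; iterating kills `v`.
      have h2 : t.sigma ((ε • Loop.deriv v + ⁅z - Loop.const e, v⁆).1 x) = -v.1 x := by
        refine t.sigma_eq (neg_mem (hv x)) ?_
        have h3 := h x
        rw [covD_eq ε e] at h3
        rw [lie_neg, sub_neg_eq_add]
        exact h3
      rw [← neg_mem_iff, ← h2]
      exact GoodGrading.sigma_mem_V t (by push_cast; omega) h1
  refine eq_zero_of_mem_loopIn hbot (loopIn_mono (GoodGrading.V_mono ?_) (key (2 * M)))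
  push_cast
  omega

end Descent

/-! ### Gauge fixing on the level surface -/

section Gauge

variable [LieAlgebra.IsKilling ℂ 𝔤] {d : ReductionDatum e h f}

open GoodGrading ReductionDatum

theorem sigma_mem_loopIn_nil {b : Loop 𝔤} (hb : b ∈ loopIn d.level) :
    Loop.mapL t.sigma b ∈ loopIn d.nil := fun x => sigma_mem_nil t (hb x)

-- The distribution is tangent to `e + L level`.
omit [LieAlgebra.IsKilling ℂ 𝔤] in
theorem covD_mem_level (ε : ℂ) {s m : Loop 𝔤} (hs : s - Loop.const e ∈ loopIn d.level)
    (hm : m ∈ loopIn d.nil) : covD ε s m ∈ loopIn d.level := by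
  rw [covD_eq ε e]
  refine add_mem (add_mem (Submodule.smul_mem _ _ (loopIn_mono nil_le_level (deriv_mem_loopIn hm)))
    ?_) fun x => lie_e_mem_level (hm x)
  rw [← lie_skew]
  exact neg_mem fun x => lie_mem_level (hm x) (hs x)

include t in
/-- Every loop in `level` is the sum of a vector of the distribution and a vector tangent to the
slice. -/
theorem exists_sub_covD_mem (ε : ℂ) {z b : Loop 𝔤} (hz : z ∈ Q e f) (hb : b ∈ loopIn d.level) :
    ∃ n ∈ loopIn d.nil, b - covD ε z n ∈ loopIn (LinearMap.ker (ad ℂ 𝔤 f)) := by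
  have hz' : z - Loop.const e ∈ loopIn (LinearMap.ker (ad ℂ 𝔤 f)) := fun x => hz x
  obtain ⟨M, hbot, htop⟩ := d.toGoodGrading.exists_bound
  suffices key : ∀ k : ℕ, ∀ b ∈ loopIn d.level, Loop.mapL t.sigma b ∈ loopIn (d.V (-M + k)) →
      ∃ n ∈ loopIn d.nil, b - covD ε z n ∈ loopIn (LinearMap.ker (ad ℂ 𝔤 f)) by
    refine key (2 * M) b hb (mem_loopIn_top (eq_top_iff.2 ?_) _)
    rw [← htop]
    exact V_mono (by push_cast; omega)
  intro k
  induction k with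
  | zero =>
    intro b hb hσ
    refine ⟨0, zero_mem _, fun x => ?_⟩
    have h1 : covD ε z (0 : Loop 𝔤) = 0 := by simpa using covD_smul ε 0 z 0
    rw [h1, sub_zero]
    refine t.lie_f_eq_zero_of_sigma ?_
    have h2 := eq_zero_of_mem_loopIn (by simpa using hbot) hσ
    exact congrArg (fun q : Loop 𝔤 => q.1 x) h2
  | succ k ih =>
    intro b hb hσ
    -- `[e, n]` cancels `b` modulo `ker ad f`. The error `ε ∂n + [z - e, n]` is bounded in the
    -- filtration by the same degree as `n`, and `σ` lowers it.
    set n := Loop.mapL t.sigma b with hn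
    have hnil : n ∈ loopIn d.nil := t.sigma_mem_loopIn_nil hb
    have h1 : ε • Loop.deriv n + ⁅z - Loop.const e, n⁆ ∈ loopIn (d.V (-M + (k + 1 : ℕ))) :=
      add_mem (Submodule.smul_mem _ ε (deriv_mem_loopIn hσ)) (lie_mem_loopIn
        (fun x hx y hy => lie_mem_V (by omega) (ker_le_V hx) hy) hz' hσ)
    have hσ' : Loop.mapL t.sigma (b - covD ε z n) ∈ loopIn (d.V (-M + k)) := fun x => by
      have h3 : t.sigma ((b - covD ε z n).1 x) =
          -t.sigma ((ε • Loop.deriv n + ⁅z - Loop.const e, n⁆).1 x) := by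
        have h4 : (b - covD ε z n).1 x = (b.1 x - ⁅e, t.sigma (b.1 x)⁆) -
            (ε • Loop.deriv n + ⁅z - Loop.const e, n⁆).1 x := by
          rw [covD_eq ε e, add_comm, ← sub_sub]
          rfl
        rw [h4, map_sub, t.sigma_of_ker (t.lie_f_sub _), zero_sub]
      change t.sigma ((b - covD ε z n).1 x) ∈ _
      rw [h3]
      exact neg_mem (sigma_mem_V t (by push_cast; omega) (h1 x))
    obtain ⟨n', hn', h2⟩ := ih (b - covD ε z n)
      (sub_mem hb (covD_mem_level ε (loopIn_mono ker_le_level hz') hnil)) hσ'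
    refine ⟨n + n', add_mem hnil hn', ?_⟩
    have h3 : covD ε z (n + n') = covD ε z n + covD ε z n' := by
      simp only [covD, Loop.deriv_add, lie_add, smul_add]
      abel
    rwa [h3, ← sub_sub]

theorem step_sub_mem_level (ε : ℂ) (N : ℕ) {s : Loop 𝔤}
    (hs : s - Loop.const e ∈ loopIn d.level) : t.step ε N s - Loop.const e ∈ loopIn d.level := by
  have hn := t.sigma_mem_loopIn_nil hs
  rw [step, gauge, add_sub_right_comm]
  refine add_mem hs (psiAd_mem (K := loopIn d.level)
    (fun y hy x => lie_mem_level (hn x) (hy x)) ?_ N)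
  have h1 := neg_mem (covD_mem_level ε hs hn)
  rwa [covD, neg_add, lie_skew, neg_add_eq_sub] at h1

/-- Gauging by `n = σ(s - e)` subtracts `[e, n]`, which leaves a part in `ker ad f` plus terms of
degree at most `j + 1`; `σ` kills the former and lowers the latter by `2`, a net gain of one. -/
theorem step_mem_V (ε : ℂ) (N : ℕ) {j : ℤ} (hj : j ≤ -1) {s : Loop 𝔤}
    (hs : s - Loop.const e ∈ loopIn d.level)
    (hσ : Loop.mapL t.sigma (s - Loop.const e) ∈ loopIn (d.V j)) :
    Loop.mapL t.sigma (t.step ε (N + 1) s - Loop.const e) ∈ loopIn (d.V (j - 1)) := by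
  set n := Loop.mapL t.sigma (s - Loop.const e) with hn
  set c := ⁅n, s⁆ - ε • Loop.deriv n with hc
  have h1 : ⁅n, s - Loop.const e⁆ - ε • Loop.deriv n ∈ loopIn (d.V (j + 1)) :=
    sub_mem (fun x => lie_mem_V le_rfl (hσ x) (level_le_V (hs x)))
      (Submodule.smul_mem _ ε (loopIn_mono (V_mono (by omega)) (deriv_mem_loopIn hσ)))
  have h2 : c ∈ loopIn (d.V (j + 2)) := by
    have h3 : c = (⁅n, s - Loop.const e⁆ - ε • Loop.deriv n) + ⁅n, Loop.const e⁆ := by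
      rw [hc, lie_sub]
      abel
    rw [h3]
    exact add_mem (loopIn_mono (V_mono (by omega)) h1)
      fun x => lie_mem_V le_rfl (hσ x) e_mem_V
  have h3 : psiAd (N + 1) n c - c ∈ loopIn (d.V (j + 1)) :=
    psiAd_sub_mem (K := loopIn (d.V (j + 1))) (fun y hy x => lie_mem_V (by omega) (hσ x) (hy x))
      (fun x => lie_mem_V (by omega) (hσ x) (h2 x)) N
  intro x
  have h4 : t.step ε (N + 1) s - Loop.const e = ((s - Loop.const e) - ⁅Loop.const e, n⁆) +
      ((⁅n, s - Loop.const e⁆ - ε • Loop.deriv n) + (psiAd (N + 1) n c - c)) := by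
    rw [step, gauge, ← hn, ← hc]
    have h5 : c = ⁅n, s - Loop.const e⁆ - ε • Loop.deriv n - ⁅Loop.const e, n⁆ := by
      rw [hc, lie_sub, ← lie_skew n (Loop.const e)]
      abel
    nth_rw 3 [h5]
    abel
  change t.sigma ((t.step ε (N + 1) s - Loop.const e).1 x) ∈ _
  rw [h4, Loop.add_apply, map_add]
  have h5 : t.sigma (((s - Loop.const e) - ⁅Loop.const e, n⁆).1 x) = 0 :=
    t.sigma_of_ker (t.lie_f_sub _)
  rw [h5, zero_add]
  exact sigma_mem_V t (by omega) (add_mem h1 h3 x)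

/-- The gauge parameter moves with the point, which adds a `ψ` term to the transported vector; since
`𝔫` is a subalgebra, both terms stay in `L𝔫`. -/
theorem hasDir_step {ε : ℂ} {M N : ℕ} (hN : 2 * M ≤ N)
    (hM : ∀ n ∈ loopIn (d.V (-1)), (ad ℂ (Loop 𝔤) n) ^ M = 0) {γ : ℂ → Loop 𝔤} {m : Loop 𝔤}
    (hm : m ∈ loopIn d.nil) (hγ : ∀ θ, γ θ - Loop.const e ∈ loopIn d.level)
    (hd : HasDir γ (covD ε (γ 0) m)) : ∃ m' ∈ loopIn d.nil,
      HasDir (fun θ => t.step ε N (γ θ)) (covD ε (t.step ε N (γ 0)) m') := by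
  have h1 : HasDir (fun θ => Loop.mapL t.sigma (γ θ - Loop.const e))
      (Loop.mapL t.sigma (covD ε (γ 0) m)) := by
    have := (hd.sub (HasDir.const (Loop.const e))).map (Loop.mapL t.sigma)
    rwa [sub_zero] at this
  have h2 := fun θ => t.sigma_mem_loopIn_nil (hγ θ)
  have h3 : ∀ y ∈ loopIn d.nil, ⁅Loop.mapL t.sigma (γ 0 - Loop.const e), y⁆ ∈ loopIn d.nil :=
    fun y hy x => lie_nil_mem (h2 0 x) (hy x)
  refine ⟨_, sub_mem (expAd_mem h3 hm (N + 1)) (psiAd_mem h3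
    (t.sigma_mem_loopIn_nil (covD_mem_level ε (hγ 0) hm)) N), ?_⟩
  exact HasDir.gauge hN ε h1 hd fun θ => hM _ (loopIn_mono nil_le_V (h2 θ))

omit t [LieAlgebra.IsKilling ℂ 𝔤] in
theorem _root_.LoopReduction.GoodGrading.exists_ad_pow_eq_zero (Γ : GoodGrading e h f) :
    ∃ M : ℕ, ∀ n ∈ loopIn (Γ.V (-1)), (ad ℂ (Loop 𝔤) n) ^ M = 0 := by
  obtain ⟨M, hbot, htop⟩ := Γ.exists_bound
  refine ⟨2 * M, fun n hn => ?_⟩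
  have key : ∀ (k : ℕ) (y : Loop 𝔤), ((ad ℂ (Loop 𝔤) n) ^ k) y ∈ loopIn (Γ.V (M - k)) := by
    intro k
    induction k with
    | zero => exact fun y => mem_loopIn_top (by simpa using htop) y
    | succ k ih =>
      intro y x
      rw [pow_succ', Module.End.mul_apply, ad_apply]
      exact lie_mem_V (by push_cast; omega) (hn x) (ih y x)
  ext1 y
  refine eq_zero_of_mem_loopIn hbot (loopIn_mono (V_mono ?_) (key (2 * M) y))
  push_cast
  omega

theorem iterate_step_mem_Q (ε : ℂ) (N : ℕ) : ∃ K : ℕ, ∀ s : Loop 𝔤,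
    s - Loop.const e ∈ loopIn d.level → (t.step ε (N + 1))^[K] s ∈ Q e f := by
  obtain ⟨K, hbot, -⟩ := d.toGoodGrading.exists_bound
  refine ⟨K, fun s hs => ?_⟩
  have key : ∀ k : ℕ, (t.step ε (N + 1))^[k] s - Loop.const e ∈ loopIn d.level ∧
      Loop.mapL t.sigma ((t.step ε (N + 1))^[k] s - Loop.const e) ∈ loopIn (d.V (-1 - k)) := by
    intro k
    induction k with
    | zero => exact ⟨hs, by simpa using loopIn_mono nil_le_V (t.sigma_mem_loopIn_nil hs)⟩
    | succ k ih =>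
      rw [Function.iterate_succ_apply']
      refine ⟨t.step_sub_mem_level ε _ ih.1, ?_⟩
      have := t.step_mem_V ε N (by omega) ih.1 ih.2
      rwa [sub_sub, ← Nat.cast_succ] at this
  intro x
  refine t.lie_f_eq_zero_of_sigma ?_
  have h1 := eq_zero_of_mem_loopIn hbot (loopIn_mono (V_mono (by omega)) (key K).2)
  exact congrArg (fun q : Loop 𝔤 => q.1 x) h1

variable (d) in
include t in
/-- A differential polynomial retraction onto the slice `Q` that is constant along the
distribution. -/
theorem exists_retraction (ε : ℂ) : ∃ ρ : Loop 𝔤 → Loop 𝔤, IsDP ρ ∧ (∀ s, ρ s ∈ Q e f) ∧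
    (∀ z ∈ Q e f, ρ z = z) ∧ ∀ s, s - Loop.const e ∈ loopIn d.level → ∀ n ∈ loopIn d.nil,
      HasDir (fun θ : ℂ => ρ (s + θ • P₂ ε s n)) 0 := by
  obtain ⟨M, hM⟩ := d.toGoodGrading.exists_ad_pow_eq_zero
  obtain ⟨K, hK⟩ := t.iterate_step_mem_Q (d := d) ε (2 * M)
  set T := t.step ε (2 * M + 1) with hT
  obtain ⟨p, hp⟩ := d.level.subtype.exists_leftInverse_of_injective (Submodule.ker_subtype _)
  have hp' : ∀ x ∈ d.level, (p x : 𝔤) = x := fun x hx =>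
    congrArg Subtype.val (LinearMap.congr_fun hp ⟨x, hx⟩)
  -- A linear projection onto the level surface, so that the algorithm, which needs `s - e` in `L
  -- level`, defines a map on all loops.
  set π : Loop 𝔤 → Loop 𝔤 :=
    fun q => Loop.const e + Loop.mapL (d.level.subtype ∘ₗ p) (q - Loop.const e) with hπ
  have hπ1 : ∀ q, π q - Loop.const e ∈ loopIn d.level := fun q x => by
    rw [hπ, add_sub_cancel_left]
    exact Subtype.coe_prop _
  have hπ2 : ∀ q, q - Loop.const e ∈ loopIn d.level → π q = q := fun q hq => by
    have h1 : Loop.mapL (d.level.subtype ∘ₗ p) (q - Loop.const e) = q - Loop.const e := by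
      ext x
      exact hp' _ (hq x)
    rw [hπ]
    simp only [h1, add_sub_cancel]
  have hQ : ∀ z ∈ Q e f, z - Loop.const e ∈ loopIn d.level := fun z hz x => ker_le_level (hz x)
  refine ⟨fun q => T^[K] (π q), ?_, fun s => hK _ (hπ1 s), fun z hz => ?_, fun s hs n hn => ?_⟩
  · have h1 : IsDP π := (IsDP.const _).add ((IsDP.id.sub (IsDP.const _)).mapL _)
    clear hK
    induction K with
    | zero => exact h1
    | succ k ih =>
      simp only [Function.iterate_succ_apply']
      exact (t.isDP_step ε _).comp ih
  · change T^[K] (π z) = z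
    rw [hπ2 z (hQ z hz)]
    exact Function.iterate_fixed (t.step_of_mem_Q ε _ hz) K
  · set γ : ℂ → Loop 𝔤 := fun θ => s + θ • P₂ ε s n with hγ
    have hP : P₂ ε s n = covD ε s (ε⁻¹ • n) := by rw [P₂_eq_covD, covD_smul]
    have hn' : ε⁻¹ • n ∈ loopIn d.nil := Submodule.smul_mem _ _ hn
    have h0 : γ 0 = s := by simp [hγ]
    have hγl : ∀ θ, γ θ - Loop.const e ∈ loopIn d.level := fun θ => by
      rw [hγ, add_sub_right_comm]
      refine add_mem hs (Submodule.smul_mem _ _ ?_)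
      rw [hP]
      exact covD_mem_level ε hs hn'
    have key : ∀ k : ℕ, (∀ θ, T^[k] (γ θ) - Loop.const e ∈ loopIn d.level) ∧
        ∃ m ∈ loopIn d.nil, HasDir (fun θ => T^[k] (γ θ)) (covD ε (T^[k] (γ 0)) m) := by
      intro k
      induction k with
      | zero =>
        refine ⟨hγl, _, hn', ?_⟩
        have := HasDir.line s (P₂ ε s n)
        rw [Function.iterate_zero_apply, h0, ← hP]
        exact this
      | succ k ih =>
        obtain ⟨ih1, m, hm, ih2⟩ := ih
        simp only [Function.iterate_succ_apply']
        exact ⟨fun θ => t.step_sub_mem_level ε _ (ih1 θ),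
          t.hasDir_step (by omega) hM hm ih1 ih2⟩
    obtain ⟨-, m, hm, h1⟩ := key K
    have h2 : (fun θ => T^[K] (π (γ θ))) = fun θ => T^[K] (γ θ) := by
      funext θ
      rw [hπ2 _ (hγl θ)]
    change HasDir (fun θ => T^[K] (π (γ θ))) 0
    rw [h2]
    -- The image curve stays in `Q`, so its velocity `(ε∂ + ad) m` takes values in `ker ad f`;
    -- transversality then gives `m = 0`.
    have h3 := (h1.sub (HasDir.const (Loop.const e))).map (Loop.mapL (ad ℂ 𝔤 f))
    have h4 : (fun θ => Loop.mapL (ad ℂ 𝔤 f) (T^[K] (γ θ) - Loop.const e)) = fun _ => 0 := by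
      funext θ
      ext x
      exact hK _ (hγl θ) x
    rw [h4, sub_zero] at h3
    have h5 := h3.unique (HasDir.const 0)
    have h6 : m = 0 := t.eq_zero_of_covD d.toGoodGrading ε (hK _ (hγl 0))
      (loopIn_mono nil_le_range hm) fun x => congrArg (fun q : Loop 𝔤 => q.1 x) h5
    rw [h6] at h1
    have h7 : covD ε (T^[K] (γ 0)) 0 = 0 := by simpa using covD_smul ε 0 (T^[K] (γ 0)) 0
    rwa [h7] at h1

end Gauge

end IsTriple

end Step

end Slice

/-! ## The reduced brackets -/

section Reduction

variable {𝔤 : Type*} [LieRing 𝔤] [LieAlgebra ℂ 𝔤] [FiniteDimensional ℂ 𝔤]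
  [LieAlgebra.IsKilling ℂ 𝔤] {e h f : 𝔤}

open LieAlgebra GoodGrading ReductionDatum

omit [LieAlgebra.IsKilling ℂ 𝔤] in
theorem mem_loopIn_of_pairing {K : Submodule ℂ 𝔤} {v : Loop 𝔤}
    (hv : ∀ s ∈ loopIn K, pairing v s = 0) (x : ℝ) {k : 𝔤} (hk : k ∈ K) :
    killingForm ℂ 𝔤 (v.1 x) k = 0 := killingForm_eq_zero_of_pairing K hv x hk

omit [FiniteDimensional ℂ 𝔤] [LieAlgebra.IsKilling ℂ 𝔤] in
theorem pairing_eq_zero {u v : Loop 𝔤} (h : ∀ x, killingForm ℂ 𝔤 (u.1 x) (v.1 x) = 0) :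
    pairing u v = 0 := by
  simp [pairing, h]

omit [LieAlgebra.IsKilling ℂ 𝔤] in
theorem pairing_nil_ker {d : ReductionDatum e h f} {n s : Loop 𝔤} (hn : n ∈ loopIn d.nil)
    (hs : s ∈ loopIn (LinearMap.ker (ad ℂ 𝔤 f))) : pairing n s = 0 :=
  pairing_eq_zero fun x => killingForm_V (i := -1) (j := 0) (by norm_num)
    (nil_le_V (hn x)) (ker_le_V (Γ := d.toGoodGrading) (hs x))

omit [FiniteDimensional ℂ 𝔤] [LieAlgebra.IsKilling ℂ 𝔤] in
theorem add_smul_mem_Q {z s : Loop 𝔤} (hz : z ∈ Q e f)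
    (hs : s ∈ loopIn (LinearMap.ker (ad ℂ 𝔤 f))) (c : ℂ) : z + c • s ∈ Q e f := fun x => by
  have h1 : ⁅f, s.1 x⁆ = 0 := hs x
  rw [Loop.add_apply, Loop.smul_apply, add_sub_right_comm, lie_add, hz x, lie_smul, h1, smul_zero,
    add_zero]

theorem pairing_grad_eq {F G : localFunctionals 𝔤} (hFG : ∀ z ∈ Q e f, F.1 z = G.1 z)
    {z s : Loop 𝔤} (hz : z ∈ Q e f) (hs : s ∈ loopIn (LinearMap.ker (ad ℂ 𝔤 f))) :
    pairing (grad F z) s = pairing (grad G z) s := by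
  have h1 : (fun θ : ℂ => F.1 (z + θ • s)) = fun θ => G.1 (z + θ • s) :=
    funext fun θ => hFG _ (add_smul_mem_Q hz hs θ)
  have h2 := hasDir_grad_line F z s
  rw [h1] at h2
  exact h2.unique (hasDir_grad_line G z s)

/-- The gradient at `z ∈ Q` of the restriction of `F` to `Q`, lifted in such a way that the
corresponding Hamiltonian vector is tangent to `Q`. -/
structure IsTangentGradient (e f : 𝔤) (ε : ℂ) (F : localFunctionals 𝔤) (z v : Loop 𝔤) : Prop where
  tangent : covD ε z v ∈ loopIn (LinearMap.ker (ad ℂ 𝔤 f))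
  pairing_eq : ∀ s ∈ loopIn (LinearMap.ker (ad ℂ 𝔤 f)), pairing v s = pairing (grad F z) s

namespace IsTangentGradient

variable {ε : ℂ} {F G : localFunctionals 𝔤} {z v w : Loop 𝔤}

theorem of_eqOn (hFG : ∀ z ∈ Q e f, F.1 z = G.1 z) (hz : z ∈ Q e f)
    (hv : IsTangentGradient e f ε F z v) : IsTangentGradient e f ε G z v :=
  ⟨hv.tangent, fun s hs => by rw [hv.pairing_eq s hs, pairing_grad_eq hFG hz hs]⟩

/-- The difference is orthogonal to `ker ad f`, hence takes values in `im ad f`, and its image under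
`ε∂ + ad z` is tangent to `Q`: transversality applies. No reduction datum enters, which is the
source of the independence of choices; the Dynkin grading is merely auxiliary. -/
theorem unique (t : IsTriple e h f) (hz : z ∈ Q e f) (hv : IsTangentGradient e f ε F z v)
    (hw : IsTangentGradient e f ε F z w) : v = w := by
  rw [← sub_eq_zero]
  refine t.eq_zero_of_covD t.dynkin ε hz (fun x => ?_) ?_
  · refine mem_range_of_orthogonal_ker fun k hk => ?_
    refine mem_loopIn_of_pairing (K := LinearMap.ker (ad ℂ 𝔤 f)) (fun s hs => ?_) x hk
    rw [pairing_sub_left, hv.pairing_eq s hs, hw.pairing_eq s hs, sub_self]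
  · rw [covD_sub]
    exact sub_mem hv.tangent hw.tangent

end IsTangentGradient

/-- The functionals that are constant along the distribution at the points of the level surface
defined by `level`. -/
def invariants (d : ReductionDatum e h f) (ε : ℂ) : Submodule ℂ (localFunctionals 𝔤) where
  carrier := {F | ∀ s, s - Loop.const e ∈ loopIn d.level → ∀ n ∈ loopIn d.nil,
    pairing (grad F s) (P₂ ε s n) = 0}
  add_mem' := fun hF hG s hs n hn => by
    rw [grad_add, pairing_add_left, hF s hs n hn, hG s hs n hn, add_zero]
  zero_mem' := fun s _ n _ => by
    have h1 : grad (0 : localFunctionals 𝔤) s = 0 := by simpa using grad_smul 0 0 s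
    rw [h1, pairing_zero_left]
  smul_mem' := fun c F hF s hs n hn => by
    rw [grad_smul, pairing_smul_left, hF s hs n hn, mul_zero]

section

variable {d : ReductionDatum e h f} {ε : ℂ}

omit [FiniteDimensional ℂ 𝔤] [LieAlgebra.IsKilling ℂ 𝔤] in
theorem sub_mem_level_of_mem_S {s : Loop 𝔤} (hs : s ∈ d.S) :
    s - Loop.const e ∈ loopIn d.level := fun x => borel_le_level (hs x)

omit [LieAlgebra.IsKilling ℂ 𝔤] in
theorem Q_subset_S {z : Loop 𝔤} (hz : z ∈ Q e f) : z ∈ d.S := fun x n hn =>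
  killingForm_V (i := -1) (j := 0) (by norm_num) (nil_le_V hn)
    (ker_le_V (Γ := d.toGoodGrading) (hz x))

/-- `invariants` demands more than `IsExtension`: constancy on `e + L level ⊃ S`. The stronger
condition is the one shown to be closed under brackets. -/
theorem isExtension_of_mem_invariants {F : localFunctionals 𝔤} (hF : F ∈ invariants d ε)
    {u : Q e f → ℂ} (hu : ∀ z : Q e f, F.1 z.1 = u z) : IsExtension d ε u F.1 :=
  ⟨F.2, hu, fun s hs n hn => by
    have h1 := (hasDir_grad_line F s (P₂ ε s n)).hasDerivAt
    rwa [hF s (sub_mem_level_of_mem_S hs) n hn] at h1⟩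

theorem IsExtension.pairing_eq_zero {u : Q e f → ℂ} {F : localFunctionals 𝔤}
    (hF : IsExtension d ε u F.1) {s n : Loop 𝔤} (hs : s ∈ d.S) (hn : n ∈ loopIn d.nil) :
    pairing (grad F s) (P₂ ε s n) = 0 :=
  (hasDir_grad_line F s (P₂ ε s n)).hasDerivAt.unique (hF.constant s hs n hn)

/-- Invariance and skewness of `P₂` put `P₂ δF` into `(L𝔫)^⊥ = L𝔟 ⊂ L level`, and such loops split
into distribution and slice parts. Subtracting `n` does not affect pairings with `ker ad f`, because
`𝔫 ⊥ ker ad f`. -/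
theorem IsExtension.exists_tangent (t : IsTriple e h f) (hε : ε ≠ 0) {u : Q e f → ℂ}
    {F : localFunctionals 𝔤} (hF : IsExtension d ε u F.1) {z : Loop 𝔤} (hz : z ∈ Q e f) :
    ∃ n ∈ loopIn d.nil, IsTangentGradient e f ε F z (grad F z - n) := by
  have h1 : covD ε z (grad F z) ∈ loopIn d.level := by
    have h2 : P₂ ε z (grad F z) ∈ loopIn d.borel := fun x n hn => by
      change killingForm ℂ 𝔤 n _ = 0
      rw [LieModule.traceForm_comm]
      refine mem_loopIn_of_pairing (K := d.nil) (fun s hs => ?_) x hn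
      have h3 := hF.pairing_eq_zero (Q_subset_S hz) hs
      rw [P₂_eq_tensor, pairing_tensor, neg_eq_zero] at h3
      rwa [P₂_eq_tensor]
    have h4 : covD ε z (grad F z) = ε • P₂ ε z (grad F z) := by
      rw [P₂_eq_covD, smul_inv_smul₀ hε]
    rw [h4]
    exact Submodule.smul_mem _ _ (loopIn_mono borel_le_level h2)
  obtain ⟨n, hn, h2⟩ := t.exists_sub_covD_mem ε hz h1
  refine ⟨n, hn, by rwa [covD_sub], fun s hs => ?_⟩
  rw [pairing_sub_left, pairing_nil_ker hn hs, sub_zero]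

variable (d ε) in
/-- The condition on a Poisson tensor under which its reduction is defined. -/
def Compatible (c₁ c₂ : ℂ) (b : Loop 𝔤) : Prop :=
  ∃ μ : ℂ, ∀ s, ∀ n ∈ loopIn d.nil, tensor c₁ c₂ b s n = μ • P₂ ε s n

/-- Write `δF = v + n`, `δG = w + m`. The tensor is `μ P₂` on `n` and `m`. The `m` term vanishes as
`F` is invariant, and `(n | P w)` becomes a multiple of `(n | P₂ w)`, zero because `P₂ w` has values
in `ker ad f`. -/
theorem IsExtension.pairing_tensor {c₁ c₂ : ℂ} {b : Loop 𝔤} (hc : Compatible d ε c₁ c₂ b)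
    (t : IsTriple e h f) (hε : ε ≠ 0) {u u' : Q e f → ℂ} {F G : localFunctionals 𝔤}
    (hF : IsExtension d ε u F.1) (hG : IsExtension d ε u' G.1) {z v w : Loop 𝔤} (hz : z ∈ Q e f)
    (hv : IsTangentGradient e f ε F z v) (hw : IsTangentGradient e f ε G z w) :
    pairing (grad F z) (tensor c₁ c₂ b z (grad G z)) = pairing v (tensor c₁ c₂ b z w) := by
  obtain ⟨μ, hμ⟩ := hc
  obtain ⟨n, hn, hFn⟩ := hF.exists_tangent t hε hz
  obtain ⟨m, hm, hGm⟩ := hG.exists_tangent t hε hz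
  have h1 : grad F z = v + n := by rw [hv.unique t hz hFn, sub_add_cancel]
  have h2 : grad G z = w + m := by rw [hw.unique t hz hGm, sub_add_cancel]
  have h3 : pairing n (tensor c₁ c₂ b z w) = 0 := by
    rw [LoopReduction.pairing_tensor, hμ z n hn, pairing_smul_left, P₂_eq_tensor,
      neg_eq_zero, ← neg_neg (pairing _ w), ← LoopReduction.pairing_tensor, ← P₂_eq_tensor,
      P₂_eq_covD, pairing_smul_right, pairing_nil_ker hn hw.tangent, mul_zero, neg_zero, mul_zero]
  rw [h2, tensor_add, pairing_add_right, hμ z m hm, pairing_smul_right,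
    hF.pairing_eq_zero (Q_subset_S hz) hm, mul_zero, add_zero, h1, pairing_add_left, h3, add_zero]

/-- For `μ ≠ 0`, invariance of `F` means `{F, (n | ·)} = 0` on the level surface. In the Jacobi
identity for `(n | ·)`, `F`, `G` the terms `{F, {G, (n | ·)}}` and `{G, {(n | ·), F}}` vanish there.
-/
theorem br_mem_invariants_of_ne {c₁ c₂ μ : ℂ} {b : Loop 𝔤} (hμ0 : μ ≠ 0)
    (hμ : ∀ s, ∀ n ∈ loopIn d.nil, tensor c₁ c₂ b s n = μ • P₂ ε s n) {F G : localFunctionals 𝔤}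
    (hF : F ∈ invariants d ε) (hG : G ∈ invariants d ε) : br c₁ c₂ b F G ∈ invariants d ε := by
  intro s hs n hn
  have key : ∀ F ∈ invariants d ε, ∀ G ∈ invariants d ε,
      (br c₁ c₂ b F (br c₁ c₂ b G (linFun n))).1 s = 0 := by
    intro F hF G hG
    -- A functional vanishing on `e + L level` has its gradient in `L moment` there; as `moment ⊂
    -- 𝔫`, invariance of `F` applies to this gradient.
    have h1 : grad (br c₁ c₂ b G (linFun n)) s ∈ loopIn d.moment := by
      refine fun x => mem_moment_of_orthogonal fun k hk => ?_
      refine mem_loopIn_of_pairing (K := d.level) (fun r hr => ?_) x hk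
      have h2 : (fun θ : ℂ => (br c₁ c₂ b G (linFun n)).1 (s + θ • r)) = fun _ => 0 := by
        funext θ
        rw [br_apply, grad_linFun, hμ _ n hn, pairing_smul_right, hG _ ?_ n hn, mul_zero]
        rw [add_sub_right_comm]
        exact add_mem hs (Submodule.smul_mem _ _ hr)
      have h3 := hasDir_grad_line (br c₁ c₂ b G (linFun n)) s r
      rw [h2] at h3
      exact h3.unique (HasDir.const 0)
    have h2 := loopIn_mono moment_le_nil h1
    rw [br_apply, hμ s _ h2, pairing_smul_right, hF s hs _ h2, mul_zero]
  have h1 := congrArg (fun K : localFunctionals 𝔤 => K.1 s) (br_jacobi (linFun n) F G c₁ c₂ b)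
  have h2 : (br c₁ c₂ b (linFun n) (br c₁ c₂ b F G)).1 s +
      (br c₁ c₂ b F (br c₁ c₂ b G (linFun n))).1 s +
      (br c₁ c₂ b G (br c₁ c₂ b (linFun n) F)).1 s = 0 := h1
  rw [br_skew (linFun n) F, map_neg] at h2
  have h3 : (-br c₁ c₂ b G (br c₁ c₂ b F (linFun n))).1 s =
    -(br c₁ c₂ b G (br c₁ c₂ b F (linFun n))).1 s := rfl
  rw [h3, key F hF G hG, key G hG F hF, neg_zero, add_zero, add_zero, br_apply, pairing_tensor,
    grad_linFun, hμ s n hn, pairing_smul_left, neg_eq_zero, mul_eq_zero, or_iff_right hμ0,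
    pairing_comm] at h2
  exact h2

theorem br_add (c₁ c₂ c₁' c₂' : ℂ) (b b' : Loop 𝔤) (F G : localFunctionals 𝔤) :
    br (c₁ + c₁') (c₂ + c₂') (b + b') F G = br c₁ c₂ b F G + br c₁' c₂' b' F G := by
  refine Subtype.ext (funext fun q => ?_)
  change (br (c₁ + c₁') (c₂ + c₂') (b + b') F G).1 q =
    (br c₁ c₂ b F G).1 q + (br c₁' c₂' b' F G).1 q
  rw [br_apply, br_apply, br_apply, ← pairing_add_right]
  congr 1
  simp only [tensor, add_smul, add_lie]
  abel

theorem br_mem_invariants {c₁ c₂ : ℂ} {b : Loop 𝔤} (hc : Compatible d ε c₁ c₂ b)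
    {F G : localFunctionals 𝔤} (hF : F ∈ invariants d ε) (hG : G ∈ invariants d ε) :
    br c₁ c₂ b F G ∈ invariants d ε := by
  obtain ⟨μ, hμ⟩ := hc
  -- For `μ = 0`, as for `P₁`, brackets with `(n | ·)` carry no information. The bracket is then the
  -- difference of two brackets with `μ = 1`, obtained by adding `P₂`.
  rcases eq_or_ne μ 0 with rfl | h0
  · have h1 : br (ε⁻¹ * ε) ε⁻¹ 0 F G ∈ invariants d ε :=
      br_mem_invariants_of_ne one_ne_zero (fun s n _ => by rw [P₂_eq_tensor, one_smul]) hF hG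
    have h2 : br (c₁ + ε⁻¹ * ε) (c₂ + ε⁻¹) (b + 0) F G ∈ invariants d ε := by
      refine br_mem_invariants_of_ne one_ne_zero (fun s n hn => ?_) hF hG
      have h3 := hμ s n hn
      rw [one_smul, P₂_eq_tensor, ← zero_add (tensor (ε⁻¹ * ε) _ _ _ _), ← zero_smul ℂ (P₂ ε s n),
        ← h3]
      simp only [tensor, add_smul, add_lie]
      abel
    rw [br_add] at h2
    simpa using sub_mem h2 h1
  · exact br_mem_invariants_of_ne h0 hμ hF hG

end

section

variable (t : IsTriple e h f) (d : ReductionDatum e h f) (ε : ℂ)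

/-- The invariant extension of functionals on `Q` provided by a retraction. -/
theorem exists_extend (t : IsTriple e h f) (d : ReductionDatum e h f) (ε : ℂ) :
    ∃ E : localFunctionalsOn (Q e f) →ₗ[ℂ] localFunctionals 𝔤,
    ∀ u, E u ∈ invariants d ε ∧ ∀ z : Q e f, (E u).1 z.1 = u.1 z := by
  obtain ⟨ρ, hρ, hQ, hid, hinv⟩ := t.exists_retraction d ε
  have hloc : ∀ u : localFunctionalsOn (Q e f),
      ∃ F : localFunctionals 𝔤, ∀ z (hz : z ∈ Q e f), F.1 z = u.1 ⟨z, hz⟩ := by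
    rintro ⟨_, F, hF, rfl⟩
    exact ⟨⟨F, hF⟩, fun z hz => rfl⟩
  refine ⟨{ toFun := fun u => ⟨fun q => u.1 ⟨ρ q, hQ q⟩, ?_⟩
            map_add' := fun u v => rfl
            map_smul' := fun c u => rfl }, fun u => ⟨fun s hs n hn => ?_, fun z => ?_⟩⟩
  · obtain ⟨F, hF⟩ := hloc u
    have h1 : (fun q => u.1 ⟨ρ q, hQ q⟩) = fun q => F.1 (ρ q) := funext fun q => (hF _ _).symm
    rw [h1]
    exact localFunctionals_comp F.2 hρ
  · obtain ⟨F, hF⟩ := hloc u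
    have h1 := hasDir_grad F (hinv s hs n hn)
    rw [pairing_zero_right] at h1
    refine HasDir.unique (hasDir_grad_line _ s (P₂ ε s n)) ?_
    convert h1 using 2 with θ
    exact (hF _ _).symm
  · change u.1 ⟨ρ z.1, _⟩ = u.1 z
    exact congrArg u.1 (Subtype.ext (hid z.1 z.2))

/-- A choice of invariant extensions. -/
def extend : localFunctionalsOn (Q e f) →ₗ[ℂ] localFunctionals 𝔤 := (exists_extend t d ε).choose

theorem extend_mem (u : localFunctionalsOn (Q e f)) : extend t d ε u ∈ invariants d ε :=
  ((exists_extend t d ε).choose_spec u).1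

theorem extend_apply (u : localFunctionalsOn (Q e f)) (z : Q e f) :
    (extend t d ε u).1 z.1 = u.1 z :=
  ((exists_extend t d ε).choose_spec u).2 z

theorem isExtension_extend (u : localFunctionalsOn (Q e f)) :
    IsExtension d ε u.1 (extend t d ε u).1 :=
  isExtension_of_mem_invariants (extend_mem t d ε u) (extend_apply t d ε u)

variable (c₁ c₂ : ℂ) (b : Loop 𝔤)

/-- The bracket on `Q` defined by the invariant extensions. -/
def redBr : LocalBracket (Q e f) :=
  ((br c₁ c₂ b).compl₁₂ (extend t d ε) (extend t d ε)).compr₂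
    ((LinearMap.funLeft ℂ ℂ (Subtype.val : Q e f → Loop 𝔤)).submoduleMap (localFunctionals 𝔤))

theorem redBr_apply (u v : localFunctionalsOn (Q e f)) (z : Q e f) :
    (redBr t d ε c₁ c₂ b u v).1 z = (br c₁ c₂ b (extend t d ε u) (extend t d ε v)).1 z.1 := rfl

theorem redBr_pencil (c₁' c₂' : ℂ) (b' : Loop 𝔤) :
    redBr t d ε (c₁ + c₁') (c₂ + c₂') (b + b') =
      redBr t d ε c₁ c₂ b + redBr t d ε c₁' c₂' b' := by
  ext u v z
  rw [redBr_apply, br_add]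
  rfl

variable {d ε c₁ c₂ b} {t}

theorem exists_isTangentGradient (hε : ε ≠ 0) {F : localFunctionals 𝔤}
    {u : localFunctionalsOn (Q e f)} (hF : ∀ z : Q e f, F.1 z.1 = u.1 z) (d : ReductionDatum e h f)
    (t : IsTriple e h f) (z : Q e f) : ∃ v, IsTangentGradient e f ε F z.1 v := by
  obtain ⟨n, -, hn⟩ := (isExtension_extend t d ε u).exists_tangent t hε z.2
  exact ⟨_, hn.of_eqOn (fun z hz => by rw [extend_apply t d ε u ⟨z, hz⟩, hF ⟨z, hz⟩]) z.2⟩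

/-- The bracket of invariant extensions does not depend on any choices. -/
theorem bracket_eq (t : IsTriple e h f) (hε : ε ≠ 0) {d d' : ReductionDatum e h f}
    (hc : Compatible d ε c₁ c₂ b) (hc' : Compatible d' ε c₁ c₂ b)
    {u v : localFunctionalsOn (Q e f)} {F G F' G' : localFunctionals 𝔤}
    (hF : IsExtension d ε u.1 F.1) (hG : IsExtension d ε v.1 G.1)
    (hF' : IsExtension d' ε u.1 F'.1) (hG' : IsExtension d' ε v.1 G'.1) (z : Q e f) :
    (br c₁ c₂ b F G).1 z.1 = (br c₁ c₂ b F' G').1 z.1 := by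
  obtain ⟨p, hp⟩ := exists_isTangentGradient hε hF.restrict d t z
  obtain ⟨q, hq⟩ := exists_isTangentGradient hε hG.restrict d t z
  rw [br_apply, br_apply, hF.pairing_tensor hc t hε hG z.2 hp hq,
    hF'.pairing_tensor hc' t hε hG' z.2
    (hp.of_eqOn (fun z hz => (hF.restrict ⟨z, hz⟩).trans (hF'.restrict ⟨z, hz⟩).symm) z.2)
    (hq.of_eqOn (fun z hz => (hG.restrict ⟨z, hz⟩).trans (hG'.restrict ⟨z, hz⟩).symm) z.2)]

theorem redBr_eq (t : IsTriple e h f) (hε : ε ≠ 0) {d d' : ReductionDatum e h f}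
    (hc : Compatible d ε c₁ c₂ b) (hc' : Compatible d' ε c₁ c₂ b) :
    redBr t d ε c₁ c₂ b = redBr t d' ε c₁ c₂ b := by
  ext u v z
  exact bracket_eq t hε hc hc' (isExtension_extend t d ε u) (isExtension_extend t d ε v)
    (isExtension_extend t d' ε u) (isExtension_extend t d' ε v) z

/-- Evaluation on the chosen extensions determines the bracket; conversely, `bracket_eq` lets any
other extensions replace them. -/
theorem isReducedBracket_iff (t : IsTriple e h f) (hε : ε ≠ 0) (hc : Compatible d ε c₁ c₂ b)
    {B : LocalBracket (Q e f)} :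
    IsReducedBracket d ε (tensor c₁ c₂ b) B ↔ B = redBr t d ε c₁ c₂ b := by
  constructor
  · rintro ⟨-, hB⟩
    ext u v z
    obtain ⟨p, q, hp, hq, hpq⟩ :=
      hB u v _ _ (isExtension_extend t d ε u) (isExtension_extend t d ε v) z
    rw [redBr_apply, br_apply, ← hpq, grad_eq _ hp, grad_eq _ hq]
  · rintro rfl
    refine ⟨fun u => ⟨_, isExtension_extend t d ε u⟩, fun u v F G hF hG z => ?_⟩
    refine ⟨_, _, isGradient_grad ⟨F, hF.isLocal⟩ z.1, isGradient_grad ⟨G, hG.isLocal⟩ z.1, ?_⟩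
    exact bracket_eq t hε hc hc (F := ⟨F, hF.isLocal⟩) (G := ⟨G, hG.isLocal⟩) hF hG
      (isExtension_extend t d ε u) (isExtension_extend t d ε v) z

theorem redBr_isPoisson (t : IsTriple e h f) (hε : ε ≠ 0) (hc : Compatible d ε c₁ c₂ b) :
    (redBr t d ε c₁ c₂ b).IsPoisson := by
  constructor
  · intro u v
    ext z
    change _ = -(redBr t d ε c₁ c₂ b v u).1 z
    rw [redBr_apply, br_skew]
    rfl
  -- The extension of the reduced bracket and the bracket of the extensions are both invariant and
  -- agree on `Q`, so nested brackets can be computed on the loop algebra.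
  · have key : ∀ (u v w : localFunctionalsOn (Q e f)) (z : Q e f),
        (redBr t d ε c₁ c₂ b u (redBr t d ε c₁ c₂ b v w)).1 z = (br c₁ c₂ b (extend t d ε u)
          (br c₁ c₂ b (extend t d ε v) (extend t d ε w))).1 z.1 := fun u v w z =>
      bracket_eq t hε hc hc (isExtension_extend t d ε u) (isExtension_extend t d ε _)
        (isExtension_extend t d ε u) (isExtension_of_mem_invariants
          (br_mem_invariants hc (extend_mem t d ε v) (extend_mem t d ε w)) fun z => rfl) z
    intro u v w
    ext z
    change (redBr t d ε c₁ c₂ b u (redBr t d ε c₁ c₂ b v w)).1 z +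
      (redBr t d ε c₁ c₂ b v (redBr t d ε c₁ c₂ b w u)).1 z +
      (redBr t d ε c₁ c₂ b w (redBr t d ε c₁ c₂ b u v)).1 z = 0
    rw [key, key, key]
    exact congrArg (fun K : localFunctionals 𝔤 => K.1 z.1) (br_jacobi (extend t d ε u)
      (extend t d ε v) (extend t d ε w) c₁ c₂ b)

end

/-! ### Existence and uniqueness of the reduction -/

section

variable {d : ReductionDatum e h f} {ε : ℂ} {a : 𝔤}

omit [LieAlgebra.IsKilling ℂ 𝔤] in
theorem compatible_pencil (ha : d.Adapted a) (α β : ℂ) :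
    Compatible d ε (α * (ε⁻¹ * ε)) (α * ε⁻¹) (β • ε⁻¹ • Loop.const a) := by
  refine ⟨α, fun s n hn => ?_⟩
  have h1 : P₁ ε a s n = 0 := by
    ext x
    change ε⁻¹ • ⁅a, n.1 x⁆ = 0
    rw [ha _ (hn x), smul_zero]
  rw [← pencil_eq_tensor, h1, smul_zero, add_zero]

omit [LieAlgebra.IsKilling ℂ 𝔤] in
theorem compatible_P₂ : Compatible d ε (ε⁻¹ * ε) ε⁻¹ 0 :=
  ⟨1, fun s n _ => by rw [P₂_eq_tensor, one_smul]⟩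

omit [LieAlgebra.IsKilling ℂ 𝔤] in
theorem compatible_P₁ (ha : d.Adapted a) : Compatible d ε 0 0 (ε⁻¹ • Loop.const a) := by
  simpa using compatible_pencil (ε := ε) ha 0 1

/-- The reduction data defined by the Dynkin grading. -/
def IsTriple.dynkinDatum (t : IsTriple e h f) : ReductionDatum e h f where
  toGoodGrading := t.dynkin
  iso := ⊥
  iso_le := bot_le
  isotropic := fun x hx y _ => by rw [(Submodule.mem_bot ℂ).1 hx, zero_lie, map_zero]

theorem exists_reduction (t : IsTriple e h f) (hε : ε ≠ 0) :
    ∃ W : LocalBracket (Q e f), ∀ a : 𝔤, ∃ B : LocalBracket (Q e f), IsBihamiltonian B W ∧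
      ∀ d : ReductionDatum e h f, d.Adapted a →
        ∀ B₁ B₂ : LocalBracket (Q e f), IsReduction d ε a B₁ B₂ ↔ B₁ = B ∧ B₂ = W := by
  -- `P₂` is compatible with every datum, so its reduction can be fixed before `a`, using the Dynkin
  -- grading with `𝔩 = 0`.
  refine ⟨redBr t t.dynkinDatum ε (ε⁻¹ * ε) ε⁻¹ 0, fun a => ?_⟩
  by_cases ha : ∃ d : ReductionDatum e h f, d.Adapted a
  · obtain ⟨d, hd⟩ := ha
    refine ⟨redBr t d ε 0 0 (ε⁻¹ • Loop.const a), ⟨redBr_isPoisson t hε (compatible_P₁ hd),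
      redBr_isPoisson t hε compatible_P₂, fun c => ?_⟩, fun d' hd' B₁ B₂ => ?_⟩
    · have h1 := redBr_isPoisson t hε (compatible_pencil (ε := ε) hd 1 c)
      have h2 : redBr t d ε 0 0 (c • ε⁻¹ • Loop.const a) =
          c • redBr t d ε 0 0 (ε⁻¹ • Loop.const a) := by
        ext u v z
        change pairing _ _ = c * pairing _ _
        rw [← pairing_smul_right]
        simp only [tensor, zero_smul, zero_add, smul_lie]
      have h3 := redBr_pencil t d ε (ε⁻¹ * ε) ε⁻¹ 0 0 0 (c • ε⁻¹ • Loop.const a)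
      rw [add_zero, add_zero, zero_add, h2] at h3
      rwa [one_mul, one_mul, h3, ← redBr_eq t hε (d := t.dynkinDatum) compatible_P₂
        compatible_P₂] at h1
    · rw [IsReduction, P₁_eq_tensor, P₂_eq_tensor,
        isReducedBracket_iff t hε (compatible_P₁ hd'), isReducedBracket_iff t hε compatible_P₂,
        redBr_eq t hε (compatible_P₁ hd') (compatible_P₁ hd),
        redBr_eq t hε compatible_P₂ (compatible_P₂ (d := t.dynkinDatum))]
  -- If no choice is adapted to `a`, nothing constrains the first bracket and the zero bracket
  -- serves.
  · have h1 := redBr_isPoisson t hε (compatible_P₂ (d := t.dynkinDatum) (ε := ε))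
    refine ⟨0, ⟨⟨fun u v => ?_, fun u v w => ?_⟩, h1, fun c => ?_⟩, fun d hd => absurd ⟨d, hd⟩ ha⟩
    · simp
    · simp
    · rwa [smul_zero, add_zero]

end

end Reduction

/-! ## The adjoint group -/

section Adjoint

variable {𝔤 : Type*} [LieRing 𝔤] [LieAlgebra ℂ 𝔤] [FiniteDimensional ℂ 𝔤]

open LieAlgebra GoodGrading

/-- The Leibniz rule for divided powers, summed coordinatewise: the double series is a Cauchy
product of absolutely convergent series. -/
theorem lie_of_hasSum {φ : 𝔤 → 𝔤} {x : 𝔤}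
    (hφ : ∀ (y : 𝔤) (ℓ : Module.Dual ℂ 𝔤),
      HasSum (fun n : ℕ => (n.factorial : ℂ)⁻¹ * ℓ (((ad ℂ 𝔤 x) ^ n) y)) (ℓ (φ y))) (y z : 𝔤) :
    φ ⁅y, z⁆ = ⁅φ y, φ z⁆ := by
  have hd : ∀ (y : 𝔤) (ℓ : Module.Dual ℂ 𝔤), HasSum (fun n => ℓ (dpow x n y)) (ℓ (φ y)) := by
    intro y ℓ
    convert hφ y ℓ using 2 with n
    simp [dpow]
  set β := Module.finBasis ℂ 𝔤
  have hb : ∀ (ℓ : Module.Dual ℂ 𝔤) (u v : 𝔤),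
      ℓ ⁅u, v⁆ = ∑ i, ∑ j, β.coord i u * β.coord j v * ℓ ⁅β i, β j⁆ := by
    intro ℓ u v
    conv_lhs => rw [← β.sum_repr u, ← β.sum_repr v]
    simp only [sum_lie_sum, smul_lie, lie_smul, map_sum, map_smul, smul_eq_mul,
      Module.Basis.coord_apply]
    exact Finset.sum_congr rfl fun i _ => Finset.sum_congr rfl fun j _ => by ring
  rw [← sub_eq_zero, ← Module.forall_dual_apply_eq_zero_iff ℂ]
  intro ℓ
  rw [map_sub, sub_eq_zero, hb]
  refine (hd ⁅y, z⁆ ℓ).unique ?_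
  have h1 : ∀ k, ℓ (dpow x k ⁅y, z⁆) =
      ∑ i, ∑ j, (∑ p ∈ Finset.HasAntidiagonal.antidiagonal k,
        β.coord i (dpow x p.1 y) * β.coord j (dpow x p.2 z)) * ℓ ⁅β i, β j⁆ := by
    intro k
    rw [dpow_lie, map_sum, Finset.sum_congr rfl fun p _ => hb ℓ _ _, Finset.sum_comm]
    refine Finset.sum_congr rfl fun i _ => ?_
    rw [Finset.sum_comm]
    refine Finset.sum_congr rfl fun j _ => ?_
    rw [Finset.sum_mul]
  simp only [h1]
  refine hasSum_sum fun i _ => hasSum_sum fun j _ => HasSum.mul_right _ ?_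
  have hi := hd y (β.coord i)
  have hj := hd z (β.coord j)
  rw [← hi.tsum_eq, ← hj.tsum_eq,
    tsum_mul_tsum_eq_tsum_sum_antidiagonal_of_summable_norm hi.summable.norm hj.summable.norm]
  exact (summable_norm_sum_mul_antidiagonal_of_summable_norm hi.summable.norm
    hj.summable.norm).of_norm.hasSum

theorem adjointGroup_lie {φ : 𝔤 ≃ₗ[ℂ] 𝔤} (hφ : φ ∈ adjointGroup 𝔤) (y z : 𝔤) :
    φ ⁅y, z⁆ = ⁅φ y, φ z⁆ := by
  induction hφ using Subgroup.closure_induction generalizing y z with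
  | mem φ hφ =>
    obtain ⟨x, hx⟩ := hφ
    exact lie_of_hasSum hx y z
  | one => rfl
  | mul φ ψ _ _ h1 h2 => exact (congrArg φ (h2 y z)).trans (h1 _ _)
  | inv φ _ h1 =>
    apply φ.injective
    rw [h1]
    change φ (φ.symm _) = ⁅φ (φ.symm _), φ (φ.symm _)⁆
    simp only [LinearEquiv.apply_symm_apply]

omit [FiniteDimensional ℂ 𝔤] in
theorem killingForm_map {φ : 𝔤 ≃ₗ[ℂ] 𝔤} (hφ : ∀ y z, φ ⁅y, z⁆ = ⁅φ y, φ z⁆) (y z : 𝔤) :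
    killingForm ℂ 𝔤 (φ y) (φ z) = killingForm ℂ 𝔤 y z :=
  LieAlgebra.killingForm_of_equiv_apply ({ φ with map_lie' := fun {y z} => hφ y z } : 𝔤 ≃ₗ⁅ℂ⁆ 𝔤) y z

theorem exists_adjointGroup_expAd {n : 𝔤} {M : ℕ} (hn : (ad ℂ 𝔤 n) ^ M = 0) :
    ∃ φ ∈ adjointGroup 𝔤, ∀ y, φ y = expAd (M + 1) n y := by
  have h1 : Function.Surjective (expAd (M + 1) n) := expAd_surjective hn
  refine ⟨LinearEquiv.ofBijective _ ⟨LinearMap.injective_iff_surjective.2 h1, h1⟩,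
    Subgroup.subset_closure ⟨n, fun y ℓ => ?_⟩, fun y => rfl⟩
  change HasSum _ (ℓ (expAd (M + 1) n y))
  rw [expAd_apply, map_sum]
  simp only [dpow, LinearMap.smul_apply, map_smul, smul_eq_mul]
  refine hasSum_sum_of_ne_finset_zero fun k hk => ?_
  rw [Finset.mem_range, not_lt] at hk
  rw [pow_eq_zero_of_le (by omega) hn, LinearMap.zero_apply, map_zero, mul_zero]

theorem GoodGrading.exists_ad_pow_eq_zero' {e h f : 𝔤} (Γ : GoodGrading e h f) :
    ∃ M : ℕ, ∀ n ∈ Γ.V (-1), (ad ℂ 𝔤 n) ^ M = 0 := by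
  obtain ⟨M, hM⟩ := Γ.exists_ad_pow_eq_zero
  refine ⟨M, fun n hn => ?_⟩
  ext1 y
  have h1 : ∀ k : ℕ, ((ad ℂ (Loop 𝔤) (Loop.const n)) ^ k) (Loop.const y) =
      Loop.const (((ad ℂ 𝔤 n) ^ k) y) := by
    intro k
    induction k with
    | zero => rfl
    | succ k ih =>
      rw [pow_succ', pow_succ', Module.End.mul_apply, Module.End.mul_apply, ih]
      rfl
  have h2 := h1 M
  rw [hM _ fun _ => hn] at h2
  exact (congrArg (fun q : Loop 𝔤 => q.1 0) h2).symm

/-! ### Conjugacy of triples with the same nilpotent element -/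

section Conjugacy

variable {e h f : 𝔤}

omit [FiniteDimensional ℂ 𝔤] in
theorem IsTriple.map {φ : 𝔤 ≃ₗ[ℂ] 𝔤} (hφ : ∀ y z, φ ⁅y, z⁆ = ⁅φ y, φ z⁆) (t : IsTriple e h f) :
    IsTriple (φ e) (φ h) (φ f) where
  lie_h_e := by rw [← hφ, t.lie_h_e, map_smul]
  lie_h_f := by rw [← hφ, t.lie_h_f, map_neg, map_smul]
  lie_e_f := by rw [← hφ, t.lie_e_f]

/-- `ker ad f` lies in degrees at most `0`. The degree-zero component `w₀` commutes with `f` and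
`h`, so `[f, [e, w₀]] = 0`; injectivity in degree `2` gives `[e, w₀] = 0`, and `ker ad e ∩ im ad f =
0`. -/
theorem IsTriple.mem_V_of_ker_range (t : IsTriple e h f) {w : 𝔤} (hw : ⁅f, w⁆ = 0)
    (hr : w ∈ LinearMap.range (ad ℂ 𝔤 f)) : w ∈ t.dynkin.V (-1) := by
  refine mem_V.2 fun i hi => ?_
  rcases eq_or_ne i 0 with rfl | h0
  · obtain ⟨y, rfl⟩ := hr
    set w₀ := proj t.dynkin.isInternal 0 (ad ℂ 𝔤 f y) with hw₀
    have h1 : w₀ = ⁅f, proj t.dynkin.isInternal (0 + 2) y⁆ := by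
      have h2 := proj_map t.dynkin.isInternal f_hom (0 + 2) y
      rw [add_neg_cancel_right] at h2
      exact h2
    have h2 : w₀ ∈ t.dynkin.comp 0 := proj_mem _ _ _
    have h3 : ⁅f, w₀⁆ = 0 := proj_ker hw 0
    have h4 : ⁅h, w₀⁆ = 0 := by
      have h5 := Module.End.mem_eigenspace_iff.1 h2
      rwa [Int.cast_zero, zero_smul] at h5
    refine t.eq_zero_of_ker_range ?_ h1
    rw [← h1]
    refine t.dynkin.injective 2 (by norm_num) _ ?_ ?_
    · have := t.dynkin.lie_mem 2 0 e t.dynkin.e_mem w₀ h2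
      rwa [add_zero] at this
    · rw [leibniz_lie, h3, lie_zero, add_zero, ← lie_skew f e, t.lie_e_f, neg_lie, h4, neg_zero]
  · exact mem_V.1 (ker_le_V hw) i (by omega)

/-- `h' - h = [f, e - e']` commutes with `f`, so it lies in negative degrees, where unipotent
elements fixing `f` remove it from the top down. Once `h' = h`, injectivity of `ad f` in degree `2`
forces `e' = e`. -/
theorem IsTriple.exists_conj (t : IsTriple e h f) {e' h' : 𝔤} (t' : IsTriple e' h' f) :
    ∃ φ ∈ adjointGroup 𝔤, φ e' = e ∧ φ h' = h ∧ φ f = f := by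
  obtain ⟨M, hM⟩ := t.dynkin.exists_ad_pow_eq_zero'
  have hfh : ⁅f, h⁆ = (2 : ℂ) • f := by rw [← lie_skew, t.lie_h_f, neg_neg]
  have hfh' : ⁅f, h'⁆ = (2 : ℂ) • f := by rw [← lie_skew, t'.lie_h_f, neg_neg]
  have key : ∀ k : ℕ, ∃ φ ∈ adjointGroup 𝔤, φ f = f ∧ φ h' - h ∈ t.dynkin.V (-1 - k) := by
    intro k
    induction k with
    | zero =>
      refine ⟨1, one_mem _, rfl, ?_⟩
      rw [Nat.cast_zero, sub_zero]
      refine t.mem_V_of_ker_range ?_ ⟨e - e', ?_⟩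
      · change ⁅f, h' - h⁆ = 0
        rw [lie_sub, hfh, hfh', sub_self]
      · change ⁅f, e - e'⁆ = h' - h
        rw [← lie_skew, sub_lie, t.lie_e_f, t'.lie_e_f, neg_sub]
    | succ k ih =>
      obtain ⟨φ, hφ, hf, hw⟩ := ih
      set j : ℤ := -1 - k with hj
      set w := φ h' - h with hwdef
      have hwf : ⁅f, w⁆ = 0 := by
        have h1 : ⁅f, φ h'⁆ = (2 : ℂ) • f := by
          nth_rw 1 [← hf]
          rw [← adjointGroup_lie hφ, hfh', map_smul, hf]
        rw [hwdef, lie_sub, hfh, h1, sub_self]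
      set y := proj t.dynkin.isInternal j w with hy
      have hyc : y ∈ t.dynkin.comp j := proj_mem _ _ _
      have hj0 : (j : ℂ) ≠ 0 := Int.cast_ne_zero.2 (by omega)
      -- Chosen so that `[u, h] = -y`: `exp(ad u)` cancels the leading component `y` of `φ h' - h`,
      -- and it fixes `f` because `[u, f] = 0`.
      set u := (j : ℂ)⁻¹ • y with hu
      have huV : u ∈ t.dynkin.V j := Submodule.smul_mem _ _ (comp_le_V le_rfl hyc)
      have huf : ⁅u, f⁆ = 0 := by
        rw [← lie_skew, hu, lie_smul, proj_ker hwf, smul_zero, neg_zero]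
      have huh : ⁅u, h⁆ = -y := by
        have h1 : ⁅h, y⁆ = (j : ℂ) • y := Module.End.mem_eigenspace_iff.1 hyc
        rw [← lie_skew, hu, lie_smul, h1, inv_smul_smul₀ hj0]
      obtain ⟨ψ, hψ, hψe⟩ := exists_adjointGroup_expAd
        (pow_eq_zero_of_le (Nat.le_succ M) (hM u (V_mono (by omega) huV)))
      refine ⟨ψ * φ, mul_mem hψ hφ, ?_, ?_⟩
      · change ψ (φ f) = f
        rw [hf, hψe, expAd_eq, huf, map_zero, add_zero]
      · change ψ (φ h') - h ∈ _
        have h1 : φ h' = h + w := by rw [hwdef, add_sub_cancel]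
        have h2 : ⁅u, φ h'⁆ = -y + ⁅u, w⁆ := by rw [h1, lie_add, huh]
        have h3 : ⁅u, w⁆ ∈ t.dynkin.V (j - 1) := lie_mem_V (by omega) huV hw
        have h4 : ⁅u, φ h'⁆ ∈ t.dynkin.V j := by
          rw [h2]
          exact add_mem (neg_mem (comp_le_V le_rfl hyc)) (V_mono (by omega) h3)
        have h5 : psiAd (M + 1) u ⁅u, φ h'⁆ - ⁅u, φ h'⁆ ∈ t.dynkin.V (j - 1) :=
          psiAd_sub_mem (fun x hx => lie_mem_V (by omega) huV hx)
            (lie_mem_V (by omega) huV h4) M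
        have h6 : w - y ∈ t.dynkin.V (j - 1) := by
          refine mem_V.2 fun i hi => ?_
          rcases eq_or_ne i j with rfl | hne
          · rw [map_sub, hy, proj_same _ hyc, sub_self]
          · rw [map_sub, mem_V.1 hw i (by omega), proj_ne _ hyc hne, sub_zero]
        have h7 : ψ (φ h') - h = (w - y) + ⁅u, w⁆ +
            (psiAd (M + 1) u ⁅u, φ h'⁆ - ⁅u, φ h'⁆) := by
          rw [hψe, expAd_eq]
          nth_rw 3 [h2]
          rw [hwdef]
          abel
        have h8 : (-1 - ((k + 1 : ℕ) : ℤ)) = j - 1 := by push_cast; omega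
        rw [h7, h8]
        exact add_mem (add_mem h6 h3) h5
  obtain ⟨K, hbot, -⟩ := t.dynkin.exists_bound
  obtain ⟨φ, hφ, hf, hw⟩ := key K
  have h1 := V_mono (j := -(K : ℤ)) (by omega) hw
  rw [hbot, Submodule.mem_bot, sub_eq_zero] at h1
  refine ⟨φ, hφ, ?_, h1, hf⟩
  have t'' := t'.map (adjointGroup_lie hφ)
  rw [h1, hf] at t''
  rw [← sub_eq_zero]
  refine t.dynkin.injective 2 (by norm_num) _ ?_ ?_
  · refine sub_mem (Module.End.mem_eigenspace_iff.2 ?_) t.dynkin.e_mem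
    exact_mod_cast t''.lie_h_e
  · rw [← lie_skew, sub_lie, t''.lie_e_f, t.lie_e_f, sub_self, neg_zero]

end Conjugacy

/-! ### Transport of reduced brackets along automorphisms -/

section Transport

variable [LieAlgebra.IsKilling ℂ 𝔤] {e h f e' h' f' : 𝔤} {φ : 𝔤 ≃ₗ[ℂ] 𝔤}
  (hφ : ∀ y z, φ ⁅y, z⁆ = ⁅φ y, φ z⁆)

omit [FiniteDimensional ℂ 𝔤] [LieAlgebra.IsKilling ℂ 𝔤] in
theorem Loop.map_symm (q : Loop 𝔤) : Loop.map φ (Loop.map φ.symm q) = q := by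
  ext x
  exact φ.apply_symm_apply _

include hφ

omit [FiniteDimensional ℂ 𝔤] [LieAlgebra.IsKilling ℂ 𝔤] in
theorem pairing_map (u v : Loop 𝔤) : pairing (Loop.map φ u) (Loop.map φ v) = pairing u v := by
  simp only [pairing, Loop.map, killingForm_map hφ]

omit [LieAlgebra.IsKilling ℂ 𝔤] in
theorem tensor_map (c₁ c₂ : ℂ) (b q v : Loop 𝔤) :
    tensor c₁ c₂ (Loop.map φ b) (Loop.map φ q) (Loop.map φ v) =
      Loop.map φ (tensor c₁ c₂ b q v) := by
  have h1 : Loop.deriv (Loop.map φ v) = Loop.map φ (Loop.deriv v) :=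
    Loop.deriv_mapL φ.toLinearMap v
  rw [tensor, h1]
  ext x
  change c₁ • φ ((Loop.deriv v).1 x) + ⁅c₂ • φ (q.1 x) + φ (b.1 x), φ (v.1 x)⁆ =
    φ (c₁ • (Loop.deriv v).1 x + ⁅c₂ • q.1 x + b.1 x, v.1 x⁆)
  rw [map_add, map_smul, hφ, map_add, map_smul]

theorem IsTangentGradient.map (e' : 𝔤) {ε : ℂ} (hf : φ f = f') {F F' : localFunctionals 𝔤}
    (hF : ∀ z ∈ Q e f, F'.1 (Loop.map φ z) = F.1 z) {z v : Loop 𝔤} (hz : z ∈ Q e f)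
    (hv : IsTangentGradient e f ε F z v) :
    IsTangentGradient e' f' ε F' (Loop.map φ z) (Loop.map φ v) := by
  constructor
  · have h1 := tensor_map hφ ε 1 0 z v
    have h2 : ∀ s v : Loop 𝔤, covD ε s v = tensor ε 1 0 s v := fun s v => by
      rw [tensor, one_smul, add_zero, covD]
    have h3 : Loop.map φ (0 : Loop 𝔤) = 0 := by
      ext x
      exact map_zero φ
    rw [h3, ← h2, ← h2] at h1
    rw [h1]
    intro x
    have h4 : ⁅f, (covD ε z v).1 x⁆ = 0 := hv.tangent x
    change ⁅f', φ ((covD ε z v).1 x)⁆ = 0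
    rw [← hf, ← hφ, h4, map_zero]
  · intro s hs
    obtain ⟨r, rfl⟩ : ∃ r, s = Loop.map φ r := ⟨_, (Loop.map_symm s).symm⟩
    have hr : r ∈ loopIn (LinearMap.ker (ad ℂ 𝔤 f)) := fun x => by
      apply φ.injective
      have h1 : ⁅f', φ (r.1 x)⁆ = 0 := hs x
      rw [ad_apply, hφ, hf, h1, map_zero]
    rw [pairing_map hφ, hv.pairing_eq r hr]
    refine (hasDir_grad_line F z r).unique ?_
    convert hasDir_grad_line F' (Loop.map φ z) (Loop.map φ r) using 2 with θ
    rw [← hF _ (add_smul_mem_Q hz hr θ)]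
    refine congrArg F'.1 (Loop.ext fun x => ?_)
    change φ (z.1 x + θ • r.1 x) = φ (z.1 x) + θ • φ (r.1 x)
    rw [map_add, map_smul]

/-- Both brackets have the form `(v | P w)` with tangent gradients, and `φ` carries tangent
gradients to tangent gradients. These do not involve the data, so `d'` need not be the image of `d`.
-/
theorem intertwines_redBr (t : IsTriple e h f) (t' : IsTriple e' h' f') (he : φ e = e')
    (hf : φ f = f') {ε : ℂ} (hε : ε ≠ 0) {d : ReductionDatum e h f} {d' : ReductionDatum e' h' f'}
    {c₁ c₂ : ℂ} {b b' : Loop 𝔤} (hb : Loop.map φ b = b') (hc : Compatible d ε c₁ c₂ b)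
    (hc' : Compatible d' ε c₁ c₂ b') :
    Intertwines φ (redBr t d ε c₁ c₂ b) (redBr t' d' ε c₁ c₂ b') := by
  intro u v u' v' hu hv z y hy
  have hQ : ∀ z ∈ Q e f, Loop.map φ z ∈ Q e' f' := fun z hz x => by
    change ⁅f', φ (z.1 x) - e'⁆ = 0
    rw [← he, ← hf, ← map_sub, ← hφ, hz x, map_zero]
  have hext : ∀ (u : localFunctionalsOn (Q e f)) (u' : localFunctionalsOn (Q e' f')),
      (∀ (z : Q e f) (y : Q e' f'), y.1 = Loop.map φ z.1 → u'.1 y = u.1 z) →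
      ∀ z ∈ Q e f, (extend t' d' ε u').1 (Loop.map φ z) = (extend t d ε u).1 z :=
    fun u u' hu z hz => by
      rw [extend_apply t d ε u ⟨z, hz⟩, extend_apply t' d' ε u' ⟨_, hQ z hz⟩]
      exact hu ⟨z, hz⟩ ⟨_, hQ z hz⟩ rfl
  obtain ⟨p, hp⟩ := exists_isTangentGradient hε (extend_apply t d ε u) d t z
  obtain ⟨q, hq⟩ := exists_isTangentGradient hε (extend_apply t d ε v) d t z
  have hp' := hp.map hφ e' hf (hext u u' hu) z.2
  have hq' := hq.map hφ e' hf (hext v v' hv) z.2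
  rw [← hy] at hp' hq'
  rw [redBr_apply, redBr_apply, br_apply, br_apply,
    (isExtension_extend t d ε u).pairing_tensor hc t hε (isExtension_extend t d ε v) z.2 hp hq,
    (isExtension_extend t' d' ε u').pairing_tensor hc' t' hε (isExtension_extend t' d' ε v') y.2
      hp' hq', hy, ← hb, tensor_map hφ, pairing_map hφ]

end Transport

end Adjoint

end

end LoopReduction

open LoopReduction in
theorem theorem3p8 {𝔤 : Type*} [LieRing 𝔤] [LieAlgebra ℂ 𝔤] [FiniteDimensional ℂ 𝔤]
    [LieAlgebra.IsSimple ℂ 𝔤] (ε : ℂ) (hε : ε ≠ 0) :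
    (∀ e h f : 𝔤, IsTriple e h f →
      ∃ W : LocalBracket (Q e f), ∀ a : 𝔤, ∃ B : LocalBracket (Q e f), IsBihamiltonian B W ∧
        ∀ d : ReductionDatum e h f, d.Adapted a →
          ∀ B₁ B₂ : LocalBracket (Q e f), IsReduction d ε a B₁ B₂ ↔ B₁ = B ∧ B₂ = W) ∧
    (∀ e h f e' h' f' : 𝔤, IsTriple e h f → IsTriple e' h' f' →
      (∃ φ ∈ adjointGroup 𝔤, φ f = f') →
      (∃ φ ∈ adjointGroup 𝔤, φ e = e' ∧ φ h = h' ∧ φ f = f') ∧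
      ∀ φ ∈ adjointGroup 𝔤, φ e = e' → φ h = h' → φ f = f' →
        ∀ (d : ReductionDatum e h f) (d' : ReductionDatum e' h' f') (a : 𝔤),
          d.Adapted a → d'.Adapted (φ a) →
          ∀ (B₁ B₂ : LocalBracket (Q e f)) (B₁' B₂' : LocalBracket (Q e' f')),
            IsReduction d ε a B₁ B₂ → IsReduction d' ε (φ a) B₁' B₂' →
            Intertwines φ B₁ B₁' ∧ Intertwines φ B₂ B₂') := by
  refine ⟨fun e h f t => exists_reduction t hε, fun e h f e' h' f' t t' hff' => ⟨?_, ?_⟩⟩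
  · obtain ⟨φ, hφ, hf⟩ := hff'
    have t₁ := t.map (adjointGroup_lie hφ)
    rw [hf] at t₁
    obtain ⟨ψ, hψ, h1, h2, h3⟩ := t'.exists_conj t₁
    exact ⟨ψ * φ, mul_mem hψ hφ, h1, h2, (congrArg ψ hf).trans h3⟩
  · intro φ hφ he _ hf d d' a ha ha' B₁ B₂ B₁' B₂' hB hB'
    rw [IsReduction, P₁_eq_tensor, P₂_eq_tensor, isReducedBracket_iff t hε (compatible_P₁ ha),
      isReducedBracket_iff t hε compatible_P₂] at hB
    rw [IsReduction, P₁_eq_tensor, P₂_eq_tensor, isReducedBracket_iff t' hε (compatible_P₁ ha'),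
      isReducedBracket_iff t' hε compatible_P₂] at hB'
    obtain ⟨rfl, rfl⟩ := hB
    obtain ⟨rfl, rfl⟩ := hB'
    have hl := adjointGroup_lie hφ
    refine ⟨intertwines_redBr hl t t' he hf hε ?_ (compatible_P₁ ha) (compatible_P₁ ha'),
      intertwines_redBr hl t t' he hf hε ?_ compatible_P₂ compatible_P₂⟩
    · ext x
      exact map_smul φ _ _
    · ext x
      exact map_zero φ
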